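/- Let $\mathbb{D}=\{t\in\mathbb{C}:|t|<1\}$, let $\sigma$ be the normalized arc length on $\partial\mathbb{D}$, and let $z\cdot w=\sum_j z_jw_j$ on $\mathbb{C}^n$. For $h$ on $\partial\mathbb{D}$ put $P[h](t)=\int_{\partial\mathbb{D}}\frac{1-|t|^2}{|s-t|^2}\,h(s)\,d\sigma(s)$; for $h$ bounded below with values in $\mathbb{R}\cup\{+\infty\}$, $P[h](t)\in\mathbb{R}\cup\{+\infty\}$. The Hardy space $H^r=H^r(\mathbb{D},\mathbb{C}^n)$ consists of the holomorphic $f:\mathbb{D}\to\mathbb{C}^n$ with $f=P[g]$ for some $g\in L^r(\partial\mathbb{D},\mathbb{C}^n)$; one writes $f(s)=g(s)$ for the boundary values. Let $p\in(1,+\infty]$, $q=p/(p-1)\in[1,\infty)$, and let $\phi:\partial\mathbb{D}\times\mathbb{C}^n\to\mathbb{R}\cup\{+\infty\}$ be Borel measurable such that every $\phi_s=\phi(s,\cdot)$ is convex (that is, $\{\phi_s<\infty\}$ is convex and $\phi_s$ is convex on it). Assume that $\phi$ satisfies the $p$-uniform growth conditions: there are $c,C,A>0$ such that for all $s\in\partial\mathbb{D}$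 and $w\in\mathbb{C}^n$, $$c|w|^p-A\le\phi_s(w)\le C|w|^p+A\quad(p<\infty),\qquad \chi(c|w|)-A\le\phi_s(w)\le\chi(C|w|)+A\quad(p=\infty),$$ where $\chi(x)=0$ for $x\le1$ and $\chi(x)=+\infty$ for $x>1$; if $p=\infty$, assume also that every $\phi_s$ is lower semicontinuous. For $\psi:\mathbb{D}\times\mathbb{C}^n\to\mathbb{R}$ write $\psi\preceq\phi$ on $\partial\mathbb{D}\times\mathbb{C}^n$ if for almost every $s\in\partial\mathbb{D}$ and every $z\in\mathbb{C}^n$, $$\limsup_{(0,1)\times\mathbb{C}^n\ni(r,w)\to(1,z)}\psi(rs,w)\le\phi(s,z).$$ Let $\mu(w)=\sup_{s\in\partial\mathbb{D}}\phi(s,w)$, and for $f_0\in L^1(\partial\mathbb{D},\mathbb{C})$, $f\in H^q$ let $L_{f_0,f}(t,w)=\operatorname{Re}(f(t)\cdot w)-P[\operatorname{Re}f_0](t)$. Define, for $(t,w)\in\mathbb{D}\times\mathbb{C}^n$, with values in $\mathbb{R}\cup\{+\infty\}$, $$\tilde\phi(t,w)=\sup\{L_{f_0,f}(t,w):\ (f_0,f)\in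 L^1\times H^q,\ L_{f_0,f}\preceq\phi\},$$ $$\hat\phi(t,w)=\sup\{\psi(t,w):\ \psi:\mathbb{D}\times\mathbb{C}^n\to\mathbb{R}\text{ plurisubharmonic},\ \psi(t',w')\le\mu(w')\text{ on }\mathbb{D}\times\mathbb{C}^n,\ \psi\preceq\phi\},$$ $$\check\phi(t,w)=\inf\{P[\phi(s,f(s))](t):\ f\in H^p,\ f(t)=w\}.$$ Then $\tilde\phi=\hat\phi=\check\phi$ on $\mathbb{D}\times\mathbb{C}^n$. Moreover, if $p<\infty$, the common value $[\phi]$ is finite and plurisubharmonic on $\mathbb{D}\times\mathbb{C}^n$, and $[\phi]\preceq\phi$ on $\partial\mathbb{D}\times\mathbb{C}^n$. -/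

import Mathlib

open MeasureTheory Filter Topology
open scoped ENNReal

namespace ThreeHulls

/-- The Hermitian space `ℂⁿ` with its Euclidean norm. -/
abbrev Cn (n : ℕ) : Type := EuclideanSpace ℂ (Fin n)

/-- The complex bilinear product `z · w = ∑ zⱼ wⱼ` (no conjugation). -/
noncomputable def dot {n : ℕ} (z w : Cn n) : ℂ := ∑ j, z j * w j

/-- The open unit disc. -/
def disc : Set ℂ := Metric.ball (0 : ℂ) 1

/-- The unit circle carries its Borel sigma-algebra. -/
noncomputable instance circleMeasurableSpace : MeasurableSpace Circle := borel Circle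

instance circleBorelSpace : BorelSpace Circle := ⟨rfl⟩

/-- The normalized arc length `dθ / 2π` on the unit circle. -/
noncomputable def arc : Measure Circle :=
  (ENNReal.ofReal (2 * Real.pi))⁻¹ •
    Measure.map Circle.exp (volume.restrict (Set.Ioc 0 (2 * Real.pi)))

/-- The Poisson kernel of the unit disc, `P(t, s) = (1 - |t|²) / |s - t|²`. -/
noncomputable def kernel (t : ℂ) (s : Circle) : ℝ := poissonKernel 0 t (s : ℂ)

/-- The Poisson integral of an integrable (vector valued) function on the circle. -/
noncomputable def poisson {V : Type*} [NormedAddCommGroup V] [NormedSpace ℝ V]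
    (h : Circle → V) (t : ℂ) : V :=
  ∫ s, kernel t s • h s ∂arc

/-- The Poisson integral of an extended real valued function on the circle: the integral of the
positive part minus the integral of the negative part, with values in `[-∞, ∞]`. It is used
for functions that are bounded from below only, so the second integral is then finite. -/
noncomputable def poissonExt (h : Circle → EReal) (t : ℂ) : EReal :=
  ((∫⁻ s, ENNReal.ofReal (kernel t s) * (h s).toENNReal ∂arc : ℝ≥0∞) : EReal) -
    ((∫⁻ s, ENNReal.ofReal (kernel t s) * (-h s).toENNReal ∂arc : ℝ≥0∞) : EReal)

/-- `f` belongs to the Hardy space `H^r(𝔻, ℂⁿ)`, with boundary values `b ∈ L^r`: it is holomorphic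
in the disc and it is the Poisson integral of `b`. (The function `b` is determined by `f` up to
a null set.) -/
structure IsHardy {n : ℕ} (r : ℝ≥0∞) (f : ℂ → Cn n) (b : Circle → Cn n) : Prop where
  holo : DifferentiableOn ℂ f disc
  memLp : MemLp b r arc
  eq_poisson : ∀ t ∈ disc, f t = poisson b t

/-- A real valued function `u` is plurisubharmonic on the set `Ω` (meant to be open): it is upper
semicontinuous, and it satisfies the sub-mean value inequality on every closed complex disc
contained in `Ω`. As `u` has finite values, its integrals over the boundaries of
such discs have to be finite. -/
def IsPSH {V : Type*} [NormedAddCommGroup V] [NormedSpace ℂ V] (Ω : Set V) (u : V → ℝ) : Prop :=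
  UpperSemicontinuousOn u Ω ∧
    ∀ a v : V, (∀ ζ : ℂ, ‖ζ‖ ≤ 1 → a + ζ • v ∈ Ω) →
      CircleIntegrable (fun ζ : ℂ => u (a + ζ • v)) 0 1 ∧
        u a ≤ Real.circleAverage (fun ζ : ℂ => u (a + ζ • v)) 0 1

/-- The cylinder `𝔻 × ℂⁿ`. -/
def cylinder (n : ℕ) : Set (ℂ × Cn n) := disc ×ˢ Set.univ

/-- `ψ ⪯ φ` on `∂𝔻 × ℂⁿ`: for almost every `s` in the circle and all `z` in `ℂⁿ`, the limsup of
`ψ (r s, w)` as `(0, 1) × ℂⁿ ∋ (r, w) → (1, z)` is at most `φ (s, z)`. -/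
def BoundaryLE {n : ℕ} (ψ : ℂ × Cn n → ℝ) (φ : Circle → Cn n → EReal) : Prop :=
  ∀ᵐ s : Circle ∂arc, ∀ z : Cn n,
    limsup (fun x : ℝ × Cn n => (ψ ((x.1 : ℂ) * (s : ℂ), x.2) : EReal))
      (𝓝[Set.Ioo 0 1] (1 : ℝ) ×ˢ 𝓝 z) ≤ φ s z

/-- A convex function with values in `ℝ ∪ {+∞}`: it is finite and convex on a convex set, and
`+∞` elsewhere. -/
def IsConvexFn {n : ℕ} (g : Cn n → EReal) : Prop :=
  (∀ w, g w ≠ ⊥) ∧ ConvexOn ℝ {w | g w < ⊤} (fun w => (g w).toReal)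

/-- `χ` vanishes on `(-∞, 1]` and equals `+∞` on `(1, ∞)`. -/
noncomputable def chi (x : ℝ) : EReal := if x ≤ 1 then 0 else ⊤

/-- The `p`-uniform growth conditions, `1 < p ≤ ∞`. -/
def UniformGrowth {n : ℕ} (p : ℝ≥0∞) (φ : Circle → Cn n → EReal) : Prop :=
  (∃ c C A : ℝ, 0 < c ∧ 0 < C ∧ 0 < A ∧ ∀ s w,
    (p ≠ ∞ → ((c * ‖w‖ ^ p.toReal - A : ℝ) : EReal) ≤ φ s w ∧
      φ s w ≤ ((C * ‖w‖ ^ p.toReal + A : ℝ) : EReal)) ∧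
    (p = ∞ → chi (c * ‖w‖) - (A : EReal) ≤ φ s w ∧ φ s w ≤ chi (C * ‖w‖) + (A : EReal))) ∧
  (p = ∞ → ∀ s, LowerSemicontinuous (φ s))

/-- `L_{f₀,f}(t, w) = Re (f(t) · w) - P[Re f₀](t)`. -/
noncomputable def affineFn {n : ℕ} (f₀ : Circle → ℂ) (f : ℂ → Cn n) (x : ℂ × Cn n) : ℝ :=
  (dot (f x.1) x.2).re - poisson (fun s => (f₀ s).re) x.1

/-- The hull `φ̃`: the supremum of the functions `L_{f₀,f} ⪯ φ` with `f₀ ∈ L¹` and `f ∈ H^q`, where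
`q = p / (p - 1)` is the conjugate exponent. -/
noncomputable def hullTilde {n : ℕ} (p : ℝ≥0∞) (φ : Circle → Cn n → EReal) (t : ℂ) (w : Cn n) :
    EReal :=
  sSup {x | ∃ (f₀ : Circle → ℂ) (f : ℂ → Cn n) (b : Circle → Cn n),
    MemLp f₀ 1 arc ∧ IsHardy p.conjExponent f b ∧ BoundaryLE (affineFn f₀ f) φ ∧
      x = (affineFn f₀ f (t, w) : EReal)}

/-- `μ(w) = sup_s φ(s, w)`. -/
noncomputable def fiberSup {n : ℕ} (φ : Circle → Cn n → EReal) (w : Cn n) : EReal := ⨆ s, φ s w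

/-- The hull `φ̂`: the Perron–Bremermann envelope, i.e. the supremum of the plurisubharmonic
functions `ψ` on `𝔻 × ℂⁿ` with `ψ ≤ μ` there and `ψ ⪯ φ` on the boundary. -/
noncomputable def hullHat {n : ℕ} (φ : Circle → Cn n → EReal) (t : ℂ) (w : Cn n) : EReal :=
  sSup {x | ∃ ψ : ℂ × Cn n → ℝ,
    IsPSH (cylinder n) ψ ∧ (∀ y ∈ cylinder n, (ψ y : EReal) ≤ fiberSup φ y.2) ∧
      BoundaryLE ψ φ ∧ x = (ψ (t, w) : EReal)}

/-- The hull `φ̌`: the infimum of the Poisson integrals `P[φ(s, f(s))](t)` over all `f ∈ H^p` with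
`f(t) = w`. -/
noncomputable def hullCheck {n : ℕ} (p : ℝ≥0∞) (φ : Circle → Cn n → EReal) (t : ℂ) (w : Cn n) :
    EReal :=
  sInf {x | ∃ (f : ℂ → Cn n) (b : Circle → Cn n),
    IsHardy p f b ∧ f t = w ∧ x = poissonExt (fun s => φ s (b s)) t}

end ThreeHulls

/-! The three hulls are compared in a cycle: `hullTilde ≤ hullHat ≤ hullCheck ≤ hullTilde`.

The first inequality holds because `L_{f₀,f}` is locally the real part of a holomorphic function
along complex lines, hence plurisubharmonic, and because it is the Poisson integral of its boundary
values, which lie below `φ(s, w) ≤ μ(w)`.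

For the second, let `ψ` compete for `hullHat` and let `f ∈ H^p`. Plurisubharmonicity is given on
affine discs only; a maximum principle with a quadratic penalty for leaving the curve extends the
sub-mean value inequality to holomorphic curves (`psh_curve_le_poisson`). It is applied to the
dilates `f(r·)`, and `r → 1` follows from Fatou's lemma once `ψ(t, f(t))` is dominated by some
Poisson integral (`psh_curve_le_poisson_boundary`). If `p < ∞`, Jensen's inequality and `μ(w) ≤
C|w|^p + A` give the domination. If `p = ∞`, `μ` can be infinite off a ball. Then the curve is
multiplied by a holomorphic function that equals 1 at the point of evaluation and is tiny on the
small set of the circle where the boundary estimate is not yet reached (`exists_damping`); there `ψ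
≤ A`. This works for `ξ f` with `ξ` in discs that touch 1 as they shrink, by convexity of `φ_s`; one
more sub-mean value argument in `ξ` reaches `ξ = 1`.

The third inequality is convex duality. With `ω` the harmonic measure at `t` and `T` the value of
`hullTilde`, the choice `f₀ = φ*(f)` shows that the functional `x ↦ ∫ Re(x·w) dω` is at most `∫
φ*(x) dω + T` on the disc algebra. Hahn–Banach extends it to all bounded measurable `x`. Since `φ*`
is finite everywhere, uniformly in `s`, the extension has no singular part and is integration
against some `b ∈ L¹`; Fenchel–Moreau and monotone convergence give `∫ φ(s, b) dω ≤ T`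
(`exists_minimizer`). As `b - w` annihilates the disc algebra, `P[b]` is holomorphic with value `w`
at `t`, so it competes for `hullCheck`.

If `p < ∞`, each description contributes one property of the common value: translated competitors of
`hullCheck` give upper semicontinuity, the supremum defining `hullTilde` gives the sub-mean value
inequality, and constant competitors of `hullCheck` with Fatou's theorem give the boundary
inequality. -/

namespace ThreeHulls

section


/-! ### Arc length and the Poisson kernel -/

/-- The map `z ↦ z / |z|` onto the unit circle. -/
noncomputable def toCircle (z : ℂ) : Circle := Circle.exp z.arg

@[simp] lemma toCircle_coe (s : Circle) : toCircle (s : ℂ) = s := Circle.exp_arg s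

lemma circleMap_zero_one (θ : ℝ) : circleMap 0 1 θ = (Circle.exp θ : ℂ) := by
  simp [circleMap, Circle.coe_exp]

lemma continuous_circle_exp : Continuous (fun θ : ℝ => Circle.exp θ) := Circle.exp.continuous

lemma two_pi_ne_zero' : ENNReal.ofReal (2 * Real.pi) ≠ 0 := by
  simp [Real.pi_pos]

instance : IsProbabilityMeasure arc := by
  constructor
  rw [arc, Measure.smul_apply, Measure.map_apply continuous_circle_exp.measurable MeasurableSet.univ]
  simp only [Set.preimage_univ, Measure.restrict_apply_univ, Real.volume_Ioc, sub_zero, smul_eq_mul]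
  exact ENNReal.inv_mul_cancel two_pi_ne_zero' ENNReal.ofReal_ne_top

section
variable {E : Type*} [NormedAddCommGroup E]

lemma aestronglyMeasurable_map_of_arc {h : Circle → E} (hh : AEStronglyMeasurable h arc) :
    AEStronglyMeasurable h
      (Measure.map Circle.exp (volume.restrict (Set.Ioc 0 (2 * Real.pi)))) := by
  refine hh.mono_ac ?_
  rw [arc]
  exact Measure.absolutelyContinuous_smul (ENNReal.inv_ne_zero.2 ENNReal.ofReal_ne_top)

lemma integrable_exp_of_arc {h : Circle → E} (hh : Integrable h arc) :
    IntegrableOn (fun θ : ℝ => h (Circle.exp θ)) (Set.Ioc 0 (2 * Real.pi)) := by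
  have h1 := aestronglyMeasurable_map_of_arc hh.1
  rw [arc] at hh
  have h2 := (integrable_smul_measure (ENNReal.inv_ne_zero.2 ENNReal.ofReal_ne_top)
    (ENNReal.inv_ne_top.2 two_pi_ne_zero')).1 hh
  exact (integrable_map_measure h1 continuous_circle_exp.aemeasurable).1 h2

lemma circleIntegrable_of_arc {h : Circle → E} (hh : Integrable h arc) :
    CircleIntegrable (fun z => h (toCircle z)) 0 1 := by
  rw [CircleIntegrable, intervalIntegrable_iff_integrableOn_Ioc_of_le (by positivity)]
  simp_rw [circleMap_zero_one, toCircle_coe]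
  exact integrable_exp_of_arc hh

variable [NormedSpace ℝ E]

lemma integral_arc {h : Circle → E} (hh : AEStronglyMeasurable h arc) :
    ∫ s, h s ∂arc = (2 * Real.pi)⁻¹ • ∫ θ in (0 : ℝ)..2 * Real.pi, h (Circle.exp θ) := by
  have h1 := aestronglyMeasurable_map_of_arc hh
  rw [arc, integral_smul_measure, integral_map continuous_circle_exp.aemeasurable h1,
    intervalIntegral.integral_of_le (by positivity), ENNReal.toReal_inv,
    ENNReal.toReal_ofReal (by positivity)]

lemma integral_arc_eq_circleAverage {h : Circle → E} (hh : AEStronglyMeasurable h arc) :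
    ∫ s, h s ∂arc = Real.circleAverage (fun z => h (toCircle z)) 0 1 := by
  rw [integral_arc hh, Real.circleAverage_def]
  simp_rw [circleMap_zero_one, toCircle_coe]

end

lemma kernel_eq (t : ℂ) (s : Circle) : kernel t s = (1 - ‖t‖ ^ 2) / ‖(s : ℂ) - t‖ ^ 2 := by
  simp only [kernel, poissonKernel_def, sub_zero]
  rw [Circle.norm_coe, one_pow]

lemma mem_disc {t : ℂ} : t ∈ disc ↔ ‖t‖ < 1 := by simp [disc]

lemma one_sub_norm_le (t : ℂ) (s : Circle) : 1 - ‖t‖ ≤ ‖(s : ℂ) - t‖ := by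
  have := norm_sub_norm_le (s : ℂ) t
  rwa [Circle.norm_coe] at this

lemma coe_sub_ne_zero {t : ℂ} (ht : t ∈ disc) (s : Circle) : (s : ℂ) - t ≠ 0 := by
  have := one_sub_norm_le t s
  rw [mem_disc] at ht
  exact norm_pos_iff.1 (by linarith)

lemma kernel_pos {t : ℂ} (ht : t ∈ disc) (s : Circle) : 0 < kernel t s := by
  rw [kernel_eq]
  have h1 := norm_pos_iff.2 (coe_sub_ne_zero ht s)
  rw [mem_disc] at ht
  have := norm_nonneg t
  have : 0 < 1 - ‖t‖ ^ 2 := by nlinarith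
  positivity

lemma kernel_le {t : ℂ} (ht : t ∈ disc) (s : Circle) :
    kernel t s ≤ (1 + ‖t‖) / (1 - ‖t‖) := by
  have h := one_sub_norm_le t s
  rw [mem_disc] at ht
  have h0 := norm_nonneg t
  rw [kernel_eq, div_le_div_iff₀ (pow_pos (by linarith) 2) (by linarith)]
  have : (1 - ‖t‖) ^ 2 ≤ ‖(s : ℂ) - t‖ ^ 2 := by gcongr
  nlinarith

lemma le_kernel {t : ℂ} (ht : t ∈ disc) (s : Circle) :
    (1 - ‖t‖) / (1 + ‖t‖) ≤ kernel t s := by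
  have h := one_sub_norm_le t s
  have h' : ‖(s : ℂ) - t‖ ≤ 1 + ‖t‖ := by
    have := norm_sub_le (s : ℂ) t
    rwa [Circle.norm_coe] at this
  rw [mem_disc] at ht
  have h0 := norm_nonneg t
  have h3 : 0 < ‖(s : ℂ) - t‖ := by linarith
  rw [kernel_eq, div_le_div_iff₀ (by linarith) (by positivity)]
  have : ‖(s : ℂ) - t‖ ^ 2 ≤ (1 + ‖t‖) ^ 2 := by gcongr
  nlinarith

lemma continuous_kernel {t : ℂ} (ht : t ∈ disc) : Continuous (kernel t) := by
  simp_rw [funext (kernel_eq t)]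
  refine Continuous.div (by fun_prop) (by fun_prop) ?_
  intro s
  simpa using coe_sub_ne_zero ht s

lemma continuousAt_kernel {t : ℂ} (ht : t ∈ disc) (s : Circle) :
    ContinuousAt (fun t => kernel t s) t := by
  simp_rw [kernel_eq]
  refine ContinuousAt.div (by fun_prop) (by fun_prop) ?_
  simpa using coe_sub_ne_zero ht s

lemma isOpen_disc : IsOpen disc := Metric.isOpen_ball

section
variable {E : Type*} [NormedAddCommGroup E] [NormedSpace ℝ E]

lemma integrable_kernel_smul {h : Circle → E} (hh : Integrable h arc) {t : ℂ} (ht : t ∈ disc) :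
    Integrable (fun s => kernel t s • h s) arc := by
  refine hh.bdd_smul ((1 + ‖t‖) / (1 - ‖t‖)) (continuous_kernel ht).aestronglyMeasurable ?_
  refine Eventually.of_forall fun s => ?_
  rw [Real.norm_of_nonneg (kernel_pos ht s).le]
  exact kernel_le ht s

lemma integrable_of_kernel_smul {h : Circle → E} {t : ℂ} (ht : t ∈ disc)
    (hh : Integrable (fun s => kernel t s • h s) arc) : Integrable h arc := by
  have h1 : h = fun s => (kernel t s)⁻¹ • (kernel t s • h s) := by
    funext s
    rw [smul_smul, inv_mul_cancel₀ (kernel_pos ht s).ne', one_smul]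
  rw [h1]
  have hpos : 0 < 1 - ‖t‖ := by rw [mem_disc] at ht; linarith
  have := norm_nonneg t
  refine hh.bdd_smul ((1 - ‖t‖) / (1 + ‖t‖))⁻¹
    ((continuous_kernel ht).inv₀ fun s => (kernel_pos ht s).ne').aestronglyMeasurable ?_
  refine Eventually.of_forall fun s => ?_
  rw [norm_inv, Real.norm_of_nonneg (kernel_pos ht s).le]
  exact inv_anti₀ (by positivity) (le_kernel ht s)

lemma poisson_eq_circleAverage {h : Circle → E} (hh : Integrable h arc) {t : ℂ} (ht : t ∈ disc) :
    poisson h t = Real.circleAverage (poissonKernel 0 t • fun z => h (toCircle z)) 0 1 := by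
  rw [poisson, integral_arc_eq_circleAverage (integrable_kernel_smul hh ht).1]
  refine Real.circleAverage_congr_sphere fun z hz => ?_
  have : z = toCircle z := by
    have h1 : ‖z‖ = 1 := by simpa using hz
    have := Complex.norm_mul_exp_arg_mul_I z
    rw [h1] at this
    simpa [toCircle] using this.symm
  simp only [kernel, Pi.smul_apply']
  rw [← this]

lemma poisson_add {h k : Circle → E} (hh : Integrable h arc) (hk : Integrable k arc) {t : ℂ}
    (ht : t ∈ disc) : poisson (fun s => h s + k s) t = poisson h t + poisson k t := by
  simp only [poisson, smul_add]
  exact integral_add (integrable_kernel_smul hh ht) (integrable_kernel_smul hk ht)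

lemma poisson_sub {h k : Circle → E} (hh : Integrable h arc) (hk : Integrable k arc) {t : ℂ}
    (ht : t ∈ disc) : poisson (fun s => h s - k s) t = poisson h t - poisson k t := by
  simp only [poisson, smul_sub]
  exact integral_sub (integrable_kernel_smul hh ht) (integrable_kernel_smul hk ht)

lemma poisson_const_mul (c : ℝ) (h : Circle → ℝ) (t : ℂ) :
    poisson (fun s => c * h s) t = c * poisson h t := by
  simp only [poisson, smul_eq_mul]
  rw [← integral_const_mul]
  exact integral_congr_ae (Eventually.of_forall fun s => by ring)

lemma poisson_congr_ae {h k : Circle → E} (hk : h =ᵐ[arc] k) (t : ℂ) :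
    poisson h t = poisson k t := by
  refine integral_congr_ae ?_
  filter_upwards [hk] with s hs
  rw [hs]

lemma poisson_mono {h k : Circle → ℝ} (hh : Integrable h arc) (hk : Integrable k arc)
    (hle : ∀ᵐ s ∂arc, h s ≤ k s) {t : ℂ} (ht : t ∈ disc) : poisson h t ≤ poisson k t := by
  refine integral_mono_ae (integrable_kernel_smul hh ht) (integrable_kernel_smul hk ht) ?_
  filter_upwards [hle] with s hs
  exact mul_le_mul_of_nonneg_left hs (kernel_pos ht s).le

lemma clm_poisson {F : Type*} [NormedAddCommGroup F] [NormedSpace ℝ F] [CompleteSpace E]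
    [CompleteSpace F]
    (L : E →L[ℝ] F) {h : Circle → E} (hh : Integrable h arc) {t : ℂ} (ht : t ∈ disc) :
    L (poisson h t) = poisson (fun s => L (h s)) t := by
  rw [poisson, ← L.integral_comp_comm (integrable_kernel_smul hh ht)]
  simp [poisson]

end

lemma poisson_of_diffContOnCl {E : Type*} [NormedAddCommGroup E] [NormedSpace ℂ E]
    [CompleteSpace E] {F : ℂ → E} (hF : DiffContOnCl ℂ F disc)
    {t : ℂ} (ht : t ∈ disc) : poisson (fun s : Circle => F s) t = F t := by
  have hc : Continuous fun s : Circle => F s := by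
    have h1 : ContinuousOn F (Metric.closedBall 0 1) := by
      have := hF.2
      rwa [disc, closure_ball _ one_ne_zero] at this
    exact h1.comp_continuous (by fun_prop) (fun s => by simpa using (Circle.norm_coe s).le)
  have hi : Integrable (fun s : Circle => F s) arc :=
    hc.integrable_of_hasCompactSupport (HasCompactSupport.of_compactSpace _)
  rw [poisson_eq_circleAverage hi ht]
  refine Eq.trans ?_ (hF.circleAverage_poissonKernel_smul ht)
  refine Real.circleAverage_congr_sphere fun z hz => ?_
  have : z = toCircle z := by
    have h1 : ‖z‖ = 1 := by simpa using hz
    have := Complex.norm_mul_exp_arg_mul_I z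
    rw [h1] at this
    simpa [toCircle] using this.symm
  simp only [Pi.smul_apply']
  rw [← this]

lemma poisson_const {E : Type*} [NormedAddCommGroup E] [NormedSpace ℂ E]
    [CompleteSpace E] (c : E) {t : ℂ} (ht : t ∈ disc) :
    poisson (fun _ : Circle => c) t = c :=
  poisson_of_diffContOnCl (F := fun _ => c) diffContOnCl_const ht

lemma integral_kernel {t : ℂ} (ht : t ∈ disc) : ∫ s, kernel t s ∂arc = 1 := by
  have h := poisson_const (1 : ℂ) ht
  simp only [poisson] at h
  have h2 : ∀ s, kernel t s • (1 : ℂ) = ((kernel t s : ℝ) : ℂ) := fun s => by simp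
  simp_rw [h2] at h
  rw [integral_complex_ofReal] at h
  exact_mod_cast h

lemma poisson_const_real (c : ℝ) {t : ℂ} (ht : t ∈ disc) :
    poisson (fun _ : Circle => c) t = c := by
  simp [poisson, integral_mul_const, integral_kernel ht]

/-- Poisson integrals of real functions are real parts of holomorphic functions. -/
lemma exists_re_eq_poisson {h : Circle → ℝ} (hh : Integrable h arc) :
    ∃ G : ℂ → ℂ, DifferentiableOn ℂ G disc ∧ ∀ t ∈ disc, poisson h t = (G t).re := by
  have h1 := circleIntegrable_of_arc hh
  have h2 := circleIntegrable_of_arc (E := ℂ) hh.ofReal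
  refine ⟨_, differentiableOn_circleAverage_herglotzRieszKernel_smul h2, fun t ht => ?_⟩
  rw [poisson_eq_circleAverage hh ht]
  have := re_circleAverage_herglotzRieszKernel_smul h1 ht
  rw [poissonKernel_eq_re_herglotzRieszKernel]
  exact this.symm

lemma continuousOn_poisson {h : Circle → ℝ} (hh : Integrable h arc) :
    ContinuousOn (poisson h) disc := by
  obtain ⟨G, hG, hP⟩ := exists_re_eq_poisson hh
  exact (Complex.continuous_re.comp_continuousOn hG.continuousOn).congr hP

lemma real_mul_mem_disc {r : ℝ} (hr : r ∈ Set.Ico (0 : ℝ) 1) {t : ℂ} (ht : ‖t‖ ≤ 1) :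
    (r : ℂ) * t ∈ disc := by
  rw [mem_disc, norm_mul, Complex.norm_real, Real.norm_of_nonneg hr.1]
  nlinarith [hr.1, hr.2, norm_nonneg t]

lemma diffContOnCl_dilate {E : Type*} [NormedAddCommGroup E] [NormedSpace ℂ E] {G : ℂ → E}
    (hG : DifferentiableOn ℂ G disc) {r : ℝ}
    (hr : r ∈ Set.Ico (0 : ℝ) 1) : DiffContOnCl ℂ (fun z => G ((r : ℂ) * z)) disc := by
  refine DifferentiableOn.diffContOnCl ?_
  rw [disc, closure_ball _ one_ne_zero]
  refine hG.comp (by fun_prop) fun z hz => real_mul_mem_disc hr (by simpa using hz)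

lemma continuous_poisson_dilate {v : Circle → ℝ} (hv : Integrable v arc) {r : ℝ}
    (hr : r ∈ Set.Ico (0 : ℝ) 1) : Continuous fun s : Circle => poisson v ((r : ℂ) * s) :=
  (continuousOn_poisson hv).comp_continuous (by fun_prop) fun s => real_mul_mem_disc hr (Circle.norm_coe s).le

lemma poisson_dilate {v : Circle → ℝ} (hv : Integrable v arc) {r : ℝ}
    (hr : r ∈ Set.Ico (0 : ℝ) 1) {t : ℂ} (ht : t ∈ disc) :
    poisson (fun s : Circle => poisson v ((r : ℂ) * s)) t = poisson v ((r : ℂ) * t) := by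
  obtain ⟨G, hG, hP⟩ := exists_re_eq_poisson hv
  have hd := diffContOnCl_dilate hG hr
  have hc : Continuous fun s : Circle => G ((r : ℂ) * s) :=
    hG.continuousOn.comp_continuous (by fun_prop) fun s => real_mul_mem_disc hr (Circle.norm_coe s).le
  have hi : Integrable (fun s : Circle => G ((r : ℂ) * s)) arc :=
    hc.integrable_of_hasCompactSupport (HasCompactSupport.of_compactSpace _)
  have h1 := poisson_of_diffContOnCl hd ht
  have h2 := clm_poisson Complex.reCLM hi ht
  rw [h1] at h2
  rw [hP _ (real_mul_mem_disc hr (mem_disc.1 ht).le)]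
  simp only [Complex.reCLM_apply] at h2
  rw [h2]
  congr 1
  funext s
  exact hP _ (real_mul_mem_disc hr (Circle.norm_coe s).le)

end

section


/-! ### Radial limits of Poisson integrals (Fatou's theorem) -/

lemma norm_exp_sub_sq (r x y : ℝ) :
    ‖(Circle.exp y : ℂ) - (r : ℂ) * Circle.exp x‖ ^ 2
      = (1 - r) ^ 2 + 2 * r * (1 - Real.cos (y - x)) := by
  rw [← Complex.normSq_eq_norm_sq, Complex.normSq_apply]
  have h1 : (Circle.exp y : ℂ).re = Real.cos y := by
    rw [Circle.coe_exp, Complex.exp_ofReal_mul_I_re]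
  have h2 : (Circle.exp y : ℂ).im = Real.sin y := by
    rw [Circle.coe_exp, Complex.exp_ofReal_mul_I_im]
  have h3 : (Circle.exp x : ℂ).re = Real.cos x := by
    rw [Circle.coe_exp, Complex.exp_ofReal_mul_I_re]
  have h4 : (Circle.exp x : ℂ).im = Real.sin x := by
    rw [Circle.coe_exp, Complex.exp_ofReal_mul_I_im]
  simp only [Complex.sub_re, Complex.sub_im, Complex.re_ofReal_mul, Complex.im_ofReal_mul,
    h1, h2, h3, h4, Real.cos_sub]
  linear_combination Real.sin_sq_add_cos_sq y + r ^ 2 * Real.sin_sq_add_cos_sq x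

lemma kernel_exp (r x y : ℝ) : kernel ((r : ℂ) * Circle.exp x) (Circle.exp y)
    = (1 - r ^ 2) / ((1 - r) ^ 2 + 2 * r * (1 - Real.cos (y - x))) := by
  rw [kernel_eq, norm_exp_sub_sq, norm_mul, Circle.norm_coe, mul_one, Complex.norm_real,
    Real.norm_eq_abs, sq_abs]

lemma kernel_exp_le_near {r : ℝ} (hr : r ∈ Set.Ico (1 / 2 : ℝ) 1) (x y : ℝ) :
    kernel ((r : ℂ) * Circle.exp x) (Circle.exp y) ≤ 2 / (1 - r) := by
  obtain ⟨h1, h2⟩ := hr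
  have hc := Real.cos_le_one (y - x)
  have hd : 0 < 1 - r := by linarith
  have hp : 0 ≤ 2 * r * (1 - Real.cos (y - x)) := mul_nonneg (by linarith) (by linarith)
  have hd2 := pow_pos hd 2
  rw [kernel_exp, div_le_div_iff₀ (by linarith) hd]
  nlinarith

lemma kernel_exp_le_far {r : ℝ} (hr : r ∈ Set.Ico (1 / 2 : ℝ) 1) {x y : ℝ} (hxy : y ≠ x)
    (hpi : |y - x| ≤ Real.pi) :
    kernel ((r : ℂ) * Circle.exp x) (Circle.exp y)
      ≤ Real.pi ^ 2 * (1 - r) / (y - x) ^ 2 := by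
  obtain ⟨h1, h2⟩ := hr
  have hc := Real.cos_le_one_sub_mul_cos_sq hpi
  have hd : 0 < 1 - r := by linarith
  have hne : 0 < (y - x) ^ 2 := by
    have : y - x ≠ 0 := sub_ne_zero.2 hxy
    positivity
  have hpi2 : 0 < Real.pi ^ 2 := by positivity
  have hq : (y - x) ^ 2 * 2 ≤ Real.pi ^ 2 * (1 - Real.cos (y - x)) := by
    have : Real.pi ^ 2 * (2 / Real.pi ^ 2 * (y - x) ^ 2) = (y - x) ^ 2 * 2 := by
      field_simp
    nlinarith
  have hcp : 0 < 1 - Real.cos (y - x) := by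
    by_contra hcon
    nlinarith
  rw [kernel_exp, div_le_div_iff₀ (by positivity) hne]
  have h3 : (1 - r ^ 2) * (y - x) ^ 2 ≤ (2 * (1 - r)) * (y - x) ^ 2 := by
    gcongr; nlinarith
  have h4 : Real.pi ^ 2 * (1 - r) * (1 - Real.cos (y - x))
      ≤ Real.pi ^ 2 * (1 - r) * ((1 - r) ^ 2 + 2 * r * (1 - Real.cos (y - x))) := by
    gcongr; nlinarith
  nlinarith

/-- Dyadic decomposition: at distance about `2^k (1 - r)` from `x` the kernel is `O(4^{-k} / (1 -
r))`, so the term with the smallest admissible `k` already dominates. The balls have length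
comparable to `2^k (1 - r)`, which makes the integrated series geometric. -/
lemma ofReal_kernel_exp_le_tsum {r : ℝ} (hr : r ∈ Set.Ico (1 / 2 : ℝ) 1) {x y : ℝ}
    (hpi : |y - x| ≤ Real.pi) :
    ENNReal.ofReal (kernel ((r : ℂ) * Circle.exp x) (Circle.exp y))
      ≤ ∑' k : ℕ, ENNReal.ofReal (4 * Real.pi ^ 2 * (1 / 4) ^ k / (1 - r)) *
          (Metric.closedBall x (2 ^ k * (1 - r))).indicator 1 y := by
  have hd : 0 < 1 - r := by linarith [hr.2]
  have hex : ∃ k : ℕ, |y - x| ≤ 2 ^ k * (1 - r) := by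
    obtain ⟨k, hk⟩ := pow_unbounded_of_one_lt (|y - x| / (1 - r)) (one_lt_two (α := ℝ))
    exact ⟨k, by rw [div_lt_iff₀ hd] at hk; exact hk.le⟩
  classical
  let k := Nat.find hex
  have hk : |y - x| ≤ 2 ^ k * (1 - r) := Nat.find_spec hex
  have hmem : y ∈ Metric.closedBall x (2 ^ k * (1 - r)) := by
    rwa [Metric.mem_closedBall, Real.dist_eq]
  refine le_trans ?_ (ENNReal.le_tsum k)
  rw [Set.indicator_of_mem hmem, Pi.one_apply, mul_one]
  refine ENNReal.ofReal_le_ofReal ?_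
  rcases Nat.eq_zero_or_pos k with h0 | hpos
  · rw [h0]
    refine (kernel_exp_le_near hr x y).trans ?_
    gcongr
    nlinarith [Real.pi_gt_three]
  · have hlt : ¬ |y - x| ≤ 2 ^ (k - 1) * (1 - r) := Nat.find_min _ (Nat.sub_lt hpos one_pos)
    push Not at hlt
    have hyx : y ≠ x := by
      rintro rfl
      simp only [sub_self, abs_zero] at hlt
      have : 0 < 2 ^ (k - 1) * (1 - r) := by positivity
      linarith
    refine (kernel_exp_le_far hr hyx hpi).trans ?_
    have h2 : (2 ^ (k - 1) * (1 - r)) ^ 2 ≤ (y - x) ^ 2 := by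
      rw [← sq_abs (y - x)]
      gcongr
    calc Real.pi ^ 2 * (1 - r) / (y - x) ^ 2
        ≤ Real.pi ^ 2 * (1 - r) / (2 ^ (k - 1) * (1 - r)) ^ 2 := by gcongr
      _ = 4 * Real.pi ^ 2 * (1 / 4) ^ k / (1 - r) := by
        obtain ⟨m, hm⟩ : ∃ m, k = m + 1 := ⟨k - 1, by omega⟩
        rw [hm, Nat.add_sub_cancel]
        have h4 : ((1 : ℝ) / 4) ^ (m + 1) = 1 / (4 * (2 ^ m) ^ 2) := by
          rw [← pow_mul, mul_comm m 2, pow_mul, one_div_pow, pow_succ]; norm_num; ring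
        rw [h4]
        field_simp

variable {E : Type*} [NormedAddCommGroup E] [NormedSpace ℝ E]

/-- The quantitative form of Fatou's theorem at a Lebesgue point. -/
lemma lintegral_kernel_exp_le {r : ℝ} (hr : r ∈ Set.Ico (1 / 2 : ℝ) 1) {x δ ε : ℝ} (hδ : 0 < δ)
    (hδpi : δ ≤ Real.pi) (hε : 0 ≤ ε) {N : ℝ → ℝ≥0∞} (hN : AEMeasurable N)
    (hball : ∀ ρ ∈ Set.Ioc 0 δ, ∫⁻ y in Metric.closedBall x ρ, N y ≤ ENNReal.ofReal (ε * ρ)) :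
    ∫⁻ y in Set.Ioc (x - Real.pi) (x + Real.pi),
      ENNReal.ofReal (kernel ((r : ℂ) * Circle.exp x) (Circle.exp y)) * N y
      ≤ ENNReal.ofReal (8 * Real.pi ^ 2 * ε) + ENNReal.ofReal (Real.pi ^ 2 * (1 - r) / δ ^ 2) *
        ∫⁻ y in Set.Ioc (x - Real.pi) (x + Real.pi), N y := by
  have hd : 0 < 1 - r := by linarith [hr.2]
  set I := Set.Ioc (x - Real.pi) (x + Real.pi)
  set B := Metric.closedBall x δ
  have hI : ∀ y ∈ I, |y - x| ≤ Real.pi := by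
    intro y hy
    rw [abs_le]
    constructor <;> linarith [hy.1, hy.2]
  have hsplit : I ⊆ B ∪ (I \ B) := by
    intro y hy
    by_cases h : y ∈ B
    · exact Or.inl h
    · exact Or.inr ⟨hy, h⟩
  -- Inside the ball the small means enter through the dyadic series; outside it the kernel itself
  -- is `O(1 - r)`.
  refine (lintegral_mono_set hsplit).trans ((lintegral_union_le _ _ _).trans (add_le_add ?_ ?_))
  · calc ∫⁻ y in B, ENNReal.ofReal (kernel ((r : ℂ) * Circle.exp x) (Circle.exp y)) * N y
        ≤ ∫⁻ y in B, ∑' k : ℕ, ENNReal.ofReal (4 * Real.pi ^ 2 * (1 / 4) ^ k / (1 - r)) *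
          (Metric.closedBall x (2 ^ k * (1 - r))).indicator N y := by
          refine lintegral_mono_ae ?_
          filter_upwards [ae_restrict_mem Metric.isClosed_closedBall.measurableSet] with y hy
          have hy' : |y - x| ≤ Real.pi := by
            rw [Metric.mem_closedBall, Real.dist_eq] at hy
            exact hy.trans hδpi
          refine (mul_le_mul_left (ofReal_kernel_exp_le_tsum hr hy') (N y)).trans ?_
          rw [← ENNReal.tsum_mul_right]
          refine ENNReal.tsum_le_tsum fun k => ?_
          rw [mul_assoc]
          gcongr
          by_cases h : y ∈ Metric.closedBall x (2 ^ k * (1 - r)) <;> simp [h]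
      _ = ∑' k : ℕ, ∫⁻ y in B, ENNReal.ofReal (4 * Real.pi ^ 2 * (1 / 4) ^ k / (1 - r)) *
          (Metric.closedBall x (2 ^ k * (1 - r))).indicator N y := by
          refine lintegral_tsum fun k => ?_
          exact ((hN.indicator Metric.isClosed_closedBall.measurableSet).const_mul _).restrict
      _ ≤ ∑' k : ℕ, ENNReal.ofReal (4 * Real.pi ^ 2 * ε * (1 / 2) ^ k) := by
          refine ENNReal.tsum_le_tsum fun k => ?_
          have hkpos : 0 < 2 ^ k * (1 - r) := by positivity
          rw [lintegral_const_mul' _ _ ENNReal.ofReal_ne_top,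
            lintegral_indicator Metric.isClosed_closedBall.measurableSet,
            Measure.restrict_restrict Metric.isClosed_closedBall.measurableSet]
          have hsub : Metric.closedBall x (2 ^ k * (1 - r)) ∩ B
              ⊆ Metric.closedBall x (min (2 ^ k * (1 - r)) δ) := by
            intro y hy
            exact Metric.mem_closedBall.2 (le_min hy.1 hy.2)
          have h1 := (lintegral_mono_set (f := N) hsub).trans
            (hball _ ⟨lt_min hkpos hδ, min_le_right _ _⟩)
          have h2 : ENNReal.ofReal (ε * min (2 ^ k * (1 - r)) δ)
              ≤ ENNReal.ofReal (ε * (2 ^ k * (1 - r))) :=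
            ENNReal.ofReal_le_ofReal (by gcongr; exact min_le_left _ _)
          refine (mul_le_mul_right (h1.trans h2) _).trans ?_
          rw [← ENNReal.ofReal_mul (by positivity)]
          refine ENNReal.ofReal_le_ofReal (le_of_eq ?_)
          have h4 : ((1 : ℝ) / 4) ^ k * 2 ^ k = (1 / 2) ^ k := by
            rw [← mul_pow]; norm_num
          field_simp
          rw [← h4]
          ring
      _ = ENNReal.ofReal (8 * Real.pi ^ 2 * ε) := by
          rw [← ENNReal.ofReal_tsum_of_nonneg (fun k => by positivity)
            (summable_geometric_two.mul_left _), tsum_mul_left, tsum_geometric_two]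
          congr 1; ring
  · rw [← lintegral_const_mul' _ _ ENNReal.ofReal_ne_top]
    refine le_trans ?_ (lintegral_mono_set (Set.sdiff_subset (t := B)))
    refine lintegral_mono_ae ?_
    filter_upwards [ae_restrict_mem (measurableSet_Ioc.diff
      Metric.isClosed_closedBall.measurableSet)] with y hy
    have hy2 : δ < |y - x| := by
      have := hy.2
      simpa [B, Real.dist_eq] using this
    have hyx : y ≠ x := by
      rintro rfl
      simp only [sub_self, abs_zero] at hy2
      linarith
    refine mul_le_mul_left (ENNReal.ofReal_le_ofReal ?_) _
    refine (kernel_exp_le_far hr hyx (hI y hy.1)).trans ?_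
    rw [← sq_abs (y - x)]
    gcongr

/-- `arc` is an image measure, so it is evaluated on measurable sets: a measurable null hull is cut
down to one period, where the exponential is continuous and injective and therefore has a measurable
image. -/
lemma ae_arc_of_ae_exp {P : Circle → Prop} (h : ∀ᵐ x : ℝ, P (Circle.exp x)) :
    ∀ᵐ s ∂arc, P s := by
  set I := Set.Ioc (0 : ℝ) (2 * Real.pi)
  set N := toMeasurable volume {x : ℝ | ¬ P (Circle.exp x)}
  have hN : volume N = 0 := by rw [measure_toMeasurable]; exact h
  have hinj : Set.InjOn Circle.exp I := Circle.exp_injOn_Ioc (by simp)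
  have hNI : MeasurableSet (N ∩ I) := (measurableSet_toMeasurable _ _).inter measurableSet_Ioc
  have him : MeasurableSet (Circle.exp '' (N ∩ I)) :=
    hNI.image_of_continuousOn_injOn continuous_circle_exp.continuousOn
      (hinj.mono Set.inter_subset_right)
  have hzero : arc (Circle.exp '' (N ∩ I)) = 0 := by
    rw [arc, Measure.smul_apply, Measure.map_apply continuous_circle_exp.measurable him,
      Measure.restrict_apply (continuous_circle_exp.measurable him), smul_eq_mul]
    refine mul_eq_zero_of_right _ (measure_mono_null ?_ hN)
    rintro x ⟨⟨y, hy, hyx⟩, hx⟩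
    rw [← hinj hy.2 hx hyx]
    exact hy.1
  refine measure_mono_null ?_ hzero
  intro s hs
  obtain ⟨x, hx, rfl⟩ : ∃ x ∈ I, Circle.exp x = s := by
    have := (Circle.exp_surjective s)
    obtain ⟨y, rfl⟩ := this
    obtain ⟨x, hx, hxy⟩ := Circle.periodic_exp.exists_mem_Ioc Real.two_pi_pos y 0
    exact ⟨x, by simpa [I] using hx, hxy.symm⟩
  exact ⟨x, ⟨subset_toMeasurable _ _ hs, hx⟩, rfl⟩

variable [CompleteSpace E]

/-- By periodicity the period can be centred at `x`, so that `|y - x| ≤ π`, the range of the kernel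
estimates. The factor `1 / (2π)` is simply dropped. -/
lemma enorm_poisson_sub_le {h : Circle → E} (hh : Integrable h arc) {t : ℂ} (ht : t ∈ disc)
    (x : ℝ) (c : E) :
    ‖poisson h t - c‖ₑ ≤ ∫⁻ y in Set.Ioc (x - Real.pi) (x + Real.pi),
      ENNReal.ofReal (kernel t (Circle.exp y)) * ‖h (Circle.exp y) - c‖ₑ := by
  have hc : Integrable (fun _ : Circle => c) arc := integrable_const c
  have h1 : poisson h t - c = ∫ s, kernel t s • (h s - c) ∂arc := by
    have := poisson_sub hh hc ht
    rw [poisson, poisson, poisson, integral_smul_const, integral_kernel ht, one_smul] at this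
    rw [this]; rfl
  have hi := integrable_kernel_smul (hh.sub hc) ht
  rw [h1]
  refine (enorm_integral_le_lintegral_enorm _).trans ?_
  have hi' : Integrable (fun s => ‖kernel t s • (h s - c)‖) arc := hi.norm
  have h2 : ∫⁻ s, ‖kernel t s • (h s - c)‖ₑ ∂arc
      = ENNReal.ofReal (∫ s, ‖kernel t s • (h s - c)‖ ∂arc) := by
    exact (ofReal_integral_norm_eq_lintegral_enorm hi).symm
  rw [h2, integral_arc hi'.1]
  have hper : Function.Periodic
      (fun θ : ℝ => ‖kernel t (Circle.exp θ) • (h (Circle.exp θ) - c)‖) (2 * Real.pi) := by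
    intro θ
    simp only [Circle.periodic_exp θ]
  have h3 := hper.intervalIntegral_add_eq 0 (x - Real.pi)
  rw [zero_add, show x - Real.pi + 2 * Real.pi = x + Real.pi by ring] at h3
  have hint : IntervalIntegrable
      (fun θ : ℝ => ‖kernel t (Circle.exp θ) • (h (Circle.exp θ) - c)‖) volume
        (x - Real.pi) (x + Real.pi) := by
    refine hper.intervalIntegrable₀ Real.two_pi_pos.ne' ?_ _ _
    rw [intervalIntegrable_iff_integrableOn_Ioc_of_le (by positivity)]
    exact integrable_exp_of_arc hi'
  have hle : x - Real.pi ≤ x + Real.pi := by linarith [Real.pi_pos]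
  rw [intervalIntegrable_iff_integrableOn_Ioc_of_le hle] at hint
  rw [h3, intervalIntegral.integral_of_le hle, smul_eq_mul,
    ENNReal.ofReal_mul (by positivity), ofReal_integral_eq_lintegral_ofReal hint
      (Eventually.of_forall fun _ => norm_nonneg _)]
  refine (mul_le_of_le_one_left zero_le ?_).trans (lintegral_mono fun y => ?_)
  · rw [ENNReal.ofReal_le_one]
    exact inv_le_one_of_one_le₀ (by linarith [Real.pi_gt_three])
  · rw [norm_smul, ENNReal.ofReal_mul (norm_nonneg _), Real.norm_of_nonneg (kernel_pos ht _).le,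
      ofReal_norm]

/-- **Fatou's theorem**: the Poisson integral of an integrable function converges radially
to this function almost everywhere. -/
theorem ae_tendsto_poisson {h : Circle → E} (hh : Integrable h arc) :
    ∀ᵐ s : Circle ∂arc, Tendsto (fun r : ℝ => poisson h ((r : ℂ) * s))
      (𝓝[Set.Ioo 0 1] (1 : ℝ)) (𝓝 (h s)) := by
  refine ae_arc_of_ae_exp ?_
  set H : ℝ → E := fun y => h (Circle.exp y)
  have hper : Function.Periodic H (2 * Real.pi) := fun θ => by
    simp only [H, Circle.periodic_exp θ]
  have hint : ∀ a b, IntervalIntegrable H volume a b := by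
    refine hper.intervalIntegrable₀ Real.two_pi_pos.ne' ?_
    rw [intervalIntegrable_iff_integrableOn_Ioc_of_le (by positivity)]
    exact integrable_exp_of_arc hh
  have hloc : LocallyIntegrable H volume := by
    intro x
    refine ⟨Set.Ioc (x - 1) (x + 1), Ioc_mem_nhds (by linarith) (by linarith), ?_⟩
    rw [← intervalIntegrable_iff_integrableOn_Ioc_of_le (by linarith)]
    exact hint _ _
  -- Lebesgue points with respect to centred balls, the only ones that occur in the dyadic estimate.
  filter_upwards [(Besicovitch.vitaliFamily (volume : Measure ℝ)).ae_tendsto_average_norm_sub hloc]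
    with x hx
  have hx' := hx.comp (Besicovitch.tendsto_filterAt volume x)
  have hmeas : AEMeasurable (fun y => ‖H y - H x‖ₑ) volume :=
    (hloc.aestronglyMeasurable.sub aestronglyMeasurable_const).enorm
  set M := ∫⁻ y in Set.Ioc (x - Real.pi) (x + Real.pi), ‖H y - H x‖ₑ
  have hM : M ≠ ∞ := by
    have h1 : IntegrableOn (fun y => H y - H x) (Set.Ioc (x - Real.pi) (x + Real.pi)) := by
      refine Integrable.sub ?_ (integrable_const _)
      have := hint (x - Real.pi) (x + Real.pi)
      rwa [intervalIntegrable_iff_integrableOn_Ioc_of_le (by linarith [Real.pi_pos])] at this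
    exact h1.2.ne
  rw [EMetric.tendsto_nhds]
  intro e he
  obtain ⟨ε, hε, hεe⟩ : ∃ ε : ℝ, 0 < ε ∧ ENNReal.ofReal (8 * Real.pi ^ 2 * ε) < e := by
    have : Tendsto (fun ε : ℝ => ENNReal.ofReal (8 * Real.pi ^ 2 * ε)) (𝓝[>] 0) (𝓝 0) := by
      have h1 : Continuous fun ε : ℝ => ENNReal.ofReal (8 * Real.pi ^ 2 * ε) :=
        ENNReal.continuous_ofReal.comp (by fun_prop)
      have := (h1.tendsto 0).mono_left (nhdsWithin_le_nhds (s := Set.Ioi 0))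
      simpa using this
    obtain ⟨ε, h1, h2⟩ := ((this.eventually (gt_mem_nhds he)).and self_mem_nhdsWithin).exists
    exact ⟨ε, h2, h1⟩
  obtain ⟨δ, hδ, hδpi, hball⟩ : ∃ δ > 0, δ ≤ Real.pi ∧ ∀ ρ ∈ Set.Ioc 0 δ,
      ∫⁻ y in Metric.closedBall x ρ, ‖H y - H x‖ₑ ≤ ENNReal.ofReal (ε * ρ) := by
    have h1 := hx'.eventually (gt_mem_nhds (half_pos hε))
    rw [eventually_nhdsWithin_iff, Metric.eventually_nhds_iff] at h1
    obtain ⟨δ, hδ, h2⟩ := h1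
    refine ⟨min (δ / 2) Real.pi, lt_min (half_pos hδ) Real.pi_pos, min_le_right _ _, ?_⟩
    rintro ρ ⟨hρ, hρ2⟩
    have h3 : ρ < δ := by linarith [hρ2.trans (min_le_left _ _)]
    have h4 := h2 (y := ρ) (by simpa [abs_of_pos hρ] using h3) hρ
    have h5 : IntegrableOn (fun y => H y - H x) (Metric.closedBall x ρ) :=
      (hloc.integrableOn_isCompact (isCompact_closedBall _ _)).sub
        (integrableOn_const measure_closedBall_lt_top.ne)
    rw [← ofReal_integral_norm_eq_lintegral_enorm h5]
    refine ENNReal.ofReal_le_ofReal ?_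
    simp only [Function.comp_apply] at h4
    rw [setAverage_eq, smul_eq_mul, measureReal_def, Real.volume_closedBall,
      ENNReal.toReal_ofReal (by linarith)] at h4
    rw [inv_mul_lt_iff₀ (by linarith)] at h4
    linarith
  have hlim : Tendsto (fun r : ℝ => ENNReal.ofReal (8 * Real.pi ^ 2 * ε) +
      ENNReal.ofReal (Real.pi ^ 2 * (1 - r) / δ ^ 2) * M) (𝓝[Set.Ioo 0 1] (1 : ℝ))
      (𝓝 (ENNReal.ofReal (8 * Real.pi ^ 2 * ε))) := by
    have h1 : Continuous fun r : ℝ => ENNReal.ofReal (Real.pi ^ 2 * (1 - r) / δ ^ 2) :=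
      ENNReal.continuous_ofReal.comp (by fun_prop)
    have h2 := (h1.tendsto 1).mono_left (nhdsWithin_le_nhds (s := Set.Ioo 0 1))
    have h3 := ENNReal.Tendsto.mul_const h2 (Or.inr hM)
    have h4 := h3.const_add (ENNReal.ofReal (8 * Real.pi ^ 2 * ε))
    simpa using h4
  filter_upwards [hlim.eventually (gt_mem_nhds hεe), self_mem_nhdsWithin,
    mem_nhdsWithin_of_mem_nhds (Ici_mem_nhds (by norm_num : (1 / 2 : ℝ) < 1))] with r hr1 hr2 hr3
  have ht : (r : ℂ) * Circle.exp x ∈ disc :=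
    real_mul_mem_disc ⟨hr2.1.le, hr2.2⟩ (Circle.norm_coe _).le
  rw [edist_eq_enorm_sub]
  refine lt_of_le_of_lt ?_ hr1
  refine (enorm_poisson_sub_le hh ht x _).trans ?_
  exact lintegral_kernel_exp_le ⟨hr3, hr2.2⟩ hδ hδpi hε.le hmeas hball

end

section


/-! ### Plurisubharmonic functions along holomorphic curves -/

lemma re_circleAverage {G : ℂ → ℂ} (hG : DiffContOnCl ℂ G disc) :
    CircleIntegrable (fun z => (G z).re) 0 1 ∧
      Real.circleAverage (fun z => (G z).re) 0 1 = (G 0).re := by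
  have hc : ContinuousOn G (Metric.closedBall 0 1) := by
    have := hG.2
    rwa [disc, closure_ball _ one_ne_zero] at this
  have hci : CircleIntegrable G 0 1 :=
    (hc.mono Metric.sphere_subset_closedBall).circleIntegrable zero_le_one
  refine ⟨?_, ?_⟩
  · exact ((Complex.continuous_re.comp_continuousOn hc).mono
      Metric.sphere_subset_closedBall).circleIntegrable zero_le_one
  · have h1 := Complex.reCLM.circleAverage_comp_comm hci
    have h2 : Real.circleAverage G 0 1 = G 0 :=
      DiffContOnCl.circleAverage (by simpa [disc] using hG)
    rw [h2] at h1
    exact h1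

variable {n : ℕ}

/-- The penalized function has no local maximum over the open disc. Moving in the direction `(1,
W'(ζ))`, the distance vector `w - W` changes only by the second order remainder `e` of `W`. In the
squared distance the cross term with `e` is harmonic and `‖e‖²` is negligible against the strictly
subharmonic `ε‖ζ‖²`, so the sub-mean value inequality of `ψ` on a small disc would be violated. -/
lemma exists_circle_gt {ψ : ℂ × Cn n → ℝ} (hψ : IsPSH (cylinder n) ψ) {r : ℝ}
    (hr : r ∈ Set.Ico (0 : ℝ) 1) {W : ℂ → Cn n} {R : ℝ} (hR : 1 < R)
    (hW : DifferentiableOn ℂ W (Metric.ball 0 R)) {p : ℂ → ℂ} (hp : Differentiable ℂ p)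
    {ζ : ℂ} (hζ : ‖ζ‖ < 1) (w : Cn n) {N ε ρ₀ : ℝ} (hN : 0 ≤ N) (hε : 0 < ε) (hρ₀ : 0 < ρ₀) :
    ∃ τ : ℂ, ‖τ‖ ≤ ρ₀ ∧ ψ ((r : ℂ) * ζ, w) - N * ‖w - W ζ‖ ^ 2 - (p ζ).re + ε * ‖ζ‖ ^ 2 <
      ψ ((r : ℂ) * (ζ + τ), w + τ • deriv W ζ) - N * ‖w + τ • deriv W ζ - W (ζ + τ)‖ ^ 2
        - (p (ζ + τ)).re + ε * ‖ζ + τ‖ ^ 2 := by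
  by_contra! hcon
  set d := w - W ζ
  set e : ℂ → Cn n := fun τ => W (ζ + τ) - W ζ - τ • deriv W ζ
  set m := ψ ((r : ℂ) * ζ, w) - N * ‖d‖ ^ 2 - (p ζ).re + ε * ‖ζ‖ ^ 2
  have hder : HasDerivAt W (deriv W ζ) ζ := by
    refine (hW.differentiableAt (Metric.isOpen_ball.mem_nhds ?_)).hasDerivAt
    simp; linarith
  -- On the circle of radius `ρ` the remainder costs at most `N c² ρ²`, while `ε‖·‖²` gains exactly
  -- `ε ρ²` on average.
  obtain ⟨c, hc, hcN⟩ : ∃ c : ℝ, 0 < c ∧ N * c ^ 2 < ε := by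
    refine ⟨Real.sqrt (ε / (N + 1)), Real.sqrt_pos.2 (by positivity), ?_⟩
    rw [Real.sq_sqrt (by positivity), mul_div_assoc', div_lt_iff₀ (by positivity)]
    nlinarith
  have hlit : ∀ᶠ τ : ℂ in 𝓝 0, ‖e τ‖ ≤ c * ‖τ‖ := by
    have := (hasDerivAt_iff_isLittleO_nhds_zero.1 hder).def hc
    exact this
  obtain ⟨ρ₁, hρ₁, hball⟩ := Metric.eventually_nhds_iff.1 hlit
  obtain ⟨ρ, hρ, hρ0, hρ1, hρR, hρζ⟩ : ∃ ρ : ℝ, 0 < ρ ∧ ρ ≤ ρ₀ ∧ ρ < ρ₁ ∧ ρ < R - 1 ∧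
      ρ < 1 - ‖ζ‖ := by
    refine ⟨min (min ρ₀ (ρ₁ / 2)) (min ((R - 1) / 2) ((1 - ‖ζ‖) / 2)), ?_, ?_, ?_, ?_, ?_⟩
    · have : 0 < R - 1 := by linarith
      have : 0 < 1 - ‖ζ‖ := by linarith
      positivity
    · exact (min_le_left _ _).trans (min_le_left _ _)
    · exact ((min_le_left _ _).trans (min_le_right _ _)).trans_lt (by linarith)
    · exact ((min_le_right _ _).trans (min_le_left _ _)).trans_lt (by linarith)
    · exact ((min_le_right _ _).trans (min_le_right _ _)).trans_lt (by linarith)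
  have hnorm : ∀ σ : ℂ, ‖(ρ : ℂ) * σ‖ = ρ * ‖σ‖ := fun σ => by
    rw [norm_mul, Complex.norm_real, Real.norm_of_nonneg hρ.le]
  -- A holomorphic function whose real part bounds `ψ` on the circle: for `‖σ‖ = 1` every term that
  -- is not harmonic has become a constant. The inner product is holomorphic in `σ`, being linear in
  -- its second argument.
  set G : ℂ → ℂ := fun σ => ((m + N * ‖d‖ ^ 2 + N * c ^ 2 * ρ ^ 2 - ε * ‖ζ‖ ^ 2 - ε * ρ ^ 2 : ℝ) : ℂ)
    - 2 * N * inner ℂ d (e (ρ * σ)) + p (ζ + ρ * σ) - 2 * ε * ρ * (starRingEnd ℂ ζ * σ) with hGdef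
  have hG : DiffContOnCl ℂ G disc := by
    refine DifferentiableOn.diffContOnCl ?_
    rw [disc, closure_ball _ one_ne_zero]
    have h1 : DifferentiableOn ℂ (fun σ : ℂ => e (ρ * σ)) (Metric.closedBall 0 1) := by
      refine DifferentiableOn.sub (DifferentiableOn.sub ?_ (by fun_prop)) (by fun_prop)
      refine hW.comp (by fun_prop) fun σ hσ => ?_
      rw [mem_closedBall_zero_iff] at hσ
      rw [mem_ball_zero_iff]
      refine (norm_add_le _ _).trans_lt ?_
      rw [hnorm]
      nlinarith
    have h2 : DifferentiableOn ℂ (fun σ : ℂ => inner ℂ d (e (ρ * σ))) (Metric.closedBall 0 1) :=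
      ((innerSL ℂ d).differentiable.comp_differentiableOn h1)
    have h3 : Differentiable ℂ (fun σ : ℂ => p (ζ + ρ * σ)) := hp.comp (by fun_prop)
    exact (((differentiableOn_const _).sub (h2.const_mul _)).add h3.differentiableOn).sub
      (by fun_prop)
  obtain ⟨hGi, hGa⟩ := re_circleAverage hG
  have he0 : e 0 = 0 := by simp [e]
  have hG0 : (G 0).re = m + N * ‖d‖ ^ 2 + N * c ^ 2 * ρ ^ 2 - ε * ‖ζ‖ ^ 2 - ε * ρ ^ 2
      + (p ζ).re := by
    simp [hGdef, he0, -Complex.ofReal_add, -Complex.ofReal_sub, -Complex.ofReal_mul,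
      -Complex.ofReal_pow]
  have hmem : ∀ σ : ℂ, ‖σ‖ ≤ 1 →
      ((r : ℂ) * ζ, w) + σ • ((r : ℂ) * ρ, (ρ : ℂ) • deriv W ζ) ∈ cylinder n := by
    intro σ hσ
    refine ⟨?_, trivial⟩
    have : (r : ℂ) * ζ + σ * ((r : ℂ) * ρ) = r * (ζ + ρ * σ) := by ring
    simp only [Prod.fst_add, Prod.smul_fst, smul_eq_mul, this]
    refine real_mul_mem_disc hr ((norm_add_le _ _).trans ?_)
    rw [hnorm]
    nlinarith [norm_nonneg σ]
  obtain ⟨hi, ha⟩ := hψ.2 _ _ hmem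
  have hmono : Real.circleAverage (fun σ : ℂ =>
      ψ (((r : ℂ) * ζ, w) + σ • ((r : ℂ) * ρ, (ρ : ℂ) • deriv W ζ))) 0 1
      ≤ Real.circleAverage (fun z => (G z).re) 0 1 := by
    refine Real.circleAverage_mono hi hGi fun σ hσ => ?_
    have hσ1 : ‖σ‖ = 1 := by simpa using hσ
    have hτ : ‖(ρ : ℂ) * σ‖ = ρ := by rw [hnorm, hσ1, mul_one]
    have h1 := hcon ((ρ : ℂ) * σ) (by rw [hτ]; exact hρ0)
    have h2 : ((r : ℂ) * ζ, w) + σ • ((r : ℂ) * ρ, (ρ : ℂ) • deriv W ζ)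
        = ((r : ℂ) * (ζ + ρ * σ), w + ((ρ : ℂ) * σ) • deriv W ζ) := by
      ext1
      · simp only [Prod.fst_add, Prod.smul_fst, smul_eq_mul]; ring
      · simp only [Prod.snd_add, Prod.smul_snd, smul_smul, mul_comm]
    have h3 : w + ((ρ : ℂ) * σ) • deriv W ζ - W (ζ + ρ * σ) = d - e (ρ * σ) := by
      simp only [d, e]; abel
    have h4 : ‖d - e (ρ * σ)‖ ^ 2
        = ‖d‖ ^ 2 - 2 * (inner ℂ d (e (ρ * σ))).re + ‖e (ρ * σ)‖ ^ 2 := by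
      exact norm_sub_sq (𝕜 := ℂ) _ _
    have h5 : ‖e (ρ * σ)‖ ^ 2 ≤ c ^ 2 * ρ ^ 2 := by
      have := hball (y := (ρ : ℂ) * σ) (by rw [dist_zero_right, hτ]; exact hρ1)
      rw [hτ] at this
      rw [← mul_pow]
      gcongr
    have h6 : ‖ζ + ρ * σ‖ ^ 2 = ‖ζ‖ ^ 2 + ρ ^ 2 + 2 * ρ * (starRingEnd ℂ ζ * σ).re := by
      have := norm_add_sq (𝕜 := ℂ) ζ (ρ * σ)
      rw [hτ] at this
      rw [this]
      simp [RCLike.inner_apply]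
      ring
    have h7 : (G σ).re = m + N * ‖d‖ ^ 2 + N * c ^ 2 * ρ ^ 2 - ε * ‖ζ‖ ^ 2 - ε * ρ ^ 2
        - 2 * N * (inner ℂ d (e (ρ * σ))).re + (p (ζ + ρ * σ)).re
        - 2 * ε * ρ * (starRingEnd ℂ ζ * σ).re := by
      simp only [hGdef, Complex.add_re, Complex.sub_re, Complex.ofReal_re]
      congr 2
      · congr 1
        have := Complex.re_ofReal_mul (2 * N) (inner ℂ d (e (ρ * σ)))
        push_cast at this
        exact this
      · have := Complex.re_ofReal_mul (2 * ε * ρ) (starRingEnd ℂ ζ * σ)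
        push_cast at this
        exact this
    simp only [h2]
    rw [h7]
    rw [h3, h4, h6] at h1
    nlinarith [mul_le_mul_of_nonneg_left h5 hN]
  rw [hGa, hG0] at hmono
  have hρ2 : 0 < ρ ^ 2 := by positivity
  nlinarith [mul_lt_mul_of_pos_right hcN hρ2]


lemma upperSemicontinuousOn_slice {ψ : ℂ × Cn n → ℝ} (hψ : UpperSemicontinuousOn ψ (cylinder n))
    {r : ℝ} (hr : r ∈ Set.Ico (0 : ℝ) 1) :
    UpperSemicontinuousOn (fun x : ℂ × Cn n => ψ ((r : ℂ) * x.1, x.2))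
      (Metric.closedBall 0 1 ×ˢ Set.univ) := by
  refine hψ.comp (g := fun x : ℂ × Cn n => ((r : ℂ) * x.1, x.2)) (by fun_prop) ?_
  rintro ⟨ζ, w⟩ ⟨hζ, -⟩
  exact ⟨real_mul_mem_disc hr (by simpa using hζ), trivial⟩

/-- The penalty frees the second variable: `ψ(rζ, w) - N‖w - W ζ‖² - Re p + ε‖ζ‖²` is maximized over
a compact set of pairs. For large `N` the maximum lies close to the curve, and by `exists_circle_gt`
it lies over the unit circle, where the hypothesis makes it at most `ε`. -/
lemma psh_curve_le_re {ψ : ℂ × Cn n → ℝ} (hψ : IsPSH (cylinder n) ψ) {r : ℝ}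
    (hr : r ∈ Set.Ico (0 : ℝ) 1) {W : ℂ → Cn n} {R : ℝ} (hR : 1 < R)
    (hW : DifferentiableOn ℂ W (Metric.ball 0 R)) {p : ℂ → ℂ} (hp : Differentiable ℂ p)
    (hlt : ∀ ζ : ℂ, ‖ζ‖ = 1 → ψ ((r : ℂ) * ζ, W ζ) < (p ζ).re) {ζ₀ : ℂ} (hζ₀ : ‖ζ₀‖ ≤ 1) :
    ψ ((r : ℂ) * ζ₀, W ζ₀) ≤ (p ζ₀).re := by
  have hWc : ContinuousOn W (Metric.closedBall 0 1) :=
    hW.continuousOn.mono (Metric.closedBall_subset_ball hR)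
  obtain ⟨B, hB⟩ := (isCompact_closedBall (0 : ℂ) 1).exists_bound_of_continuousOn hWc
  set K : Set (ℂ × Cn n) := Metric.closedBall 0 1 ×ˢ Metric.closedBall 0 (B + 1)
  have hK : IsCompact K := (isCompact_closedBall _ _).prod (isCompact_closedBall _ _)
  have hKsub : K ⊆ Metric.closedBall 0 1 ×ˢ Set.univ := Set.prod_mono_right (Set.subset_univ _)
  have hf := (upperSemicontinuousOn_slice hψ.1 hr).mono hKsub
  have hpc : Continuous fun x : ℂ × Cn n => (p x.1).re :=
    Complex.continuous_re.comp (hp.continuous.comp continuous_fst)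
  have hWK : ContinuousOn (fun x : ℂ × Cn n => W x.1) K :=
    hWc.comp continuous_fst.continuousOn fun x hx => hx.1
  have hwK : ∀ ζ : ℂ, ‖ζ‖ ≤ 1 → ∀ w : Cn n, ‖w - W ζ‖ ≤ 1 → (ζ, w) ∈ K := by
    intro ζ hζ w hw
    refine ⟨by simpa using hζ, ?_⟩
    have h1 := hB ζ (by simpa using hζ)
    have h2 := norm_add_le (w - W ζ) (W ζ)
    rw [sub_add_cancel] at h2
    simp only [mem_closedBall_zero_iff]
    linarith
  -- a uniform neighbourhood of the boundary curve
  obtain ⟨δ, hδ, hδ1, hδlt⟩ : ∃ δ : ℝ, 0 < δ ∧ δ ≤ 1 ∧ ∀ x ∈ K, ‖x.1‖ = 1 → ‖x.2 - W x.1‖ < δ →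
      ψ ((r : ℂ) * x.1, x.2) < (p x.1).re := by
    set T : Set (ℂ × Cn n) := Metric.sphere 0 1 ×ˢ Metric.closedBall 0 (B + 1)
    have hT : IsCompact T := (isCompact_sphere _ _).prod (isCompact_closedBall _ _)
    have hTK : T ⊆ K := Set.prod_mono_left Metric.sphere_subset_closedBall
    have hu : UpperSemicontinuousOn
        (fun x : ℂ × Cn n => ψ ((r : ℂ) * x.1, x.2) + -(p x.1).re) T :=
      (hf.mono hTK).add hpc.neg.continuousOn.upperSemicontinuousOn
    -- By upper semicontinuity the set over the circle where `ψ ≥ Re p` is compact; it misses the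
    -- graph of `W`, hence stays at a positive distance from it.
    have hZ := hu.isCompact_inter_preimage_Ici hT (0 : ℝ)
    set Z := T ∩ (fun x : ℂ × Cn n => ψ ((r : ℂ) * x.1, x.2) + -(p x.1).re) ⁻¹' Set.Ici 0
    rcases Z.eq_empty_or_nonempty with hZe | hZn
    · refine ⟨1, one_pos, le_rfl, fun x hx h1 _ => ?_⟩
      by_contra hcon
      have : x ∈ Z := ⟨⟨by simpa using h1, hx.2⟩, by simp; linarith⟩
      rw [hZe] at this
      exact this
    · have hcz : ContinuousOn (fun x : ℂ × Cn n => ‖x.2 - W x.1‖) Z :=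
        ((continuous_snd.continuousOn.sub hWK).norm).mono fun x hx => hTK hx.1
      obtain ⟨z, hzZ, hzmin⟩ := hZ.exists_isMinOn hZn hcz
      have hzpos : 0 < ‖z.2 - W z.1‖ := by
        rw [norm_pos_iff, sub_ne_zero]
        intro heq
        have h1 := hlt z.1 (by simpa using hzZ.1.1)
        rw [← heq] at h1
        have h2 : 0 ≤ ψ ((r : ℂ) * z.1, z.2) + -(p z.1).re := hzZ.2
        linarith
      refine ⟨min 1 ‖z.2 - W z.1‖, lt_min one_pos hzpos, min_le_left _ _, fun x hx h1 h2 => ?_⟩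
      by_contra hcon
      have hxZ : x ∈ Z := ⟨⟨by simpa using h1, hx.2⟩, by simp; linarith⟩
      have h3 : ‖z.2 - W z.1‖ ≤ ‖x.2 - W x.1‖ := hzmin hxZ
      exact absurd (h2.trans_le (min_le_right _ _)) (not_lt.2 h3)
  -- upper bound for the function without penalty
  obtain ⟨M, hM⟩ := (hf.add hpc.neg.continuousOn.upperSemicontinuousOn).bddAbove_of_isCompact hK
  refine le_of_forall_pos_le_add fun ε hε => ?_
  set φ₀ := ψ ((r : ℂ) * ζ₀, W ζ₀) - (p ζ₀).re + ε * ‖ζ₀‖ ^ 2 with hφ₀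
  -- At distance `δ` from the curve the penalty exceeds `M + ε - φ₀`, the most that could be gained
  -- over the value at the starting point.
  set N := (|M + ε - φ₀| + 1) / δ ^ 2
  have hN : 0 ≤ N := by positivity
  have hNδ : N * δ ^ 2 = |M + ε - φ₀| + 1 := by
    rw [div_mul_cancel₀]; positivity
  have hu : UpperSemicontinuousOn (fun x : ℂ × Cn n => ψ ((r : ℂ) * x.1, x.2)
      + (-(N * ‖x.2 - W x.1‖ ^ 2) - (p x.1).re + ε * ‖x.1‖ ^ 2)) K := by
    refine hf.add (ContinuousOn.upperSemicontinuousOn ?_)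
    have h1 : ContinuousOn (fun x : ℂ × Cn n => ‖x.2 - W x.1‖) K :=
      (continuous_snd.continuousOn.sub hWK).norm
    exact ((h1.pow 2).const_mul N).neg.sub hpc.continuousOn |>.add (by fun_prop)
  have hx₀ : (ζ₀, W ζ₀) ∈ K := hwK _ hζ₀ _ (by simp)
  obtain ⟨⟨ζ, w⟩, hx, hmax⟩ := hu.exists_isMaxOn ⟨_, hx₀⟩ hK
  have h0 := hmax hx₀
  simp only [Set.mem_ofPred_eq, sub_self, norm_zero] at h0
  have hMx : ψ ((r : ℂ) * ζ, w) + -(p ζ).re ≤ M := hM ⟨_, hx, rfl⟩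
  have hζ1 : ‖ζ‖ ≤ 1 := by simpa using hx.1
  have hζ2 : ‖ζ‖ ^ 2 ≤ 1 := pow_le_one₀ (norm_nonneg _) hζ1
  have hd : ‖w - W ζ‖ < δ := by
    by_contra hcon
    push Not at hcon
    have h1 : N * δ ^ 2 ≤ N * ‖w - W ζ‖ ^ 2 := by gcongr
    have h2 := le_abs_self (M + ε - φ₀)
    have h3 := mul_le_mul_of_nonneg_left hζ2 hε.le
    linarith
  have hζeq : ‖ζ‖ = 1 := by
    by_contra hne
    have hlt1 : ‖ζ‖ < 1 := lt_of_le_of_ne hζ1 hne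
    have hev : ∀ᶠ τ : ℂ in 𝓝 0, ‖ζ + τ‖ < 1 ∧ ‖w + τ • deriv W ζ‖ < B + 1 := by
      have hwB : ‖w‖ < B + 1 := by
        have h1 := hB ζ (by simpa using hζ1)
        have h2 := norm_add_le (w - W ζ) (W ζ)
        rw [sub_add_cancel] at h2
        linarith
      have c1 : ContinuousAt (fun τ : ℂ => ‖ζ + τ‖) 0 := by fun_prop
      have c2 : ContinuousAt (fun τ : ℂ => ‖w + τ • deriv W ζ‖) 0 := by fun_prop
      exact (c1.eventually_lt continuousAt_const (by simpa using hlt1)).and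
        (c2.eventually_lt continuousAt_const (by simpa using hwB))
    obtain ⟨ρ, hρ, hball⟩ := Metric.eventually_nhds_iff.1 hev
    obtain ⟨τ, hτ, hgt⟩ := exists_circle_gt hψ hr hR hW hp hlt1 w hN hε (half_pos hρ)
    obtain ⟨h1, h2⟩ := hball (y := τ) (by rw [dist_zero_right]; linarith)
    have hmem : (ζ + τ, w + τ • deriv W ζ) ∈ K := ⟨by simpa using h1.le, by simpa using h2.le⟩
    have h3 := hmax hmem
    simp only [Set.mem_ofPred_eq] at h3
    linarith
  have hfin := hδlt _ hx hζeq hd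
  have hpen : 0 ≤ N * ‖w - W ζ‖ ^ 2 := by positivity
  simp only at hfin
  nlinarith [mul_nonneg hε.le (sq_nonneg ‖ζ₀‖)]

end

/-! ### The sub-mean value inequality on curves with continuous and with integrable majorants -/

section


lemma integrable_of_continuous {E : Type*} [NormedAddCommGroup E] {g : Circle → E}
    (hg : Continuous g) : Integrable g arc :=
  hg.integrable_of_hasCompactSupport (HasCompactSupport.of_compactSpace _)

lemma exists_polynomial_re_fourier (c : ℂ) (k : ℤ) :
    ∃ p : Polynomial ℂ, ∀ x : AddCircle (1 : ℝ),
      (c * fourier k x).re = (p.eval (AddCircle.toCircle x : ℂ)).re := by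
  obtain ⟨m, rfl | rfl⟩ := k.eq_nat_or_neg
  · refine ⟨Polynomial.C c * Polynomial.X ^ m, fun x => ?_⟩
    rw [fourier_apply, natCast_zsmul, AddCircle.toCircle_nsmul]
    simp
  · refine ⟨Polynomial.C (starRingEnd ℂ c) * Polynomial.X ^ m, fun x => ?_⟩
    rw [fourier_neg, fourier_apply, natCast_zsmul, AddCircle.toCircle_nsmul]
    rw [← Complex.conj_re]
    simp

/-- Real parts of polynomials are uniformly dense in the continuous functions on the circle. -/
lemma exists_polynomial_re_near (g : C(Circle, ℝ)) {η : ℝ} (hη : 0 < η) :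
    ∃ p : Polynomial ℂ, ∀ s : Circle, |(p.eval (s : ℂ)).re - g s| < η := by
  have h1ne : (1 : ℝ) ≠ 0 := one_ne_zero
  let G : C(AddCircle (1 : ℝ), ℂ) :=
    ⟨fun x => (g (AddCircle.toCircle x) : ℂ), by fun_prop⟩
  have hG : G ∈ (Submodule.span ℂ (Set.range (@fourier (1 : ℝ)))).topologicalClosure := by
    rw [span_fourier_closure_eq_top]; trivial
  rw [← SetLike.mem_coe, Submodule.topologicalClosure_coe, Metric.mem_closure_iff] at hG
  obtain ⟨f, hf, hfG⟩ := hG η hη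
  obtain ⟨c, rfl⟩ := Finsupp.mem_span_range_iff_exists_finsupp.1 hf
  choose P hP using fun k => exists_polynomial_re_fourier (c k) k
  refine ⟨∑ k ∈ c.support, P k, fun s => ?_⟩
  obtain ⟨x, hx⟩ := (AddCircle.homeomorphCircle h1ne).surjective s
  rw [AddCircle.homeomorphCircle_apply] at hx
  subst hx
  have h2 : ((∑ k ∈ c.support, P k).eval (AddCircle.toCircle x : ℂ)).re
      = ((c.sum fun i a => a • fourier i : C(AddCircle (1 : ℝ), ℂ)) x).re := by
    rw [Polynomial.eval_finsetSum, Complex.re_sum, Finsupp.sum, ContinuousMap.sum_apply,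
      Complex.re_sum]
    refine Finset.sum_congr rfl fun k _ => ?_
    rw [← hP]
    rfl
  rw [h2]
  have h3 := ContinuousMap.dist_apply_le_dist (f := G)
    (g := (c.sum fun i a => a • fourier i : C(AddCircle (1 : ℝ), ℂ))) x
  have h4 := h3.trans_lt hfG
  rw [dist_comm, dist_eq_norm] at h4
  refine lt_of_le_of_lt ?_ h4
  have h5 := Complex.abs_re_le_norm ((c.sum fun i a => a • fourier i :
    C(AddCircle (1 : ℝ), ℂ)) x - G x)
  simpa [G] using h5

lemma poisson_re_polynomial (p : Polynomial ℂ) {t : ℂ} (ht : t ∈ disc) :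
    poisson (fun s : Circle => (p.eval (s : ℂ)).re) t = (p.eval t).re := by
  have h1 := poisson_of_diffContOnCl (F := fun z => p.eval z)
    (p.differentiable.diffContOnCl) ht
  have hi : Integrable (fun s : Circle => p.eval (s : ℂ)) arc :=
    integrable_of_continuous (p.continuous.comp (by fun_prop))
  rw [← h1]
  exact (clm_poisson Complex.reCLM hi ht).symm

variable {n : ℕ}

lemma psh_curve_le_poisson_continuous {ψ : ℂ × Cn n → ℝ} (hψ : IsPSH (cylinder n) ψ) {r : ℝ}
    (hr : r ∈ Set.Ico (0 : ℝ) 1) {W : ℂ → Cn n} {R : ℝ} (hR : 1 < R)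
    (hW : DifferentiableOn ℂ W (Metric.ball 0 R)) (g : C(Circle, ℝ))
    (hlt : ∀ s : Circle, ψ ((r : ℂ) * s, W s) < g s) {t : ℂ} (ht : t ∈ disc) :
    ψ ((r : ℂ) * t, W t) ≤ poisson g t := by
  refine le_of_forall_pos_le_add fun η hη => ?_
  -- Approximating `g + η/2` up to `η/2` puts `Re p` strictly between `g` and `g + η`.
  obtain ⟨p, hp⟩ := exists_polynomial_re_near (g + ContinuousMap.const _ (η / 2)) (half_pos hη)
  have h1 : ∀ s : Circle, g s < (p.eval (s : ℂ)).re ∧ (p.eval (s : ℂ)).re ≤ g s + η := by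
    intro s
    have := abs_lt.1 (hp s)
    simp only [ContinuousMap.add_apply, ContinuousMap.const_apply] at this
    constructor <;> linarith [this.1, this.2]
  have h2 := psh_curve_le_re hψ hr hR hW p.differentiable (fun ζ hζ => ?_) (mem_disc.1 ht).le
  · refine h2.trans ?_
    rw [← poisson_re_polynomial p ht]
    have hgi := integrable_of_continuous g.continuous
    have hci : Integrable (fun _ : Circle => η) arc := integrable_const _
    refine (poisson_mono (integrable_of_continuous
      (Complex.continuous_re.comp (p.continuous.comp (by fun_prop)))) (hgi.add hci)
      (Eventually.of_forall fun s => (h1 s).2) ht).trans ?_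
    rw [← poisson_const_real η ht, ← poisson_add hgi hci ht, poisson_const_real η ht]
    exact le_rfl
  · have h3 : ζ ∈ Submonoid.unitSphere ℂ := by simpa [Submonoid.unitSphere] using hζ
    have h4 : ∃ s : Circle, (s : ℂ) = ζ := ⟨⟨ζ, h3⟩, rfl⟩
    obtain ⟨s, rfl⟩ := h4
    exact (hlt s).trans (h1 s).1

/-- Semicontinuity provides constants that work locally, and the admissible values at each point
form an interval, so a partition of unity glues them. -/
lemma exists_continuous_between {u : Circle → ℝ} {g : Circle → EReal}
    (hu : UpperSemicontinuous u) (hg : LowerSemicontinuous g) (h : ∀ s, (u s : EReal) < g s) :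
    ∃ k : C(Circle, ℝ), ∀ s, u s < k s ∧ (k s : EReal) < g s := by
  refine exists_continuous_forall_mem_convex_of_local_const
    (t := fun s => {x : ℝ | u s < x ∧ (x : EReal) < g s}) (fun s => ?_) fun s => ?_
  · refine Set.OrdConnected.convex ⟨fun x hx y hy z hz => ⟨hx.1.trans_le hz.1, ?_⟩⟩
    exact lt_of_le_of_lt (EReal.coe_le_coe_iff.2 hz.2) hy.2
  · obtain ⟨c, hc1, hc2⟩ := EReal.lt_iff_exists_real_btwn.1 (h s)
    refine ⟨c, ?_⟩
    filter_upwards [hu s c (EReal.coe_lt_coe_iff.1 hc1), hg s c hc2] with y h1 h2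
    exact ⟨h1, h2⟩

lemma upperSemicontinuous_curve {ψ : ℂ × Cn n → ℝ} (hψ : UpperSemicontinuousOn ψ (cylinder n))
    {r : ℝ} (hr : r ∈ Set.Ico (0 : ℝ) 1) {W : Circle → Cn n} (hW : Continuous W) :
    UpperSemicontinuous fun s : Circle => ψ ((r : ℂ) * s, W s) := by
  rw [← upperSemicontinuousOn_univ_iff]
  refine hψ.comp (g := fun s : Circle => ((r : ℂ) * s, W s)) (by fun_prop) fun s _ => ?_
  exact ⟨real_mul_mem_disc hr (Circle.norm_coe s).le, trivial⟩

/-- A version of the Vitali–Carathéodory theorem for Poisson integrals. -/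
lemma exists_lsc_gt_poisson_le {v : Circle → ℝ} (hv : Integrable v arc) {t : ℂ} (ht : t ∈ disc)
    {ε : ℝ} (hε : 0 < ε) :
    ∃ g : Circle → EReal, (∀ s, (v s : EReal) < g s) ∧ LowerSemicontinuous g ∧
      Integrable (fun s => (g s).toReal) arc ∧ (∀ᵐ s ∂arc, ((g s).toReal : EReal) = g s) ∧
      poisson (fun s => (g s).toReal) t ≤ poisson v t + ε := by
  set C := (1 + ‖t‖) / (1 - ‖t‖)
  have hC : 0 < C := by
    have := norm_nonneg t
    have : 0 < 1 - ‖t‖ := by rw [mem_disc] at ht; linarith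
    positivity
  obtain ⟨g, hvg, hg, hgi, hgtop, hgint⟩ :=
    exists_lt_lowerSemicontinuous_integral_lt v hv (div_pos hε hC)
  have hgt : ∀ᵐ s ∂arc, ((g s).toReal : EReal) = g s := by
    filter_upwards [hgtop] with s hs
    exact EReal.coe_toReal hs.ne (ne_bot_of_gt (hvg s))
  refine ⟨g, hvg, hg, hgi, hgt, ?_⟩
  have h3 : poisson (fun s => (g s).toReal) t - poisson v t ≤ ε := by
    rw [← poisson_sub hgi hv ht]
    have h4 : poisson (fun s => (g s).toReal - v s) t ≤ ∫ s, C * ((g s).toReal - v s) ∂arc := by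
      refine integral_mono_ae (integrable_kernel_smul (hgi.sub hv) ht)
        ((hgi.sub hv).const_mul C) ?_
      filter_upwards [hgt] with s hs
      refine mul_le_mul_of_nonneg_right (kernel_le ht s) ?_
      have := hvg s
      rw [← hs, EReal.coe_lt_coe_iff] at this
      linarith
    refine h4.trans ?_
    rw [integral_const_mul, integral_sub hgi hv]
    have : C * (ε / C) = ε := by field_simp
    nlinarith
  linarith

/-- Plurisubharmonic functions satisfy the sub-mean value property along holomorphic curves. -/
theorem psh_curve_le_poisson {ψ : ℂ × Cn n → ℝ} (hψ : IsPSH (cylinder n) ψ) {r : ℝ}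
    (hr : r ∈ Set.Ico (0 : ℝ) 1) {W : ℂ → Cn n} {R : ℝ} (hR : 1 < R)
    (hW : DifferentiableOn ℂ W (Metric.ball 0 R)) {v : Circle → ℝ} (hv : Integrable v arc)
    (hle : ∀ᵐ s : Circle ∂arc, ψ ((r : ℂ) * s, W s) ≤ v s) {t : ℂ} (ht : t ∈ disc) :
    ψ ((r : ℂ) * t, W t) ≤ poisson v t := by
  -- The bound holds almost everywhere only, whereas inserting a continuous function requires it at
  -- every point.
  set v' : Circle → ℝ := fun s => max (v s) (ψ ((r : ℂ) * s, W s))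
  have hv' : v =ᵐ[arc] v' := by
    filter_upwards [hle] with s hs
    exact (max_eq_left hs).symm
  rw [poisson_congr_ae hv']
  refine le_of_forall_pos_le_add fun ε hε => ?_
  obtain ⟨g, hvg, hg, hgi, hgt, hgp⟩ := exists_lsc_gt_poisson_le (hv.congr hv') ht hε
  have hWc : Continuous fun s : Circle => W s :=
    hW.continuousOn.comp_continuous (by fun_prop) fun s => by
      rw [mem_ball_zero_iff, Circle.norm_coe]; exact hR
  obtain ⟨k, hk⟩ := exists_continuous_between (upperSemicontinuous_curve hψ.1 hr hWc) hg
    fun s => lt_of_le_of_lt (EReal.coe_le_coe_iff.2 (le_max_right _ _)) (hvg s)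
  refine (psh_curve_le_poisson_continuous hψ hr hR hW k (fun s => (hk s).1) ht).trans
    (le_trans ?_ hgp)
  refine poisson_mono (integrable_of_continuous k.continuous) hgi ?_ ht
  filter_upwards [hgt] with s hs
  rw [← EReal.coe_le_coe_iff, hs]
  exact (hk s).2.le

end

section


/-! ### Poisson integrals of extended real valued functions -/

lemma poissonExt_eq {h : Circle → EReal} {k : Circle → ℝ} (hk : Integrable k arc)
    (hhk : ∀ᵐ s ∂arc, h s = k s) {t : ℂ} (ht : t ∈ disc) :
    poissonExt h t = ((poisson k t : ℝ) : EReal) := by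
  have hi := integrable_kernel_smul hk ht
  have h1 : ∫⁻ s, ENNReal.ofReal (kernel t s) * (h s).toENNReal ∂arc
      = ∫⁻ s, ENNReal.ofReal (kernel t s • k s) ∂arc := by
    refine lintegral_congr_ae ?_
    filter_upwards [hhk] with s hs
    rw [hs, smul_eq_mul, ENNReal.ofReal_mul (kernel_pos ht s).le, EReal.real_coe_toENNReal]
  have h2 : ∫⁻ s, ENNReal.ofReal (kernel t s) * (-h s).toENNReal ∂arc
      = ∫⁻ s, ENNReal.ofReal (-(kernel t s • k s)) ∂arc := by
    refine lintegral_congr_ae ?_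
    filter_upwards [hhk] with s hs
    rw [hs, smul_eq_mul, ← mul_neg, ENNReal.ofReal_mul (kernel_pos ht s).le, ← EReal.coe_neg,
      EReal.real_coe_toENNReal]
  have f1 : ∫⁻ s, ENNReal.ofReal (kernel t s • k s) ∂arc ≠ ∞ := hi.lintegral_lt_top.ne
  have f2 : ∫⁻ s, ENNReal.ofReal (-(kernel t s • k s)) ∂arc ≠ ∞ := hi.neg.lintegral_lt_top.ne
  rw [poissonExt, h1, h2, poisson, integral_eq_lintegral_pos_part_sub_lintegral_neg_part hi,
    EReal.coe_sub, EReal.coe_ennreal_toReal f1, EReal.coe_ennreal_toReal f2]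

/-- The lower bound keeps the negative integral finite, so an infinite positive integral would give
the value `⊤`. Since the kernel is bounded away from 0, finiteness at the single point `t` yields
integrability on the circle. -/
lemma exists_integrable_of_poissonExt_ne_top {h : Circle → EReal} (hm : AEMeasurable h arc) {A : ℝ}
    (hA : ∀ s, ((-A : ℝ) : EReal) ≤ h s) {t : ℂ} (ht : t ∈ disc) (hP : poissonExt h t ≠ ⊤) :
    ∃ k : Circle → ℝ, Integrable k arc ∧ ∀ᵐ s ∂arc, h s = k s := by
  have hKm : Measurable fun s => ENNReal.ofReal (kernel t s) :=
    (continuous_kernel ht).measurable.ennreal_ofReal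
  have hKpos : ∀ s, ENNReal.ofReal (kernel t s) ≠ 0 := fun s => by simpa using kernel_pos ht s
  have hKi : ∫⁻ s, ENNReal.ofReal (kernel t s) ∂arc ≠ ∞ :=
    (integrable_of_continuous (continuous_kernel ht)).lintegral_lt_top.ne
  have hneg : ∀ s, (-h s).toENNReal ≤ ENNReal.ofReal A := fun s => by
    rw [← EReal.real_coe_toENNReal]
    refine EReal.toENNReal_le_toENNReal ?_
    rw [EReal.neg_le]
    simpa using hA s
  have h2 : ∫⁻ s, ENNReal.ofReal (kernel t s) * (-h s).toENNReal ∂arc ≠ ∞ := by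
    refine ne_top_of_le_ne_top (b := ∫⁻ s, ENNReal.ofReal (kernel t s) * ENNReal.ofReal A ∂arc) ?_
      (lintegral_mono fun s => by gcongr; exact hneg s)
    rw [lintegral_mul_const' _ _ ENNReal.ofReal_ne_top]
    exact ENNReal.mul_ne_top hKi ENNReal.ofReal_ne_top
  have h1 : ∫⁻ s, ENNReal.ofReal (kernel t s) * (h s).toENNReal ∂arc ≠ ∞ := by
    intro htop
    refine hP ?_
    rw [poissonExt, htop, EReal.coe_ennreal_top]
    exact EReal.top_sub (by simpa using h2)
  have hme : AEMeasurable (fun s => (h s).toENNReal) arc :=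
    measurable_ereal_toENNReal.comp_aemeasurable hm
  have hfin : ∀ᵐ s ∂arc, h s ≠ ⊤ := by
    filter_upwards [ae_lt_top' (hKm.aemeasurable.mul hme) h1] with s hs htop
    simp [htop, ENNReal.mul_top (hKpos s)] at hs
  have hkm : AEMeasurable (fun s => (h s).toReal) arc := measurable_ereal_toReal.comp_aemeasurable hm
  refine ⟨fun s => (h s).toReal, ?_, ?_⟩
  · refine integrable_of_kernel_smul ht ⟨(continuous_kernel ht).aestronglyMeasurable.smul
      hkm.aestronglyMeasurable, ?_⟩
    rw [hasFiniteIntegral_iff_enorm]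
    refine lt_of_le_of_lt (b := ∫⁻ s, (ENNReal.ofReal (kernel t s) * (h s).toENNReal +
      ENNReal.ofReal (kernel t s) * (-h s).toENNReal) ∂arc) ?_ ?_
    · refine lintegral_mono_ae ?_
      filter_upwards [hfin] with s hs
      rw [enorm_smul, Real.enorm_of_nonneg (kernel_pos ht s).le, ← mul_add]
      gcongr
      have hb : h s ≠ ⊥ := ne_bot_of_le_ne_bot (EReal.coe_ne_bot _) (hA s)
      obtain ⟨x, hx⟩ : ∃ x : ℝ, h s = x := ⟨_, (EReal.coe_toReal hs hb).symm⟩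
      rw [hx, ← EReal.coe_neg, EReal.real_coe_toENNReal, EReal.real_coe_toENNReal, EReal.toReal_coe]
      rcases le_total 0 x with h0 | h0
      · rw [Real.enorm_of_nonneg h0]; exact le_self_add
      · rw [← enorm_neg, Real.enorm_of_nonneg (by linarith)]; exact le_add_self
    · have hmul : AEMeasurable (fun s => ENNReal.ofReal (kernel t s) * (h s).toENNReal) arc :=
        hKm.aemeasurable.mul hme
      rw [lintegral_add_left' hmul]
      exact ENNReal.add_lt_top.2 ⟨h1.lt_top, h2.lt_top⟩
  · filter_upwards [hfin] with s hs
    exact (EReal.coe_toReal hs (ne_bot_of_le_ne_bot (EReal.coe_ne_bot _) (hA s))).symm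

/-! ### Harmonic measure -/

/-- The harmonic measure of the disc at the point `t`. -/
noncomputable def harmonicMeasure (t : ℂ) : Measure Circle :=
  arc.withDensity fun s => ((kernel t s).toNNReal : ℝ≥0∞)

section Harmonic

variable {E : Type*} [NormedAddCommGroup E] [NormedSpace ℝ E] {t : ℂ}

lemma measurable_kernel_toNNReal (ht : t ∈ disc) : Measurable fun s => (kernel t s).toNNReal :=
  (continuous_kernel ht).measurable.real_toNNReal

lemma kernel_toNNReal_smul (ht : t ∈ disc) (s : Circle) (x : E) :
    (kernel t s).toNNReal • x = kernel t s • x := by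
  rw [NNReal.smul_def, Real.coe_toNNReal _ (kernel_pos ht s).le]

lemma integral_harmonicMeasure (ht : t ∈ disc) (g : Circle → E) :
    ∫ s, g s ∂(harmonicMeasure t) = poisson g t := by
  rw [harmonicMeasure, integral_withDensity_eq_integral_smul (measurable_kernel_toNNReal ht)]
  exact integral_congr_ae (Eventually.of_forall fun s => kernel_toNNReal_smul ht s _)

lemma integrable_harmonicMeasure_iff (ht : t ∈ disc) {g : Circle → E} :
    Integrable g (harmonicMeasure t) ↔ Integrable g arc := by
  rw [harmonicMeasure, integrable_withDensity_iff_integrable_smul (measurable_kernel_toNNReal ht)]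
  simp only [kernel_toNNReal_smul ht]
  exact ⟨integrable_of_kernel_smul ht, fun h => integrable_kernel_smul h ht⟩

lemma isProbabilityMeasure_harmonicMeasure (ht : t ∈ disc) :
    IsProbabilityMeasure (harmonicMeasure t) := by
  constructor
  rw [harmonicMeasure, withDensity_apply _ MeasurableSet.univ, setLIntegral_univ]
  have h1 := ofReal_integral_eq_lintegral_ofReal (integrable_of_continuous (continuous_kernel ht))
    (Eventually.of_forall fun s => (kernel_pos ht s).le)
  rw [integral_kernel ht, ENNReal.ofReal_one] at h1
  exact h1.symm

lemma ae_of_ae_harmonicMeasure (ht : t ∈ disc) {P : Circle → Prop}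
    (h : ∀ᵐ s ∂(harmonicMeasure t), P s) : ∀ᵐ s ∂arc, P s := by
  rw [harmonicMeasure, ae_withDensity_iff (measurable_kernel_toNNReal ht).coe_nnreal_ennreal] at h
  filter_upwards [h] with s hs
  exact hs (by simpa using kernel_pos ht s)

end Harmonic

/-- Jensen's inequality for Poisson integrals. -/
lemma norm_poisson_rpow_le {n : ℕ} {b : Circle → Cn n} {p : ℝ} (hp : 1 ≤ p)
    (hb : Integrable b arc) (hbp : Integrable (fun s => ‖b s‖ ^ p) arc) {t : ℂ} (ht : t ∈ disc) :
    ‖poisson b t‖ ^ p ≤ poisson (fun s => ‖b s‖ ^ p) t := by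
  have hν := isProbabilityMeasure_harmonicMeasure ht
  have h1 : ‖poisson b t‖ ≤ poisson (fun s => ‖b s‖) t := by
    rw [← integral_harmonicMeasure ht, ← integral_harmonicMeasure ht]
    exact norm_integral_le_integral_norm _
  have h2 := (convexOn_rpow hp).map_integral_le (μ := harmonicMeasure t) (f := fun s => ‖b s‖)
    (Real.continuous_rpow_const (by linarith)).continuousOn
    isClosed_Ici (Eventually.of_forall fun s => norm_nonneg _)
    ((integrable_harmonicMeasure_iff ht).2 hb.norm) ((integrable_harmonicMeasure_iff ht).2 hbp)
  rw [integral_harmonicMeasure ht, integral_harmonicMeasure ht] at h2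
  exact (Real.rpow_le_rpow (norm_nonneg _) h1 (by linarith)).trans h2

/-! ### Boundary behaviour of plurisubharmonic functions along curves -/

variable {n : ℕ}

lemma BoundaryLE.eventually_lt {ψ : ℂ × Cn n → ℝ} {s : Circle} {z : Cn n} {c : EReal}
    (h : limsup (fun x : ℝ × Cn n => (ψ ((x.1 : ℂ) * (s : ℂ), x.2) : EReal))
      (𝓝[Set.Ioo 0 1] (1 : ℝ) ×ˢ 𝓝 z) < c) :
    ∀ᶠ x : ℝ × Cn n in 𝓝[Set.Ioo 0 1] (1 : ℝ) ×ˢ 𝓝 z,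
      (ψ ((x.1 : ℂ) * (s : ℂ), x.2) : EReal) < c :=
  eventually_lt_of_limsup_lt h

/-- Dilating a curve by `r m` moves the point of evaluation to `t / r m`, which has to remain in the
disc. -/
lemma exists_radii (t : ℂ) (ht : t ∈ disc) : ∃ r : ℕ → ℝ, (∀ m, r m ∈ Set.Ioo (0 : ℝ) 1) ∧
    Tendsto r atTop (𝓝[Set.Ioo 0 1] 1) ∧ ∀ m, t / r m ∈ disc := by
  rw [mem_disc] at ht
  have h0 := norm_nonneg t
  set a := (1 + ‖t‖) / 2
  have ha1 : a < 1 := by simp only [a]; linarith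
  have hta : ‖t‖ < a := by simp only [a]; linarith
  have hmem : ∀ m : ℕ, 1 - (1 - a) * (1 / ((m : ℝ) + 1)) ∈ Set.Ico a 1 := by
    intro m
    have h1 : 1 / ((m : ℝ) + 1) ≤ 1 := by
      rw [div_le_one (by positivity)]; linarith [Nat.cast_nonneg (α := ℝ) m]
    have h2 : 0 < 1 / ((m : ℝ) + 1) := by positivity
    constructor <;> nlinarith
  have hIoo : ∀ m : ℕ, 1 - (1 - a) * (1 / ((m : ℝ) + 1)) ∈ Set.Ioo (0 : ℝ) 1 := fun m =>
    ⟨by linarith [(hmem m).1], (hmem m).2⟩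
  refine ⟨fun m => 1 - (1 - a) * (1 / ((m : ℝ) + 1)), hIoo, ?_, ?_⟩
  · refine tendsto_nhdsWithin_iff.2 ⟨?_, Eventually.of_forall hIoo⟩
    have := (tendsto_one_div_add_atTop_nhds_zero_nat (𝕜 := ℝ)).const_mul (1 - a)
    simpa using this.const_sub 1
  · intro m
    rw [mem_disc, norm_div, Complex.norm_real, Real.norm_of_nonneg (hIoo m).1.le,
      div_lt_one (hIoo m).1]
    linarith [(hmem m).1]

lemma tendsto_div_radii {t : ℂ} {r : ℕ → ℝ} (hr : Tendsto r atTop (𝓝[Set.Ioo 0 1] 1)) :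
    Tendsto (fun m => t / (r m : ℂ)) atTop (𝓝 t) := by
  have h1 : Tendsto r atTop (𝓝 1) := hr.mono_right nhdsWithin_le_nhds
  have h2 : Tendsto (fun m => (r m : ℂ)) atTop (𝓝 ((1 : ℝ) : ℂ)) :=
    (Complex.continuous_ofReal.tendsto 1).comp h1
  have h3 : Tendsto (fun m => t / (r m : ℂ)) atTop (𝓝 (t / ((1 : ℝ) : ℂ))) :=
    (tendsto_const_nhds (x := t)).div h2 (by simp)
  simpa using h3

/-- If a plurisubharmonic function is dominated by a Poisson integral along a holomorphic curve,
then it is dominated by the Poisson integral of its boundary values. -/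
theorem psh_curve_le_poisson_boundary {ψ : ℂ × Cn n → ℝ} {φ : Circle → Cn n → EReal}
    (hψ : IsPSH (cylinder n) ψ) (hψφ : BoundaryLE ψ φ) {F : ℂ → Cn n}
    (hF : DifferentiableOn ℂ F disc) {β : Circle → Cn n}
    (hFβ : ∀ᵐ s : Circle ∂arc, Tendsto (fun r : ℝ => F ((r : ℂ) * s))
      (𝓝[Set.Ioo 0 1] (1 : ℝ)) (𝓝 (β s)))
    {v : Circle → ℝ} (hv : Integrable v arc) (hle : ∀ t ∈ disc, ψ (t, F t) ≤ poisson v t)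
    {k : Circle → ℝ} (hk : Integrable k arc) (hφk : ∀ᵐ s ∂arc, φ s (β s) ≤ k s)
    {t : ℂ} (ht : t ∈ disc) : ψ (t, F t) ≤ poisson k t := by
  obtain ⟨r, hr, hr1, hrt⟩ := exists_radii t ht
  have hrI : ∀ m, r m ∈ Set.Ico (0 : ℝ) 1 := fun m => ⟨(hr m).1.le, (hr m).2⟩
  have hτ := tendsto_div_radii (t := t) hr1
  have hrτ : ∀ m, (r m : ℂ) * (t / r m) = t := fun m =>
    mul_div_cancel₀ _ (by exact_mod_cast (hr m).1.ne')
  set V : ℕ → Circle → ℝ := fun m s => poisson v ((r m : ℂ) * s)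
  set X : ℕ → Circle → ℝ := fun m s => ψ ((r m : ℂ) * s, F ((r m : ℂ) * s))
  have hVX : ∀ m s, X m s ≤ V m s := fun m s =>
    hle _ (real_mul_mem_disc (hrI m) (Circle.norm_coe s).le)
  have hVc : ∀ m, Continuous (V m) := fun m => continuous_poisson_dilate hv (hrI m)
  have hFc : ∀ m, Continuous fun s : Circle => F ((r m : ℂ) * s) := fun m =>
    hF.continuousOn.comp_continuous (by fun_prop)
      fun s => real_mul_mem_disc (hrI m) (Circle.norm_coe s).le
  have hXm : ∀ m, Measurable (X m) := fun m =>
    (upperSemicontinuous_curve hψ.1 (hrI m) (hFc m)).measurable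
  -- The deficit of `ψ` below its Poisson majorant, cut off at height `m`: integrability of `X` is
  -- not known, whereas `V - Y` is integrable and still bounds `X` from above.
  set Y : ℕ → Circle → ℝ := fun m s => min (V m s - X m s) m
  have hY0 : ∀ m s, 0 ≤ Y m s := fun m s => le_min (sub_nonneg.2 (hVX m s)) (Nat.cast_nonneg m)
  have hYm : ∀ m, Measurable (Y m) := fun m =>
    ((hVc m).measurable.sub (hXm m)).min measurable_const
  have hYi : ∀ m, Integrable (Y m) arc := fun m =>
    Integrable.of_bound (hYm m).aestronglyMeasurable m (Eventually.of_forall fun s => by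
      rw [Real.norm_of_nonneg (hY0 m s)]; exact min_le_right _ _)
  have hmain : ∀ m, poisson (Y m) (t / r m) ≤ poisson v t - ψ (t, F t) := by
    intro m
    have hVi := integrable_of_continuous (hVc m)
    have h1 := psh_curve_le_poisson hψ (hrI m) (W := fun z => F ((r m : ℂ) * z)) (R := 1 / r m)
      (by rw [lt_div_iff₀ (hr m).1, one_mul]; exact (hr m).2) ?_ (hVi.sub (hYi m))
      (Eventually.of_forall fun s => ?_) (hrt m)
    · rw [hrτ] at h1
      have h2 : poisson (V m - Y m) (t / r m) = poisson (V m) (t / r m) - poisson (Y m) (t / r m) :=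
        poisson_sub hVi (hYi m) (hrt m)
      have h3 := poisson_dilate hv (hrI m) (hrt m)
      rw [hrτ] at h3
      rw [h2] at h1
      simp only [V] at h1
      linarith
    · refine hF.comp (by fun_prop) fun z hz => ?_
      rw [mem_ball_zero_iff, lt_div_iff₀ (hr m).1] at hz
      rw [mem_disc, norm_mul, Complex.norm_real, Real.norm_of_nonneg (hr m).1.le]
      linarith
    · have : Y m s ≤ V m s - X m s := min_le_left _ _
      simp only [Pi.sub_apply, X] at this ⊢
      linarith
  -- Fatou's lemma
  have hpt : ∀ᵐ s ∂arc, ENNReal.ofReal (kernel t s * (v s - k s)) ≤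
      liminf (fun m => ENNReal.ofReal (kernel (t / r m) s * Y m s)) atTop := by
    filter_upwards [hψφ, hFβ, ae_tendsto_poisson hv, hφk] with s h1 h2 h3 h4
    have hV : Tendsto (fun m => V m s) atTop (𝓝 (v s)) := h3.comp hr1
    have hK : Tendsto (fun m => kernel (t / r m) s) atTop (𝓝 (kernel t s)) :=
      (continuousAt_kernel ht s).tendsto.comp hτ
    have hX : ∀ ε > 0, ∀ᶠ m in atTop, X m s < k s + ε := by
      intro ε hε
      have h5 : limsup (fun x : ℝ × Cn n => (ψ ((x.1 : ℂ) * (s : ℂ), x.2) : EReal))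
          (𝓝[Set.Ioo 0 1] (1 : ℝ) ×ˢ 𝓝 (β s)) < ((k s + ε : ℝ) : EReal) :=
        ((h1 (β s)).trans h4).trans_lt (EReal.coe_lt_coe_iff.2 (by linarith))
      have h6 := BoundaryLE.eventually_lt h5
      have h7 := (hr1.prodMk (h2.comp hr1)).eventually h6
      filter_upwards [h7] with m hm
      exact EReal.coe_lt_coe_iff.1 hm
    have hlow : ∀ ε > 0, ENNReal.ofReal (kernel t s * (v s - k s - ε)) ≤
        liminf (fun m => ENNReal.ofReal (kernel (t / r m) s * Y m s)) atTop := by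
      intro ε hε
      have h5 : Tendsto (fun m => ENNReal.ofReal (kernel (t / r m) s * (v s - k s - ε))) atTop
          (𝓝 (ENNReal.ofReal (kernel t s * (v s - k s - ε)))) :=
        (ENNReal.continuous_ofReal.tendsto _).comp (hK.mul_const _)
      rw [← h5.liminf_eq]
      refine liminf_le_liminf ?_
      filter_upwards [hX (ε / 2) (half_pos hε),
        hV.eventually (lt_mem_nhds (show v s - ε / 2 < v s by linarith)),
        (tendsto_natCast_atTop_atTop (R := ℝ)).eventually_ge_atTop (v s - k s)] with m h6 h7 h8
      refine ENNReal.ofReal_le_ofReal (mul_le_mul_of_nonneg_left ?_ (kernel_pos (hrt m) s).le)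
      exact le_min (by linarith) (by linarith)
    have h9 : Tendsto (fun ε : ℝ => ENNReal.ofReal (kernel t s * (v s - k s - ε))) (𝓝[>] 0)
        (𝓝 (ENNReal.ofReal (kernel t s * (v s - k s)))) := by
      have hc : Continuous fun ε : ℝ => ENNReal.ofReal (kernel t s * (v s - k s - ε)) :=
        ENNReal.continuous_ofReal.comp (by fun_prop)
      have := (hc.tendsto 0).mono_left (nhdsWithin_le_nhds (s := Set.Ioi 0))
      simpa using this
    exact le_of_tendsto h9 (eventually_nhdsWithin_of_forall fun ε hε => hlow ε hε)
  have hc0 : 0 ≤ poisson v t - ψ (t, F t) := sub_nonneg.2 (hle t ht)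
  have hlint : ∫⁻ s, ENNReal.ofReal (kernel t s * (v s - k s)) ∂arc
      ≤ ENNReal.ofReal (poisson v t - ψ (t, F t)) := by
    refine (lintegral_mono_ae hpt).trans ((lintegral_liminf_le fun m =>
      (((continuous_kernel (hrt m)).measurable.mul (hYm m)).ennreal_ofReal :
        Measurable fun s => ENNReal.ofReal (kernel (t / r m) s * Y m s))).trans ?_)
    refine liminf_le_of_le (by isBoundedDefault) fun b hb => ?_
    obtain ⟨m, hm⟩ := hb.exists
    refine hm.trans ?_
    have h1 := ofReal_integral_eq_lintegral_ofReal (integrable_kernel_smul (hYi m) (hrt m))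
      (Eventually.of_forall fun s => mul_nonneg (kernel_pos (hrt m) s).le (hY0 m s))
    simp only [smul_eq_mul] at h1
    refine h1.symm.le.trans ?_
    exact ENNReal.ofReal_le_ofReal (hmain m)
  have hvk := integrable_kernel_smul (hv.sub hk) ht
  -- Fatou's lemma has controlled the positive part of `v - k`, which is enough for an upper bound
  -- of the integral.
  have h1 : poisson (fun s => v s - k s) t ≤ poisson v t - ψ (t, F t) := by
    have h2 := integral_eq_lintegral_pos_part_sub_lintegral_neg_part hvk
    have h3 : poisson (fun s => v s - k s) t ≤
        (∫⁻ s, ENNReal.ofReal (kernel t s • (v - k) s) ∂arc).toReal := by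
      rw [poisson]
      refine h2.le.trans ?_
      linarith [ENNReal.toReal_nonneg (a := ∫⁻ s, ENNReal.ofReal (-(kernel t s • (v - k) s)) ∂arc)]
    refine h3.trans (ENNReal.toReal_le_of_le_ofReal hc0 hlint)
  rw [poisson_sub hv hk ht] at h1
  linarith

end

/-! ### `hullHat ≤ hullCheck` for finite `p` -/

section


variable {n : ℕ}

lemma IsHardy.integrable {p : ℝ≥0∞} (hp : 1 ≤ p) {f : ℂ → Cn n} {b : Circle → Cn n}
    (hf : IsHardy p f b) : Integrable b arc :=
  hf.memLp.integrable hp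

lemma IsHardy.ae_tendsto {p : ℝ≥0∞} (hp : 1 ≤ p) {f : ℂ → Cn n} {b : Circle → Cn n}
    (hf : IsHardy p f b) : ∀ᵐ s : Circle ∂arc, Tendsto (fun r : ℝ => f ((r : ℂ) * s))
      (𝓝[Set.Ioo 0 1] (1 : ℝ)) (𝓝 (b s)) := by
  filter_upwards [ae_tendsto_poisson (hf.integrable hp)] with s hs
  refine hs.congr' (eventually_nhdsWithin_of_forall fun r hr => ?_)
  exact (hf.eq_poisson _ (real_mul_mem_disc ⟨hr.1.le, hr.2⟩ (Circle.norm_coe s).le)).symm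

lemma aemeasurable_comp_boundary {φ : Circle → Cn n → EReal}
    (hmeas : Measurable (fun x : Circle × Cn n => φ x.1 x.2)) {b : Circle → Cn n}
    (hb : AEStronglyMeasurable b arc) : AEMeasurable (fun s => φ s (b s)) arc :=
  hmeas.comp_aemeasurable (aemeasurable_id.prodMk hb.aemeasurable)

/-- The Poisson majorant needed by `psh_curve_le_poisson_boundary` is that of `C‖b‖^p + A`: the
bound `ψ ≤ μ` gives `C‖f‖^p + A` inside the disc, and Jensen's inequality compares the two. -/
theorem psh_le_poissonExt_of_rpow_growth {p : ℝ≥0∞} (hp : 1 ≤ p) (hp' : p ≠ ∞)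
    {φ : Circle → Cn n → EReal}
    (hmeas : Measurable (fun x : Circle × Cn n => φ x.1 x.2)) {C A : ℝ} (hC : 0 < C)
    (hlow : ∀ s w, ((-A : ℝ) : EReal) ≤ φ s w)
    (hup : ∀ s w, φ s w ≤ ((C * ‖w‖ ^ p.toReal + A : ℝ) : EReal))
    {ψ : ℂ × Cn n → ℝ} (hψ : IsPSH (cylinder n) ψ)
    (hμ : ∀ y ∈ cylinder n, (ψ y : EReal) ≤ fiberSup φ y.2) (hψφ : BoundaryLE ψ φ)
    {f : ℂ → Cn n} {b : Circle → Cn n} (hf : IsHardy p f b) {t : ℂ} (ht : t ∈ disc) :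
    (ψ (t, f t) : EReal) ≤ poissonExt (fun s => φ s (b s)) t := by
  by_cases htop : poissonExt (fun s => φ s (b s)) t = ⊤
  · rw [htop]; exact le_top
  obtain ⟨k, hk, hφk⟩ := exists_integrable_of_poissonExt_ne_top
    (aemeasurable_comp_boundary hmeas hf.memLp.1) (fun s => hlow s (b s)) ht htop
  rw [poissonExt_eq hk hφk ht, EReal.coe_le_coe_iff]
  have hp1 : 1 ≤ p.toReal := by simpa using ENNReal.toReal_mono hp' hp
  have hbp : Integrable (fun s => ‖b s‖ ^ p.toReal) arc :=
    hf.memLp.integrable_norm_rpow (by positivity) hp'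
  have hv : Integrable (fun s => C * ‖b s‖ ^ p.toReal + A) arc :=
    (hbp.const_mul C).add (integrable_const A)
  refine psh_curve_le_poisson_boundary hψ hψφ hf.holo (hf.ae_tendsto hp) hv (fun τ hτ => ?_) hk
    (hφk.mono fun s hs => hs.le) ht
  have h1 : (ψ (τ, f τ) : EReal) ≤ ((C * ‖f τ‖ ^ p.toReal + A : ℝ) : EReal) :=
    (hμ (τ, f τ) ⟨hτ, Set.mem_univ _⟩).trans (iSup_le fun s => hup s _)
  rw [EReal.coe_le_coe_iff] at h1
  have h2 := norm_poisson_rpow_le hp1 (hf.integrable hp) hbp hτ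
  rw [← hf.eq_poisson τ hτ] at h2
  rw [poisson_add (hbp.const_mul C) (integrable_const A) hτ, poisson_const_mul,
    poisson_const_real A hτ]
  nlinarith

end

section


variable {n : ℕ}

/-! ### Holomorphic functions that are small on small sets -/

lemma kernel_le_of_norm_le {a : ℝ} (ha : a < 1) {t : ℂ} (ht : ‖t‖ ≤ a) (s : Circle) :
    kernel t s ≤ 2 / (1 - a) := by
  have hd : t ∈ disc := mem_disc.2 (ht.trans_lt ha)
  refine (kernel_le hd s).trans ?_
  have := norm_nonneg t
  rw [div_le_div_iff₀ (by linarith) (by linarith)]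
  nlinarith

lemma re_polynomial_nonneg {P : Polynomial ℂ} (hP : ∀ s : Circle, 0 ≤ (P.eval (s : ℂ)).re) {τ : ℂ}
    (hτ : ‖τ‖ ≤ 1) : 0 ≤ (P.eval τ).re := by
  rcases hτ.lt_or_eq with h | h
  · rw [← poisson_re_polynomial P (mem_disc.2 h)]
    exact integral_nonneg fun s => mul_nonneg (kernel_pos (mem_disc.2 h) s).le (hP s)
  · exact hP ⟨τ, mem_sphere_zero_iff_norm.2 h⟩

/-- A Urysohn function `g` of the closed set `B` inside a slightly larger open set has `P[g](τ) ≤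
h/2`, because the kernel is at most `2 / (1 - a)`. A polynomial whose real part is within `h/4` of
`g` is shifted by `h/4`, which restores positivity, and by an imaginary constant, which makes its
value at `τ` real. -/
lemma exists_polynomial_barrier {B : Set Circle} (hB : IsClosed B) {a h : ℝ} (ha : a < 1)
    (hlt : arc B < ENNReal.ofReal (h * (1 - a) / 4)) {τ : ℂ} (hτ : ‖τ‖ ≤ a) :
    ∃ H : Polynomial ℂ, (∀ z : ℂ, ‖z‖ ≤ 1 → 0 ≤ (H.eval z).re) ∧
      (∀ s ∈ B, 1 ≤ (H.eval (s : ℂ)).re) ∧ (H.eval τ).im = 0 ∧ (H.eval τ).re ≤ h := by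
  have hτd : τ ∈ disc := mem_disc.2 (hτ.trans_lt ha)
  have h0 : 0 < h := by
    by_contra hcon
    rw [ENNReal.ofReal_of_nonpos (by nlinarith)] at hlt
    exact not_lt_bot hlt
  obtain ⟨O, hBO, hO, hOm⟩ := Set.exists_isOpen_lt_of_lt B _ hlt
  obtain ⟨g, hg0, hg1, hg⟩ := exists_continuous_zero_one_of_isClosed hO.isClosed_compl hB
    (Set.disjoint_left.2 fun s hs hsB => hs (hBO hsB))
  obtain ⟨P, hP⟩ := exists_polynomial_re_near g (η := h / 4) (by linarith)
  have hgi := integrable_of_continuous (E := ℝ) g.continuous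
  have hpoi : poisson g τ ≤ h / 2 := by
    have h1 : ∀ s, kernel τ s • g s ≤ O.indicator (fun _ => 2 / (1 - a)) s := by
      intro s
      by_cases hs : s ∈ O
      · rw [Set.indicator_of_mem hs, smul_eq_mul]
        have := kernel_le_of_norm_le ha hτ s
        have := kernel_pos hτd s
        nlinarith [(hg s).1, (hg s).2]
      · rw [Set.indicator_of_notMem hs, hg0 hs]; simp
    refine (integral_mono (integrable_kernel_smul hgi hτd)
      ((integrable_const _).indicator hO.measurableSet) h1).trans ?_
    rw [integral_indicator hO.measurableSet, setIntegral_const, smul_eq_mul]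
    have h2 : arc.real O ≤ h * (1 - a) / 4 := by
      refine ENNReal.toReal_le_of_le_ofReal ?_ hOm.le
      have : 0 < 1 - a := by linarith
      positivity
    have h3 : 0 < 2 / (1 - a) := div_pos two_pos (by linarith)
    refine (mul_le_mul_of_nonneg_right h2 h3.le).trans (le_of_eq ?_)
    have : 1 - a ≠ 0 := by linarith
    field_simp
    norm_num
  set c : ℂ := (h / 4 : ℝ) - Complex.I * (P.eval τ).im
  have hev : ∀ z : ℂ, ((P + Polynomial.C c).eval z).re = (P.eval z).re + h / 4 := by
    intro z; simp [c]
  refine ⟨P + Polynomial.C c, fun z hz => re_polynomial_nonneg (fun s => ?_) hz, fun s hs => ?_,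
    ?_, ?_⟩
  · rw [hev]; linarith [(abs_lt.1 (hP s)).1, (hg s).1]
  · rw [hev]
    have h1 := (abs_lt.1 (hP s)).1
    rw [hg1 hs] at h1
    simp only [Pi.one_apply] at h1
    linarith
  · simp [c]
  · rw [hev]
    have hPi : Integrable (fun s : Circle => (P.eval (s : ℂ)).re) arc :=
      integrable_of_continuous
        (Complex.continuous_re.comp (P.continuous.comp continuous_subtype_val))
    have h1 := poisson_mono hPi (hgi.add (integrable_const (h / 4)))
      (Eventually.of_forall fun s => show _ ≤ g s + h / 4 by linarith [(abs_lt.1 (hP s)).2]) hτd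
    rw [poisson_re_polynomial P hτd] at h1
    have h2 : poisson (⇑g + fun _ => h / 4) τ = poisson g τ + h / 4 := by
      have h3 := poisson_add hgi (integrable_const (h / 4)) hτd
      rw [poisson_const_real (h / 4) hτd] at h3
      exact h3
    rw [h2] at h1
    linarith

/-- The function is a small negative power of `G = 1 + N H`, normalized at `τ`, with `H` from
`exists_polynomial_barrier`. On `B` the modulus of `G` is so large that even the power `-κ` is below
`θ`. As `Re G ≥ 1`, the argument of `G` is bounded, so a power with small exponent stays near the
segment `[0, 1]`. The threshold `m` depends on `η`, `θ`, `a` only. -/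
lemma exists_damping {η θ a : ℝ} (hη : 0 < η) (hθ : 0 < θ) (ha : a < 1) :
    ∃ m : ℝ≥0∞, 0 < m ∧ ∀ B : Set Circle, IsClosed B → arc B < m → ∀ τ : ℂ, ‖τ‖ ≤ a →
      ∃ (q : ℂ → ℂ) (R : ℝ), 1 < R ∧ DifferentiableOn ℂ q (Metric.ball 0 R) ∧ q τ = 1 ∧
        (∀ s ∈ B, ‖q (s : ℂ)‖ ≤ θ) ∧
          ∀ s : Circle, ∃ σ ∈ Set.Icc (0 : ℝ) 1, ‖q (s : ℂ) - σ‖ ≤ η := by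
  -- The exponent deviates from a real one by at most `3κ`: `3κ ≤ 1` allows `‖exp z - 1‖ ≤ 2‖z‖`,
  -- and then `6κ ≤ η`.
  set κ := min (1 / 3) (η / 6)
  have hκ : 0 < κ := lt_min (by norm_num) (by positivity)
  have hκ3 : κ ≤ 1 / 3 := min_le_left _ _
  have hκη : κ ≤ η / 6 := min_le_right _ _
  set N := Real.exp ((1 + |Real.log θ|) / κ)
  have hN : 0 < N := Real.exp_pos _
  -- The barrier is used with `h = 1 / N`, so that `G τ ≤ 2` and the normalizing constant `a₀ = log
  -- (G τ)` lies in `[0, 1]`.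
  refine ⟨ENNReal.ofReal (1 / N * (1 - a) / 4), ENNReal.ofReal_pos.2 ?_,
    fun B hB hBm τ hτ => ?_⟩
  · have : 0 < 1 - a := by linarith
    positivity
  obtain ⟨H, hH0, hH1, hHi, hHr⟩ := exists_polynomial_barrier hB ha hBm hτ
  set G : ℂ → ℂ := fun z => 1 + N * H.eval z
  have hGd : Differentiable ℂ G := by
    have := H.differentiable
    fun_prop
  have hGre : ∀ z, (G z).re = 1 + N * (H.eval z).re := fun z => by simp [G]
  -- Positivity of `Re G` on the closed disc persists on a larger disc, where the principal
  -- logarithm is then holomorphic.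
  obtain ⟨δ, hδ, hδG⟩ := (isCompact_closedBall (0 : ℂ) 1).exists_thickening_subset_open
    (isOpen_lt continuous_const (Complex.continuous_re.comp hGd.continuous) :
      IsOpen {z | 0 < (G z).re}) (fun z hz => by
        rw [mem_closedBall_zero_iff] at hz
        have := hH0 z hz
        change 0 < (G z).re
        rw [hGre]; positivity)
  rw [thickening_closedBall hδ zero_le_one] at hδG
  set a₀ := (Complex.log (G τ)).re
  have hGτ : G τ = ((1 + N * (H.eval τ).re : ℝ) : ℂ) := by
    apply Complex.ext
    · rw [hGre]; simp
    · simp [G, hHi]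
  have hτ0 : 0 ≤ (H.eval τ).re := hH0 τ (hτ.trans ha.le)
  have hlogτ : Complex.log (G τ) = (a₀ : ℂ) := by
    apply Complex.ext
    · simp [a₀]
    · rw [hGτ, ← Complex.ofReal_log (by positivity)]; simp
  have ha₀ : a₀ = Real.log (1 + N * (H.eval τ).re) := by
    simp only [a₀]
    rw [hGτ, ← Complex.ofReal_log (by positivity), Complex.ofReal_re]
  have ha₀0 : 0 ≤ a₀ := by
    rw [ha₀]; exact Real.log_nonneg (by nlinarith)
  have ha₀1 : a₀ ≤ 1 := by
    rw [ha₀]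
    refine (Real.log_le_sub_one_of_pos (by positivity)).trans ?_
    have := mul_le_mul_of_nonneg_left hHr hN.le
    rw [mul_one_div_cancel hN.ne'] at this
    linarith
  refine ⟨fun z => Complex.exp (-κ * Complex.log (G z) + κ * a₀), 1 + δ, by linarith, ?_, ?_, ?_, ?_⟩
  · intro z hz
    have hs : G z ∈ Complex.slitPlane := Or.inl (hδG (by simpa [add_comm] using hz))
    have h1 : DifferentiableAt ℂ (fun z => Complex.log (G z)) z := hGd.differentiableAt.clog hs
    exact (((h1.const_mul _).add_const _).cexp).differentiableWithinAt
  · simp [hlogτ]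
  · intro s hs
    rw [Complex.norm_exp]
    have h1 : (-κ * Complex.log (G s) + κ * a₀ : ℂ).re = -κ * Real.log ‖G s‖ + κ * a₀ := by
      simp [Complex.log_re]
    rw [h1]
    have h2 : N ≤ ‖G s‖ := by
      refine le_trans ?_ (Complex.re_le_norm _)
      rw [hGre]; nlinarith [hH1 s hs]
    have h3 : (1 + |Real.log θ|) / κ ≤ Real.log ‖G s‖ := by
      rw [Real.le_log_iff_exp_le (hN.trans_le h2)]; exact h2
    rw [div_le_iff₀ hκ] at h3
    rw [← Real.le_log_iff_exp_le hθ]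
    nlinarith [neg_abs_le (Real.log θ)]
  · intro s
    set L := Complex.log (G s)
    have hs1 : ‖(s : ℂ)‖ ≤ 1 := (Circle.norm_coe s).le
    have hGs : 1 ≤ (G s).re := by rw [hGre]; nlinarith [hH0 s hs1]
    have hLre : 0 ≤ L.re := by
      simp only [L, Complex.log_re]
      exact Real.log_nonneg (hGs.trans (Complex.re_le_norm _))
    have hLim : |L.im| ≤ 2 := by
      simp only [L, Complex.log_im]
      have := Complex.abs_arg_le_pi_div_two_iff.2 (zero_le_one.trans hGs)
      linarith [Real.pi_le_four]
    refine ⟨Real.exp (-κ * L.re), ⟨(Real.exp_pos _).le, Real.exp_le_one_iff.2 (by nlinarith)⟩, ?_⟩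
    set z : ℂ := κ * a₀ - κ * L.im * Complex.I
    have hz : ‖z‖ ≤ 3 * κ := by
      refine (norm_sub_le _ _).trans ?_
      rw [norm_mul, norm_mul, norm_mul, Complex.norm_I, Complex.norm_real, Complex.norm_real,
        Complex.norm_real, Real.norm_of_nonneg hκ.le, Real.norm_of_nonneg ha₀0, Real.norm_eq_abs]
      nlinarith
    have heq : Complex.exp (-κ * L + κ * a₀) - (Real.exp (-κ * L.re) : ℝ)
        = (Real.exp (-κ * L.re) : ℝ) * (Complex.exp z - 1) := by
      rw [mul_sub, mul_one, Complex.ofReal_exp, ← Complex.exp_add]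
      congr 2
      conv_lhs => rw [← Complex.re_add_im L]
      simp only [z]; push_cast; ring
    rw [heq, norm_mul, Complex.norm_real, Real.norm_of_nonneg (Real.exp_pos _).le]
    have h1 : Real.exp (-κ * L.re) ≤ 1 := Real.exp_le_one_iff.2 (by nlinarith)
    have h2 := Complex.norm_exp_sub_one_le (x := z) (by linarith)
    have h3 := norm_nonneg (Complex.exp z - 1)
    nlinarith

end

/-! ### Plurisubharmonic functions along damped curves -/

section


variable {n : ℕ}

/-- A tube lemma: finitely many product neighbourhoods cover the compact set. -/
lemma eventually_forall_of_isCompact {X Y : Type*} [TopologicalSpace Y] {l : Filter X} {K : Set Y}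
    (hK : IsCompact K) {P : X → Y → Prop} (hP : ∀ y ∈ K, ∀ᶠ z : X × Y in l ×ˢ 𝓝 y, P z.1 z.2) :
    ∀ᶠ x in l, ∀ y ∈ K, P x y := by
  refine hK.induction_on (p := fun s => ∀ᶠ x in l, ∀ y ∈ s, P x y) (by simp)
    (fun s t hst h => h.mono fun x hx y hy => hx y (hst hy)) (fun s t hs ht => ?_) fun y hy => ?_
  · filter_upwards [hs, ht] with x h1 h2 y hy
    exact hy.elim (h1 y) (h2 y)
  · obtain ⟨pa, ha, pb, hb, h⟩ := eventually_prod_iff.1 (hP y hy)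
    exact ⟨{y | pb y}, mem_nhdsWithin_of_mem_nhds hb, ha.mono fun x hx y hy => h hx hy⟩

/-- On the circle of radius `r m` the boundary estimate, for all multipliers in the compact set `S`
at once, fails only on a set `B m` whose measure tends to 0. Multiplying the curve by the function
`q` of `exists_damping` pushes it into the ball of radius `δ` over `B m`, where `ψ ≤ A ≤ v`.
Elsewhere the multiplier `ξ q(s)` is within `η` of `ξ [0, 1]`, hence in `S`. As `q = 1` at `t / r
m`, the value at the point of interest is unchanged. -/
theorem psh_dilate_le_poisson {ψ : ℂ × Cn n → ℝ} (hψ : IsPSH (cylinder n) ψ) {δ A : ℝ} (hδ : 0 < δ)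
    (hψA : ∀ t ∈ disc, ∀ w, ‖w‖ ≤ δ → ψ (t, w) ≤ A) {f : ℂ → Cn n}
    (hf : DifferentiableOn ℂ f disc) {M : ℝ} (hM : ∀ t ∈ disc, ‖f t‖ ≤ M) {b : Circle → Cn n}
    (hfb : ∀ᵐ s : Circle ∂arc, Tendsto (fun r : ℝ => f ((r : ℂ) * s))
      (𝓝[Set.Ioo 0 1] (1 : ℝ)) (𝓝 (b s)))
    {v : Circle → ℝ} (hv : Integrable v arc) (hvA : ∀ s, A ≤ v s) {S : Set ℂ} (hS : IsCompact S)
    (hlim : ∀ᵐ s : Circle ∂arc, ∀ ζ ∈ S,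
      limsup (fun x : ℝ × Cn n => (ψ ((x.1 : ℂ) * (s : ℂ), x.2) : EReal))
        (𝓝[Set.Ioo 0 1] (1 : ℝ) ×ˢ 𝓝 (ζ • b s)) ≤ v s)
    {ξ : ℂ} {η : ℝ} (hη : 0 < η) (hξ : ∀ σ ∈ Set.Icc (0 : ℝ) 1, ∀ ζ : ℂ, ‖ζ - ξ * σ‖ ≤ η → ζ ∈ S)
    {t : ℂ} (ht : t ∈ disc) : ψ (t, ξ • f t) ≤ poisson v t := by
  refine le_of_forall_pos_le_add fun ε hε => ?_
  obtain ⟨g, hvg, hg, hgi, hgt, hgε⟩ := exists_lsc_gt_poisson_le hv ht hε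
  refine le_trans ?_ hgε
  obtain ⟨r, hr, hr1, hrt⟩ := exists_radii t ht
  have hrI : ∀ m, r m ∈ Set.Ico (0 : ℝ) 1 := fun m => ⟨(hr m).1.le, (hr m).2⟩
  have hτ := tendsto_div_radii (t := t) hr1
  have hrτ : ∀ m, (r m : ℂ) * (t / r m) = t := fun m =>
    mul_div_cancel₀ _ (by exact_mod_cast (hr m).1.ne')
  have hM0 : 0 ≤ M := (norm_nonneg _).trans (hM t ht)
  have ht1 := mem_disc.1 ht
  -- The point `t / r m` varies with `m`; the threshold is uniform for `‖τ‖ ≤ (1 + ‖t‖) / 2`, which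
  -- eventually contains all of them.
  obtain ⟨m₀, hm₀, hdamp⟩ := exists_damping (η := η / (‖ξ‖ + 1)) (θ := δ / ((‖ξ‖ + 1) * (M + 1)))
    (a := (1 + ‖t‖) / 2) (by positivity) (by positivity) (by linarith)
  set B : ℕ → Set Circle := fun m =>
    {s | ∀ ζ ∈ S, (ψ ((r m : ℂ) * s, ζ • f ((r m : ℂ) * s)) : EReal) < g s}ᶜ
  have hfc : ∀ m, Continuous fun s : Circle => f ((r m : ℂ) * s) := fun m =>
    hf.continuousOn.comp_continuous (by fun_prop)
      fun s => real_mul_mem_disc (hrI m) (Circle.norm_coe s).le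
  have hBc : ∀ m, IsClosed (B m) := by
    intro m
    rw [isClosed_compl_iff, isOpen_iff_mem_nhds]
    intro s hs
    refine eventually_forall_of_isCompact hS fun ζ hζ => ?_
    rw [← nhds_prod_eq]
    obtain ⟨c, hc1, hc2⟩ := EReal.lt_iff_exists_real_btwn.1 (hs ζ hζ)
    have h1 : ∀ᶠ x : Circle × ℂ in 𝓝 (s, ζ), (c : EReal) < g x.1 :=
      (continuous_fst.tendsto (s, ζ)).eventually (hg s _ hc2)
    have hdm : ((r m : ℂ) * s, ζ • f ((r m : ℂ) * s)) ∈ cylinder n :=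
      ⟨real_mul_mem_disc (hrI m) (Circle.norm_coe s).le, Set.mem_univ _⟩
    have hopen : IsOpen (cylinder n) := isOpen_disc.prod isOpen_univ
    have h2 := hψ.1 _ hdm c (EReal.coe_lt_coe_iff.1 hc1)
    rw [hopen.nhdsWithin_eq hdm] at h2
    have hcont : Continuous fun x : Circle × ℂ =>
        ((r m : ℂ) * x.1, x.2 • f ((r m : ℂ) * x.1)) :=
      (continuous_const.mul (continuous_subtype_val.comp continuous_fst)).prodMk
        (continuous_snd.smul ((hfc m).comp continuous_fst))
    filter_upwards [h1, (hcont.tendsto (s, ζ)).eventually h2] with x hx1 hx2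
    exact (EReal.coe_lt_coe_iff.2 hx2).trans hx1
  have hB0 : Tendsto (fun m => arc (B m)) atTop (𝓝 0) := by
    have h := tendsto_measure_of_ae_tendsto_indicator_of_isFiniteMeasure (μ := arc) (L := atTop)
      (As := B) (A := ∅) MeasurableSet.empty (fun m => (hBc m).measurableSet) ?_
    · simpa using h
    filter_upwards [hfb, hlim] with s h1 h2
    simp only [Set.mem_empty_iff_false, iff_false, B, Set.notMem_compl_iff]
    refine hr1.eventually (p := fun r : ℝ => ∀ ζ ∈ S,
      (ψ ((r : ℂ) * s, ζ • f ((r : ℂ) * s)) : EReal) < g s) ?_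
    refine eventually_forall_of_isCompact hS fun ζ hζ => ?_
    have h3 := BoundaryLE.eventually_lt ((h2 ζ hζ).trans_lt (hvg s))
    have h4 : Tendsto (fun x : ℝ × ℂ => (x.1, x.2 • f ((x.1 : ℂ) * s)))
        (𝓝[Set.Ioo 0 1] (1 : ℝ) ×ˢ 𝓝 ζ) (𝓝[Set.Ioo 0 1] (1 : ℝ) ×ˢ 𝓝 (ζ • b s)) :=
      tendsto_fst.prodMk (tendsto_snd.smul (h1.comp tendsto_fst))
    exact h4.eventually h3
  have hfin : ∀ᶠ m in atTop,
      ψ (t, ξ • f t) ≤ poisson (fun s => (g s).toReal) (t / r m) := by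
    filter_upwards [hB0.eventually (gt_mem_nhds hm₀),
      hτ.norm.eventually (ge_mem_nhds (show ‖t‖ < (1 + ‖t‖) / 2 by linarith))] with m hm1 hm2
    obtain ⟨q, R, hR, hq, hqτ, hqB, hqσ⟩ := hdamp (B m) (hBc m) hm1 _ hm2
    have hball : Metric.ball (0 : ℂ) (min R (1 / r m)) ⊆ Metric.ball 0 R :=
      Metric.ball_subset_ball (min_le_left _ _)
    have h1 := psh_curve_le_poisson hψ (hrI m)
      (W := fun z => (ξ * q z) • f ((r m : ℂ) * z)) (R := min R (1 / r m))
      (lt_min hR (by rw [lt_div_iff₀ (hr m).1, one_mul]; exact (hr m).2)) ?_ hgi ?_ (hrt m)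
    · rwa [hrτ, hqτ, mul_one] at h1
    · refine ((hq.mono hball).const_mul ξ).smul (hf.comp (by fun_prop) fun z hz => ?_)
      rw [mem_ball_zero_iff, lt_min_iff, lt_div_iff₀ (hr m).1] at hz
      rw [mem_disc, norm_mul, Complex.norm_real, Real.norm_of_nonneg (hr m).1.le]
      linarith
    · filter_upwards [hgt] with s hs
      have hsd := real_mul_mem_disc (hrI m) (Circle.norm_coe s).le
      rw [← EReal.coe_le_coe_iff, hs]
      by_cases hsB : s ∈ B m
      · refine le_trans (EReal.coe_le_coe_iff.2 ((hψA _ hsd _ ?_).trans (hvA s))) (hvg s).le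
        rw [norm_smul, norm_mul]
        have h2 := hqB s hsB
        have h3 := hM _ hsd
        calc ‖ξ‖ * ‖q s‖ * ‖f ((r m : ℂ) * s)‖
            ≤ (‖ξ‖ + 1) * (δ / ((‖ξ‖ + 1) * (M + 1))) * (M + 1) := by
              gcongr <;> linarith
          _ = δ := by
              have : ‖ξ‖ + 1 ≠ 0 := by positivity
              have : M + 1 ≠ 0 := by positivity
              field_simp
      · obtain ⟨σ, hσ, hσq⟩ := hqσ s
        refine (Set.notMem_compl_iff.1 hsB _ (hξ σ hσ _ ?_)).le
        rw [← mul_sub, norm_mul]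
        calc ‖ξ‖ * ‖q s - σ‖ ≤ (‖ξ‖ + 1) * (η / (‖ξ‖ + 1)) := by
              gcongr; linarith
          _ = η := by
              have : ‖ξ‖ + 1 ≠ 0 := by positivity
              field_simp
  have hcont : Tendsto (fun m => poisson (fun s => (g s).toReal) (t / r m)) atTop
      (𝓝 (poisson (fun s => (g s).toReal) t)) :=
    ((continuousOn_poisson hgi).continuousAt (isOpen_disc.mem_nhds ht)).tendsto.comp hτ
  exact ge_of_tendsto hcont hfin

end

/-! ### `hullHat ≤ hullCheck` for `p = ∞` -/

section


variable {n : ℕ}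

lemma IsConvexFn.le_combo {g : Cn n → EReal} (hg : IsConvexFn g) {x y : Cn n} {a b : ℝ}
    (hx : g x ≤ a) (hy : g y ≤ b) {ρ : ℝ} (hρ : ρ ∈ Set.Icc (0 : ℝ) 1) :
    g (ρ • x + (1 - ρ) • y) ≤ ((ρ * a + (1 - ρ) * b : ℝ) : EReal) := by
  have hx' : x ∈ {w | g w < ⊤} := hx.trans_lt (EReal.coe_lt_top _)
  have hy' : y ∈ {w | g w < ⊤} := hy.trans_lt (EReal.coe_lt_top _)
  have hρ' : 0 ≤ 1 - ρ := by linarith [hρ.2]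
  have h1 := hg.2.1 hx' hy' hρ.1 hρ' (by ring)
  have h2 := hg.2.2 hx' hy' hρ.1 hρ' (by ring)
  rw [← EReal.coe_toReal h1.ne (hg.1 _), EReal.coe_le_coe_iff]
  refine h2.trans ?_
  rw [← EReal.coe_toReal hx'.ne (hg.1 _), EReal.coe_le_coe_iff] at hx
  rw [← EReal.coe_toReal hy'.ne (hg.1 _), EReal.coe_le_coe_iff] at hy
  simp only [smul_eq_mul]
  have := mul_le_mul_of_nonneg_left hx hρ.1
  have := mul_le_mul_of_nonneg_left hy hρ'
  linarith

/-- The union of the discs with centre `ρ` and radius `δ (1 - ρ)`, for `0 ≤ ρ ≤ 1`. -/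
def dropletSet (δ : ℝ) : Set ℂ :=
  (fun x : ℝ × ℂ => (x.1 : ℂ) + ((δ * (1 - x.1) : ℝ) : ℂ) * x.2) ''
    (Set.Icc 0 1 ×ˢ Metric.closedBall 0 1)

lemma isCompact_dropletSet (δ : ℝ) : IsCompact (dropletSet δ) :=
  (isCompact_Icc.prod (isCompact_closedBall 0 1)).image (by fun_prop)

lemma mem_dropletSet {δ ρ : ℝ} (hδ : 0 < δ) (hρ : ρ ∈ Set.Ico (0 : ℝ) 1) {ζ : ℂ}
    (hζ : ‖ζ - ρ‖ ≤ δ * (1 - ρ)) : ζ ∈ dropletSet δ := by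
  have h0 : 0 < δ * (1 - ρ) := mul_pos hδ (by linarith [hρ.2])
  refine ⟨(ρ, (ζ - ρ) / ((δ * (1 - ρ) : ℝ) : ℂ)), ⟨⟨hρ.1, hρ.2.le⟩, ?_⟩, ?_⟩
  · rw [mem_closedBall_zero_iff, norm_div, Complex.norm_real, Real.norm_of_nonneg h0.le,
      div_le_one h0]
    exact hζ
  · change (ρ : ℂ) + ((δ * (1 - ρ) : ℝ) : ℂ) * ((ζ - ρ) / ((δ * (1 - ρ) : ℝ) : ℂ)) = ζ
    rw [mul_div_cancel₀ _ (by exact_mod_cast h0.ne')]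
    ring

/-- The point is the convex combination, with weights `ρ` and `1 - ρ`, of `z` and of a multiple of
`z` in the ball of radius `δ₀`. -/
lemma IsConvexFn.le_of_mem_dropletSet {g : Cn n → EReal} (hg : IsConvexFn g) {δ₀ A k M : ℝ}
    (hδ₀ : 0 < δ₀) (hA : ∀ w, ‖w‖ ≤ δ₀ → g w ≤ A) {z : Cn n} (hz : ‖z‖ ≤ M) (hk : g z ≤ k)
    {ρ : ℝ} (hρ : ρ ∈ Set.Icc (0 : ℝ) 1) {u : ℂ} (hu : ‖u‖ ≤ 1) :
    g (((ρ : ℂ) + ((δ₀ / (M + 1) * (1 - ρ) : ℝ) : ℂ) * u) • z) ≤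
      ((ρ * k + (1 - ρ) * A : ℝ) : EReal) := by
  have hM : 0 ≤ M := (norm_nonneg z).trans hz
  have h1 : ((ρ : ℂ) + ((δ₀ / (M + 1) * (1 - ρ) : ℝ) : ℂ) * u) • z
      = ρ • z + (1 - ρ) • ((((δ₀ / (M + 1) : ℝ) : ℂ) * u) • z) := by
    ext j
    simp
    ring
  rw [h1]
  refine hg.le_combo hk (hA _ ?_) hρ
  rw [norm_smul, norm_mul, Complex.norm_real, Real.norm_of_nonneg (by positivity)]
  calc δ₀ / (M + 1) * ‖u‖ * ‖z‖ ≤ δ₀ / (M + 1) * 1 * (M + 1) := by gcongr; linarith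
    _ = δ₀ := by field_simp

/-- Here `ξ` lies in the open disc around `ρ`, so a whole neighbourhood of the segment `[0, ξ]`
consists of multipliers at which convexity bounds `φ_s`. This room is what the damping requires. -/
lemma psh_dilate_le {φ : Circle → Cn n → EReal} (hconv : ∀ s, IsConvexFn (φ s)) {δ₀ A : ℝ}
    (hδ₀ : 0 < δ₀) (hA : ∀ s w, ‖w‖ ≤ δ₀ → φ s w ≤ A)
    {ψ : ℂ × Cn n → ℝ} (hψ : IsPSH (cylinder n) ψ)
    (hψA : ∀ t ∈ disc, ∀ w, ‖w‖ ≤ δ₀ → ψ (t, w) ≤ A) (hψφ : BoundaryLE ψ φ)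
    {f : ℂ → Cn n} {b : Circle → Cn n} (hf : DifferentiableOn ℂ f disc)
    {M : ℝ} (hM : ∀ t ∈ disc, ‖f t‖ ≤ M) (hbM : ∀ᵐ s ∂arc, ‖b s‖ ≤ M)
    (hfb : ∀ᵐ s : Circle ∂arc, Tendsto (fun r : ℝ => f ((r : ℂ) * s))
      (𝓝[Set.Ioo 0 1] (1 : ℝ)) (𝓝 (b s)))
    {k : Circle → ℝ} (hk : Integrable k arc) (hφk : ∀ᵐ s ∂arc, φ s (b s) ≤ k s)
    {ρ : ℝ} (hρ : ρ ∈ Set.Ico (0 : ℝ) 1) {ξ : ℂ} (hξ : ‖ξ - ρ‖ < δ₀ / (M + 1) * (1 - ρ))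
    {t : ℂ} (ht : t ∈ disc) : ψ (t, ξ • f t) ≤ ρ * poisson k t + (1 - ρ) * A := by
  have hM0 : 0 ≤ M := (norm_nonneg _).trans (hM t ht)
  set δ := δ₀ / (M + 1)
  have hδ : 0 < δ := by positivity
  have hρI : ρ ∈ Set.Icc (0 : ℝ) 1 := ⟨hρ.1, hρ.2.le⟩
  have hv : Integrable (fun s => max (k s) A) arc := hk.sup (integrable_const A)
  -- A crude majorant first. The point `σ ξ` lies in the disc with centre `σ ρ` and radius `δ (1 - σ
  -- ρ)`, and `η` is the smaller of the margins at `σ = 1` and `σ = 0`.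
  have hdom : ∀ τ ∈ disc, ψ (τ, ξ • f τ) ≤ poisson (fun s => max (k s) A) τ := by
    intro τ hτ
    refine psh_dilate_le_poisson hψ hδ₀ hψA hf hM hfb hv (fun s => le_max_right _ _)
      (isCompact_dropletSet δ) ?_ (η := min (δ * (1 - ρ) - ‖ξ - ρ‖) δ)
      (lt_min (by linarith) hδ) (fun σ hσ ζ hζ => ?_) hτ
    · filter_upwards [hψφ, hbM, hφk] with s h1 h2 h3
      rintro _ ⟨⟨ρ', u⟩, ⟨hρ', hu⟩, rfl⟩
      refine (h1 _).trans (((hconv s).le_of_mem_dropletSet hδ₀ (hA s) h2 h3 hρ'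
        (mem_closedBall_zero_iff.1 hu)).trans (EReal.coe_le_coe_iff.2 ?_))
      have h4 := mul_le_mul_of_nonneg_left (le_max_left (k s) A) hρ'.1
      have h5 := mul_le_mul_of_nonneg_left (le_max_right (k s) A) (sub_nonneg.2 hρ'.2)
      simp only at h4 h5 ⊢
      linarith
    · refine mem_dropletSet (ρ := σ * ρ) hδ ⟨mul_nonneg hσ.1 hρ.1, ?_⟩ ?_
      · nlinarith [hσ.1, hσ.2, hρ.1, hρ.2]
      · have h1 : ζ - ((σ * ρ : ℝ) : ℂ) = (ζ - ξ * σ) + σ * (ξ - ρ) := by push_cast; ring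
        rw [h1]
        refine (norm_add_le _ _).trans ?_
        rw [norm_mul, Complex.norm_real, Real.norm_of_nonneg hσ.1]
        have h2 := hζ.trans (min_le_left _ _)
        have h3 := hζ.trans (min_le_right _ _)
        have h4 := mul_le_mul_of_nonneg_left h2 hσ.1
        have h5 := mul_le_mul_of_nonneg_left h3 (sub_nonneg.2 hσ.2)
        linarith
  have hk' : Integrable (fun s => ρ * k s + (1 - ρ) * A) arc :=
    (hk.const_mul ρ).add (integrable_const _)
  -- Once some Poisson majorant is known, the boundary values of `ξ f` give the sharp bound.
  have h := psh_curve_le_poisson_boundary hψ hψφ (F := fun τ => ξ • f τ) (β := fun s => ξ • b s)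
    (hf.const_smul ξ) (hfb.mono fun s hs => hs.const_smul ξ) hv hdom hk' ?_ ht
  · rwa [poisson_add (hk.const_mul ρ) (integrable_const _) ht, poisson_const_mul,
      poisson_const_real _ ht] at h
  · filter_upwards [hbM, hφk] with s h2 h3
    have h4 : 0 < δ * (1 - ρ) := mul_pos hδ (by linarith [hρ.2])
    have h5 := (hconv s).le_of_mem_dropletSet hδ₀ (hA s) h2 h3 hρI
      (u := (ξ - ρ) / ((δ * (1 - ρ) : ℝ) : ℂ)) (by
        rw [norm_div, Complex.norm_real, Real.norm_of_nonneg h4.le, div_le_one h4]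
        exact hξ.le)
    rw [mul_div_cancel₀ _ (by exact_mod_cast h4.ne')] at h5
    simpa using h5

/-- Upper semicontinuity alone does not bound `ψ(t, w)` by nearby values, so the sub-mean value
inequality is used on the circle `1 + η e^{iθ}`. For `e^{iθ}` near `-1` the multiplier lies in one
of the discs of the hypothesis; on the rest of the circle `ψ` is hardly larger than `ψ(t, w)`
itself. The good arc does not depend on `η`, so its fixed proportion forces the bound as `η → 0`. -/
lemma psh_le_of_dilate_le {ψ : ℂ × Cn n → ℝ} (hψ : IsPSH (cylinder n) ψ) {t : ℂ} (ht : t ∈ disc)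
    (w : Cn n) {δ P A : ℝ} (hδ : 0 < δ)
    (h : ∀ ρ ∈ Set.Ico (0 : ℝ) 1, ∀ ξ : ℂ, ‖ξ - ρ‖ < δ * (1 - ρ) →
      ψ (t, ξ • w) ≤ ρ * P + (1 - ρ) * A) : ψ (t, w) ≤ P := by
  set T : Set ℝ := {θ | ‖1 + circleMap 0 1 θ‖ < δ}
  have hT : IsOpen T := isOpen_lt (by fun_prop) continuous_const
  set ν := volume.restrict (Set.Ioc 0 (2 * Real.pi))
  set α := ν.real T
  have hα : 0 < α := by
    change 0 < (ν T).toReal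
    rw [ENNReal.toReal_pos_iff]
    refine ⟨?_, measure_lt_top _ _⟩
    refine lt_of_lt_of_le (b := volume (T ∩ Set.Ioo 0 (2 * Real.pi))) ?_ ?_
    · refine (hT.inter isOpen_Ioo).measure_pos _ ⟨Real.pi, ?_, Real.pi_pos, ?_⟩
      · change ‖1 + circleMap 0 1 Real.pi‖ < δ
        simpa [circleMap] using hδ
      · linarith [Real.pi_pos]
    · rw [Measure.restrict_apply hT.measurableSet]
      exact measure_mono (Set.inter_subset_inter_right _ Set.Ioo_subset_Ioc_self)
  have hν : ν.real Set.univ = 2 * Real.pi := by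
    rw [measureReal_def, Measure.restrict_apply_univ, Real.volume_Ioc, sub_zero,
      ENNReal.toReal_ofReal (by positivity)]
  have hopen : IsOpen (cylinder n) := isOpen_disc.prod isOpen_univ
  have htw : (t, w) ∈ cylinder n := ⟨ht, Set.mem_univ _⟩
  refine le_of_forall_pos_le_add fun ε hε => ?_
  -- The error from semicontinuity is spread over length `2π` but is paid for by the arc of length
  -- `α`.
  set ε₁ := ε / 2 * (α / (2 * Real.pi))
  have hε₁ : 0 < ε₁ := by positivity
  have husc := hψ.1 _ htw (ψ (t, w) + ε₁) (by linarith)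
  rw [hopen.nhdsWithin_eq htw] at husc
  obtain ⟨r, hr, hrw⟩ := Metric.eventually_nhds_iff.1
    (((Continuous.prodMk_right t).tendsto w).eventually husc)
  set η := min (1 / 2) (min (r / (2 * (‖w‖ + 1))) (ε / (2 * (|A - P| + 1))))
  have hη : 0 < η := by positivity
  have hη1 : η ≤ 1 / 2 := min_le_left _ _
  have hη2 : η * ‖w‖ < r := by
    have : η ≤ r / (2 * (‖w‖ + 1)) := (min_le_right _ _).trans (min_le_left _ _)
    rw [le_div_iff₀ (by positivity)] at this
    nlinarith [norm_nonneg w]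
  have hη3 : η * (A - P) ≤ ε / 2 := by
    have : η ≤ ε / (2 * (|A - P| + 1)) := (min_le_right _ _).trans (min_le_right _ _)
    rw [le_div_iff₀ (by positivity)] at this
    nlinarith [le_abs_self (A - P)]
  obtain ⟨hci, hle⟩ := hψ.2 (t, w) (0, (η : ℂ) • w) fun ζ _ => ⟨by simpa using ht, Set.mem_univ _⟩
  have hval : ∀ ζ : ℂ, ((t, w) : ℂ × Cn n) + ζ • ((0 : ℂ), (η : ℂ) • w)
      = (t, (1 + η * ζ) • w) := by
    intro ζ
    refine Prod.ext (by simp) ?_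
    change w + ζ • (η : ℂ) • w = (1 + η * ζ) • w
    rw [add_smul, one_smul, smul_smul, mul_comm]
  simp only [hval] at hci hle
  have hnorm : ∀ θ : ℝ, ‖circleMap 0 1 θ‖ = 1 := fun θ => by simp
  set D := (1 - η) * P + η * A
  have hbound : ∀ θ, ψ (t, (1 + η * circleMap 0 1 θ) • w)
      ≤ T.indicator (fun _ => D - (ψ (t, w) + ε₁)) θ + (ψ (t, w) + ε₁) := by
    intro θ
    by_cases hθ : θ ∈ T
    · rw [Set.indicator_of_mem hθ]
      have := h (1 - η) ⟨by linarith, by linarith⟩ (1 + η * circleMap 0 1 θ) (by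
        have h1 : (1 + η * circleMap 0 1 θ) - ((1 - η : ℝ) : ℂ) = η * (1 + circleMap 0 1 θ) := by
          push_cast; ring
        rw [h1, norm_mul, Complex.norm_real, Real.norm_of_nonneg hη.le]
        have : ‖1 + circleMap 0 1 θ‖ < δ := hθ
        nlinarith)
      simp only [D]
      linarith
    · rw [Set.indicator_of_notMem hθ, zero_add]
      refine (hrw ?_).le
      rw [dist_eq_norm, add_smul, one_smul, add_sub_cancel_left, norm_smul, norm_mul, hnorm,
        Complex.norm_real, Real.norm_of_nonneg hη.le, mul_one]
      exact hη2
  have hi : IntegrableOn (fun θ : ℝ => ψ (t, (1 + η * circleMap 0 1 θ) • w))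
      (Set.Ioc 0 (2 * Real.pi)) := by
    have := (intervalIntegrable_iff_integrableOn_Ioc_of_le (by positivity)).1 hci
    exact this
  have hind : Integrable (T.indicator fun _ : ℝ => D - (ψ (t, w) + ε₁)) ν :=
    (integrable_const _).indicator hT.measurableSet
  have heval : ∫ θ, (T.indicator (fun _ : ℝ => D - (ψ (t, w) + ε₁)) θ + (ψ (t, w) + ε₁)) ∂ν
      = α * (D - (ψ (t, w) + ε₁)) + 2 * Real.pi * (ψ (t, w) + ε₁) := by
    rw [integral_add hind (integrable_const _), integral_indicator hT.measurableSet,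
      setIntegral_const, integral_const, hν, smul_eq_mul, smul_eq_mul]
  have hmono := (integral_mono (μ := ν) hi (hind.add (integrable_const (ψ (t, w) + ε₁)))
    hbound).trans_eq heval
  have hpi := Real.pi_pos
  rw [Real.circleAverage, smul_eq_mul, inv_mul_eq_div, le_div_iff₀ (by positivity),
    intervalIntegral.integral_of_le (by positivity)] at hle
  have hfin : α * ψ (t, w) ≤ α * D + 2 * Real.pi * ε₁ := by nlinarith
  have h2 : 2 * Real.pi * ε₁ = α * (ε / 2) := by
    simp only [ε₁]; field_simp
  rw [h2, ← mul_add, mul_le_mul_iff_right₀ hα] at hfin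
  simp only [D] at hfin
  linarith

/-- Only `ψ ≤ A` on the small ball survives from `ψ ≤ μ`, so `f` itself has no evident Poisson
majorant; the multiples `ξ f` do, and `ξ = 1` is reached inside the fibre over `t`. -/
theorem psh_le_poissonExt_of_bounded_domain {φ : Circle → Cn n → EReal}
    (hmeas : Measurable (fun x : Circle × Cn n => φ x.1 x.2)) (hconv : ∀ s, IsConvexFn (φ s))
    {δ₀ A : ℝ} (hδ₀ : 0 < δ₀) (hlow : ∀ s w, ((-A : ℝ) : EReal) ≤ φ s w)
    (hA : ∀ s w, ‖w‖ ≤ δ₀ → φ s w ≤ A)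
    {ψ : ℂ × Cn n → ℝ} (hψ : IsPSH (cylinder n) ψ)
    (hμ : ∀ y ∈ cylinder n, (ψ y : EReal) ≤ fiberSup φ y.2) (hψφ : BoundaryLE ψ φ)
    {f : ℂ → Cn n} {b : Circle → Cn n} (hf : IsHardy ∞ f b) {t : ℂ} (ht : t ∈ disc) :
    (ψ (t, f t) : EReal) ≤ poissonExt (fun s => φ s (b s)) t := by
  by_cases htop : poissonExt (fun s => φ s (b s)) t = ⊤
  · rw [htop]; exact le_top
  obtain ⟨k, hk, hφk⟩ := exists_integrable_of_poissonExt_ne_top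
    (aemeasurable_comp_boundary hmeas hf.memLp.1) (fun s => hlow s (b s)) ht htop
  rw [poissonExt_eq hk hφk ht, EReal.coe_le_coe_iff]
  have hψA : ∀ τ ∈ disc, ∀ w, ‖w‖ ≤ δ₀ → ψ (τ, w) ≤ A := fun τ hτ w hw =>
    EReal.coe_le_coe_iff.1 ((hμ (τ, w) ⟨hτ, Set.mem_univ _⟩).trans (iSup_le fun s => hA s w hw))
  set M := (eLpNorm b ∞ arc).toReal
  have hbM : ∀ᵐ s ∂arc, ‖b s‖ ≤ M := by
    filter_upwards [enorm_ae_le_eLpNormEssSup b arc] with s hs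
    rw [← eLpNorm_exponent_top] at hs
    have := ENNReal.toReal_mono hf.memLp.2.ne hs
    simpa [M] using this
  have hfM : ∀ τ ∈ disc, ‖f τ‖ ≤ M := by
    intro τ hτ
    rw [hf.eq_poisson τ hτ, ← poisson_const_real M hτ]
    refine norm_integral_le_of_norm_le (integrable_kernel_smul (integrable_const M) hτ) ?_
    filter_upwards [hbM] with s hs
    rw [norm_smul, Real.norm_of_nonneg (kernel_pos hτ s).le, smul_eq_mul]
    exact mul_le_mul_of_nonneg_left hs (kernel_pos hτ s).le
  have hM0 : 0 ≤ M := ENNReal.toReal_nonneg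
  exact psh_le_of_dilate_le hψ ht (f t) (δ := δ₀ / (M + 1)) (A := A) (by positivity)
    fun ρ hρ ξ hξ => psh_dilate_le hconv hδ₀ hA hψ hψA hψφ hf.holo hfM hbM (hf.ae_tendsto le_top) hk
      (hφk.mono fun s hs => hs.le) hρ hξ ht

end

section


variable {n : ℕ}

/-! ### The bilinear product -/

lemma dot_add (z w w' : Cn n) : dot z (w + w') = dot z w + dot z w' := by
  simp [dot, mul_add, Finset.sum_add_distrib]

lemma add_dot (z z' w : Cn n) : dot (z + z') w = dot z w + dot z' w := by
  simp [dot, add_mul, Finset.sum_add_distrib]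

lemma dot_smul (c : ℂ) (z w : Cn n) : dot z (c • w) = c * dot z w := by
  simp only [dot, PiLp.smul_apply, smul_eq_mul, Finset.mul_sum]
  exact Finset.sum_congr rfl fun j _ => by ring

lemma smul_dot (c : ℂ) (z w : Cn n) : dot (c • z) w = c * dot z w := by
  simp only [dot, PiLp.smul_apply, smul_eq_mul, Finset.mul_sum, mul_assoc]

lemma real_smul_dot (c : ℝ) (z w : Cn n) : dot (c • z) w = c * dot z w := by
  simp only [dot, PiLp.smul_apply, Complex.real_smul, Finset.mul_sum, mul_assoc]

lemma dot_real_smul (c : ℝ) (z w : Cn n) : dot z (c • w) = c * dot z w := by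
  simp only [dot, PiLp.smul_apply, Complex.real_smul, Finset.mul_sum]
  exact Finset.sum_congr rfl fun j _ => by ring

lemma dot_sub (z w w' : Cn n) : dot z (w - w') = dot z w - dot z w' := by
  simp [dot, mul_sub, Finset.sum_sub_distrib]

lemma sub_dot (z z' w : Cn n) : dot (z - z') w = dot z w - dot z' w := by
  simp [dot, sub_mul, Finset.sum_sub_distrib]

@[simp] lemma dot_zero (z : Cn n) : dot z 0 = 0 := by simp [dot]

@[simp] lemma zero_dot (z : Cn n) : dot 0 z = 0 := by simp [dot]

lemma norm_dot_le (z w : Cn n) : ‖dot z w‖ ≤ ‖z‖ * ‖w‖ := by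
  calc ‖dot z w‖ ≤ ∑ j, ‖z j‖ * ‖w j‖ := by
        refine (norm_sum_le _ _).trans (le_of_eq ?_)
        simp
    _ ≤ √(∑ j, ‖z j‖ ^ 2) * √(∑ j, ‖w j‖ ^ 2) := Real.sum_mul_le_sqrt_mul_sqrt _ _ _
    _ = ‖z‖ * ‖w‖ := by rw [EuclideanSpace.norm_eq, EuclideanSpace.norm_eq]

lemma re_dot_le (z w : Cn n) : (dot z w).re ≤ ‖z‖ * ‖w‖ :=
  (Complex.re_le_norm _).trans (norm_dot_le z w)

lemma abs_re_dot_le (z w : Cn n) : |(dot z w).re| ≤ ‖z‖ * ‖w‖ :=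
  (Complex.abs_re_le_norm _).trans (norm_dot_le z w)

lemma continuous_dot : Continuous fun x : Cn n × Cn n => dot x.1 x.2 := by
  unfold dot
  fun_prop

lemma eq_sum_single (y : Cn n) :
    y = ∑ j, ((y j).re • EuclideanSpace.single j (1 : ℂ) +
      (y j).im • EuclideanSpace.single j Complex.I) := by
  ext i
  simp only [WithLp.ofLp_sum, Finset.sum_apply, PiLp.add_apply, PiLp.smul_apply,
    PiLp.single_apply, Complex.real_smul]
  rw [Finset.sum_eq_single i (fun j _ hj => by simp [hj.symm]) (by simp)]
  simp

lemma exists_linear_eq_re_dot (L : Cn n →ₗ[ℝ] ℝ) : ∃ ζ : Cn n, ∀ y, L y = (dot ζ y).re := by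
  refine ⟨WithLp.toLp 2 fun j => (L (EuclideanSpace.single j 1) : ℂ) -
    L (EuclideanSpace.single j Complex.I) * Complex.I, fun y => ?_⟩
  conv_lhs => rw [eq_sum_single y]
  simp only [map_sum, map_add, map_smul, dot, Complex.re_sum, smul_eq_mul]
  refine Finset.sum_congr rfl fun j _ => ?_
  simp
  ring

/-! ### Convex conjugates -/

/-- A convex lower semicontinuous function with explicit local bounds: it is at most `B` on the ball
of radius `ρ`, and it is coercive. -/
structure IsTame (ρ B : ℝ) (K : ℝ → ℝ) (g : Cn n → EReal) : Prop where
  convex : IsConvexFn g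
  lsc : LowerSemicontinuous g
  le_near : ∀ w, ‖w‖ ≤ ρ → g w ≤ B
  coercive : ∀ R w, ((R * ‖w‖ - K R : ℝ) : EReal) ≤ g w

/-- The convex conjugate with respect to the real part of the bilinear product; the supremum
is taken over a dense sequence. -/
noncomputable def conj (g : Cn n → EReal) (ζ : Cn n) : ℝ :=
  (⨆ i, (((dot ζ (TopologicalSpace.denseSeq (Cn n) i)).re : EReal) + -g (TopologicalSpace.denseSeq (Cn n) i))).toReal

variable {ρ B : ℝ} {K : ℝ → ℝ} {g : Cn n → EReal}

lemma coe_add_neg_le_iff {a c : ℝ} {x : EReal} (hx : x ≠ ⊥) :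
    (a : EReal) + -x ≤ c ↔ ((a - c : ℝ) : EReal) ≤ x := by
  induction x with
  | bot => exact absurd rfl hx
  | top => simp
  | coe x =>
    rw [← EReal.coe_neg, ← EReal.coe_add, EReal.coe_le_coe_iff, EReal.coe_le_coe_iff]
    constructor <;> intro <;> linarith

lemma exists_denseSeq_mem {U : Set (Cn n)} (hU : IsOpen U)
    (hne : U.Nonempty) : ∃ i, TopologicalSpace.denseSeq (Cn n) i ∈ U :=
  (TopologicalSpace.denseRange_denseSeq (Cn n)).exists_mem_open hU hne

lemma IsTame.conj_coe (hg : IsTame ρ B K g) (hρ : 0 < ρ) (ζ : Cn n) : ((conj g ζ : ℝ) : EReal) =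
    ⨆ i, (((dot ζ (TopologicalSpace.denseSeq (Cn n) i)).re : EReal) + -g (TopologicalSpace.denseSeq (Cn n) i)) := by
  refine EReal.coe_toReal (ne_top_of_le_ne_top (EReal.coe_ne_top (K ‖ζ‖)) ?_) ?_
  · refine iSup_le fun i => (coe_add_neg_le_iff (hg.convex.1 _)).2 ?_
    refine le_trans (EReal.coe_le_coe_iff.2 ?_) (hg.coercive ‖ζ‖ _)
    linarith [re_dot_le ζ (TopologicalSpace.denseSeq (Cn n) i)]
  · obtain ⟨i, hi⟩ := exists_denseSeq_mem (Metric.isOpen_ball (x := (0 : Cn n)) (ε := ρ))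
      ⟨0, Metric.mem_ball_self hρ⟩
    refine ne_bot_of_le_ne_bot ?_ (le_iSup _ i)
    have h1 : g (TopologicalSpace.denseSeq (Cn n) i) ≠ ⊤ :=
      ((hg.le_near _ (mem_ball_zero_iff.1 hi).le).trans_lt (EReal.coe_lt_top _)).ne
    rw [← EReal.coe_toReal h1 (hg.convex.1 _), ← EReal.coe_neg, ← EReal.coe_add]
    exact EReal.coe_ne_bot _

lemma IsTame.conj_le (hg : IsTame ρ B K g) (hρ : 0 < ρ) {ζ : Cn n} {c : ℝ}
    (h : ∀ z, (((dot ζ z).re - c : ℝ) : EReal) ≤ g z) : conj g ζ ≤ c := by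
  rw [← EReal.coe_le_coe_iff, hg.conj_coe hρ]
  exact iSup_le fun i => (coe_add_neg_le_iff (hg.convex.1 _)).2 (h _)

lemma IsTame.conj_le_of_norm_le (hg : IsTame ρ B K g) (hρ : 0 < ρ) {ζ : Cn n} {R : ℝ}
    (hR : ‖ζ‖ ≤ R) : conj g ζ ≤ K R := by
  refine hg.conj_le hρ fun z => le_trans (EReal.coe_le_coe_iff.2 ?_) (hg.coercive R z)
  have := mul_le_mul_of_nonneg_right hR (norm_nonneg z)
  linarith [re_dot_le ζ z]

/-- The Fenchel–Young inequality. -/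
lemma IsTame.young (hg : IsTame ρ B K g) (hρ : 0 < ρ) (ζ z : Cn n) :
    (((dot ζ z).re - conj g ζ : ℝ) : EReal) ≤ g z := by
  by_cases hz : g z = ⊤
  · rw [hz]; exact le_top
  obtain ⟨k, hk⟩ : ∃ k : ℝ, g z = k := ⟨_, (EReal.coe_toReal hz (hg.convex.1 z)).symm⟩
  rw [hk, EReal.coe_le_coe_iff]
  -- The supremum runs over a dense sequence, and `g` may be infinite arbitrarily near `z`. Near `r
  -- z` with `r < 1`, however, every point is a convex combination of `z` and a point of the ball of
  -- radius `ρ`.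
  have key : ∀ r ∈ Set.Ico (0 : ℝ) 1,
      r * (dot ζ z).re - ‖ζ‖ * (1 - r) * ρ - (r * k + (1 - r) * B) ≤ conj g ζ := by
    intro r hr
    have hr1 : 0 < 1 - r := by linarith [hr.2]
    obtain ⟨i, hi⟩ := exists_denseSeq_mem (Metric.isOpen_ball (x := r • z) (ε := (1 - r) * ρ))
      ⟨r • z, Metric.mem_ball_self (by positivity)⟩
    set d := TopologicalSpace.denseSeq (Cn n) i
    rw [mem_ball_iff_norm] at hi
    have hd : d = r • z + (1 - r) • ((1 - r)⁻¹ • (d - r • z)) := by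
      rw [smul_inv_smul₀ hr1.ne']; abel
    have h1 : g d ≤ ((r * k + (1 - r) * B : ℝ) : EReal) := by
      rw [hd]
      refine hg.convex.le_combo hk.le (hg.le_near _ ?_) ⟨hr.1, hr.2.le⟩
      rw [norm_smul, Real.norm_of_nonneg (inv_nonneg.2 hr1.le), inv_mul_le_iff₀ hr1]
      exact hi.le
    have h2 : (((dot ζ d).re : ℝ) : EReal) + -g d ≤ (conj g ζ : ℝ) := by
      rw [hg.conj_coe hρ]
      exact le_iSup (fun i => (((dot ζ (TopologicalSpace.denseSeq (Cn n) i)).re : EReal) + -g (TopologicalSpace.denseSeq (Cn n) i))) i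
    rw [coe_add_neg_le_iff (hg.convex.1 _)] at h2
    have h3 := EReal.coe_le_coe_iff.1 (h2.trans h1)
    have h4 : (dot ζ (r • z)).re - (dot ζ d).re ≤ ‖ζ‖ * ‖d - r • z‖ := by
      rw [← Complex.sub_re, ← dot_sub, norm_sub_rev]
      exact re_dot_le _ _
    rw [dot_real_smul, Complex.re_ofReal_mul] at h4
    have h5 := mul_le_mul_of_nonneg_left hi.le (norm_nonneg ζ)
    linarith
  have hlim : Tendsto (fun r : ℝ => r * (dot ζ z).re - ‖ζ‖ * (1 - r) * ρ - (r * k + (1 - r) * B))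
      (𝓝[<] 1) (𝓝 (1 * (dot ζ z).re - ‖ζ‖ * (1 - 1) * ρ - (1 * k + (1 - 1) * B))) := by
    have : Continuous fun r : ℝ =>
        r * (dot ζ z).re - ‖ζ‖ * (1 - r) * ρ - (r * k + (1 - r) * B) := by fun_prop
    exact (this.tendsto 1).mono_left nhdsWithin_le_nhds
  have := le_of_tendsto hlim (by
    filter_upwards [Ioo_mem_nhdsLT (zero_lt_one' ℝ)] with r hr using key r ⟨hr.1.le, hr.2⟩)
  linarith

lemma IsTame.neg_le_conj (hg : IsTame ρ B K g) (hρ : 0 < ρ) (ζ : Cn n) : -B ≤ conj g ζ := by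
  have h := (hg.young hρ ζ 0).trans (hg.le_near 0 (by simpa using hρ.le))
  rw [EReal.coe_le_coe_iff, dot_zero, Complex.zero_re] at h
  linarith

lemma IsTame.convexOn_conj (hg : IsTame ρ B K g) (hρ : 0 < ρ) :
    ConvexOn ℝ Set.univ (conj g) := by
  refine ⟨convex_univ, fun ζ _ ξ _ a b ha hb hab => hg.conj_le hρ fun z => ?_⟩
  have h1 := hg.young hρ ζ z
  have h2 := hg.young hρ ξ z
  by_cases hz : g z = ⊤
  · rw [hz]; exact le_top
  obtain ⟨k, hk⟩ : ∃ k : ℝ, g z = k := ⟨_, (EReal.coe_toReal hz (hg.convex.1 z)).symm⟩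
  rw [hk, EReal.coe_le_coe_iff] at h1 h2 ⊢
  rw [add_dot, real_smul_dot, real_smul_dot, Complex.add_re, Complex.re_ofReal_mul,
    Complex.re_ofReal_mul, smul_eq_mul, smul_eq_mul]
  have h3 := mul_le_mul_of_nonneg_left h1 ha
  have h4 := mul_le_mul_of_nonneg_left h2 hb
  have h5 : a * k + b * k = k := by rw [← add_mul, hab, one_mul]
  linarith

lemma IsTame.continuous_conj (hg : IsTame ρ B K g) (hρ : 0 < ρ) : Continuous (conj g) :=
  continuousOn_univ.1 ((hg.convexOn_conj hρ).continuousOn isOpen_univ)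

/-- Hahn–Banach separation of `(z, c)` from the epigraph, which is closed by semicontinuity and
convex. -/
lemma IsTame.exists_affine_minorant (hg : IsTame ρ B K g) (hρ : 0 < ρ) {z : Cn n} {c : ℝ}
    (hc : (c : EReal) < g z) :
    ∃ (ζ : Cn n) (d : ℝ), (∀ y, (((dot ζ y).re - d : ℝ) : EReal) ≤ g y) ∧
      c < (dot ζ z).re - d := by
  set E : Set (Cn n × ℝ) := {x | g x.1 ≤ (x.2 : EReal)}
  have hEc : IsClosed E := by
    have h1 : IsClosed {x : Cn n × EReal | g x.1 ≤ x.2} := hg.lsc.isClosed_epigraph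
    exact h1.preimage (f := fun x : Cn n × ℝ => (x.1, (x.2 : EReal)))
      (continuous_fst.prodMk (continuous_coe_real_ereal.comp continuous_snd))
  have hEv : Convex ℝ E := by
    intro x hx y hy a b ha hb hab
    obtain rfl : b = 1 - a := by linarith
    have := hg.convex.le_combo (x := x.1) (y := y.1) hx hy ⟨ha, by linarith⟩
    simpa [E] using this
  obtain ⟨F, u, hFu, hF⟩ := geometric_hahn_banach_point_closed hEv hEc (x := (z, c))
    (by simpa [E] using hc)
  set L : Cn n →ₗ[ℝ] ℝ := F.toLinearMap.comp (LinearMap.inl ℝ (Cn n) ℝ)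
  set α := F (0, 1)
  have hFL : ∀ y r, F (y, r) = L y + r * α := by
    intro y r
    have : ((y, r) : Cn n × ℝ) = (y, 0) + r • (0, 1) := by simp
    rw [this, map_add, map_smul]
    rfl
  obtain ⟨ζ, hζ⟩ := exists_linear_eq_re_dot L
  rw [hFL] at hFu
  have hα : 0 ≤ α := by
    by_contra hcon
    rw [not_le] at hcon
    have h1 : ∀ r : ℝ, B ≤ r → u < r * α := by
      intro r hr
      have := hF (0, r) ((hg.le_near 0 (by simpa using hρ.le)).trans (EReal.coe_le_coe_iff.2 hr))
      rwa [hFL, map_zero, zero_add] at this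
    have h2 := h1 (max B (u / α)) (le_max_left _ _)
    have h3 := mul_le_mul_of_nonpos_right (le_max_right B (u / α)) hcon.le
    rw [div_mul_cancel₀ _ hcon.ne] at h3
    linarith
  have hmin : ∀ y, g y ≠ ⊤ → ∃ r : ℝ, g y = r ∧ u < L y + r * α := by
    intro y hy
    refine ⟨(g y).toReal, (EReal.coe_toReal hy (hg.convex.1 y)).symm, ?_⟩
    rw [← hFL]
    exact hF (y, (g y).toReal) (EReal.coe_toReal hy (hg.convex.1 y)).ge
  have hneg : ∀ (m : ℝ) (y : Cn n), (dot (m • ζ) y).re = m * L y := by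
    intro m y
    rw [real_smul_dot, Complex.re_ofReal_mul, hζ]
  rcases hα.eq_or_lt with h0 | h0
  -- A vertical hyperplane: a large multiple of it is added to the constant minorant `-K 0`.
  · rw [← h0] at hFu hmin
    set m := max 0 ((c + K 0 + 1) / (u - L z))
    have hm : 0 ≤ m := le_max_left _ _
    have hu : 0 < u - L z := by linarith
    refine ⟨(-m) • ζ, K 0 - m * u, fun y => ?_, ?_⟩
    · by_cases hy : g y = ⊤
      · rw [hy]; exact le_top
      obtain ⟨r, -, hr⟩ := hmin y hy
      refine le_trans (EReal.coe_le_coe_iff.2 ?_) (hg.coercive 0 y)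
      rw [hneg]
      nlinarith
    · rw [hneg]
      have : (c + K 0 + 1) / (u - L z) ≤ m := le_max_right _ _
      rw [div_le_iff₀ hu] at this
      linarith
  · refine ⟨(-α⁻¹) • ζ, -(α⁻¹ * u), fun y => ?_, ?_⟩
    · by_cases hy : g y = ⊤
      · rw [hy]; exact le_top
      obtain ⟨r, hyr, hr⟩ := hmin y hy
      rw [hyr, EReal.coe_le_coe_iff, hneg]
      have := mul_le_mul_of_nonneg_left hr.le (inv_nonneg.2 h0.le)
      rw [mul_add, mul_comm r, inv_mul_cancel_left₀ h0.ne'] at this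
      linarith
    · rw [hneg]
      have := mul_lt_mul_of_pos_left hFu (inv_pos.2 h0)
      rw [mul_add, mul_comm c, inv_mul_cancel_left₀ h0.ne'] at this
      linarith

/-- The Fenchel–Moreau theorem. -/
lemma IsTame.exists_lt_sub_conj (hg : IsTame ρ B K g) (hρ : 0 < ρ) {z : Cn n} {c : ℝ}
    (hc : (c : EReal) < g z) :
    ∃ k, c < (dot (TopologicalSpace.denseSeq (Cn n) k) z).re - conj g (TopologicalSpace.denseSeq (Cn n) k) := by
  obtain ⟨ζ, d, h1, h2⟩ := hg.exists_affine_minorant hρ hc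
  -- Finite convex functions are continuous, so the slope can be moved into the dense sequence.
  refine exists_denseSeq_mem (U := {ζ | c < (dot ζ z).re - conj g ζ}) (isOpen_lt continuous_const
    ((Complex.continuous_re.comp (continuous_dot.comp (Continuous.prodMk_left z))).sub
      (hg.continuous_conj hρ))) ⟨ζ, ?_⟩
  have := hg.conj_le hρ h1
  change c < _ - _
  linarith

lemma measurable_conj {X : Type*} [MeasurableSpace X] {φ : X → Cn n → EReal}
    (hφ : Measurable fun x : X × Cn n => φ x.1 x.2) :
    Measurable fun x : X × Cn n => conj (φ x.1) x.2 := by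
  refine Measurable.ereal_toReal (Measurable.iSup fun i => ?_)
  have h1 : Measurable fun x : X × Cn n =>
      ((dot x.2 (TopologicalSpace.denseSeq (Cn n) i)).re : EReal) :=
    Measurable.coe_real_ereal (Complex.measurable_re.comp
      ((continuous_dot.comp (Continuous.prodMk_left _)).measurable.comp measurable_snd))
  have h2 : Measurable fun x : X × Cn n => -φ x.1 (TopologicalSpace.denseSeq (Cn n) i) :=
    (hφ.comp (measurable_fst.prodMk measurable_const)).neg
  exact h1.add h2

end

/-! ### Extension under a convex majorant, and densities of additive set functions -/

section


variable {n : ℕ}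

/-- The Hahn–Banach theorem for a convex majorant. -/
theorem exists_extension_of_le_convex {E : Type*} [AddCommGroup E] [Module ℝ E] {J : E → ℝ}
    (hJ : ConvexOn ℝ Set.univ J) (N : Submodule ℝ E) (ℓ₀ : E →ₗ[ℝ] ℝ) (hN : ∀ x ∈ N, ℓ₀ x ≤ J x) :
    ∃ ℓ : E →ₗ[ℝ] ℝ, (∀ x ∈ N, ℓ x = ℓ₀ x) ∧ ∀ x, ℓ x ≤ J x := by
  have hJ2 := hJ.2
  have hJ0 : 0 ≤ J 0 := by simpa using hN 0 N.zero_mem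
  have hbdd : ∀ x, BddBelow (Set.range fun c : Set.Ioi (0 : ℝ) => J ((c : ℝ) • x) / c) := by
    intro x
    refine ⟨J 0 - J (-x), ?_⟩
    rintro _ ⟨⟨c, hc⟩, rfl⟩
    have hc' : (0 : ℝ) < c := hc
    have h1 : (0 : ℝ) < 1 + c := by linarith
    have h := hJ2 (Set.mem_univ (c • x)) (Set.mem_univ (-x)) (a := 1 / (1 + c)) (b := c / (1 + c))
      (by positivity) (by positivity) (by field_simp)
    have h2 : (1 / (1 + c)) • c • x + (c / (1 + c)) • -x = 0 := by
      rw [smul_smul, smul_neg, ← sub_eq_add_neg, ← sub_smul]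
      have : 1 / (1 + c) * c - c / (1 + c) = 0 := by ring
      rw [this, zero_smul]
    rw [h2, smul_eq_mul, smul_eq_mul, div_mul_eq_mul_div, div_mul_eq_mul_div, ← add_div,
      le_div_iff₀ h1] at h
    change _ ≤ J (c • x) / c
    rw [le_div_iff₀ hc']
    nlinarith
  -- The largest sublinear minorant of this kind: the infimum over rescalings of `J`. It is finite
  -- because 0 is a convex combination of `c x` and `-x`, and a linear functional below `J` on `N`
  -- is below it there, so the sublinear Hahn–Banach theorem applies.
  set S : E → ℝ := fun x => ⨅ c : Set.Ioi (0 : ℝ), J ((c : ℝ) • x) / c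
  have hS : ∀ x (c : ℝ), 0 < c → S x ≤ J (c • x) / c := fun x c hc => ciInf_le (hbdd x) ⟨c, hc⟩
  have hSle : ∀ x a, (∀ c : ℝ, 0 < c → a ≤ J (c • x) / c) → a ≤ S x := fun x a h =>
    le_ciInf fun c => h c c.2
  have hhom : ∀ (c : ℝ), 0 < c → ∀ x, S (c • x) ≤ c * S x := by
    intro c hc x
    rw [← div_le_iff₀' hc]
    refine hSle _ _ fun d hd => ?_
    rw [div_le_iff₀ hc]
    refine (hS (c • x) (d / c) (by positivity)).trans (le_of_eq ?_)
    rw [smul_smul, div_mul_cancel₀ _ hc.ne']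
    field_simp
  have hhom' : ∀ (c : ℝ), 0 < c → ∀ x, S (c • x) = c * S x := by
    refine fun c hc x => le_antisymm (hhom c hc x) ?_
    have := hhom c⁻¹ (inv_pos.2 hc) (c • x)
    rwa [inv_smul_smul₀ hc.ne', ← div_eq_inv_mul, le_div_iff₀' hc] at this
  have hadd : ∀ x y, S (x + y) ≤ S x + S y := by
    intro x y
    rw [← sub_le_iff_le_add]
    refine hSle _ _ fun c hc => ?_
    rw [sub_le_comm]
    refine hSle _ _ fun d hd => ?_
    rw [sub_le_iff_le_add']
    have hcd : 0 < c + d := by positivity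
    refine (hS (x + y) (c * d / (c + d)) (by positivity)).trans ?_
    have h := hJ2 (Set.mem_univ (c • x)) (Set.mem_univ (d • y)) (a := d / (c + d))
      (b := c / (c + d)) (by positivity) (by positivity) (by field_simp; ring)
    have h3 : (d / (c + d)) • c • x + (c / (c + d)) • d • y = (c * d / (c + d)) • (x + y) := by
      rw [smul_smul, smul_smul, smul_add]
      congr 2 <;> ring
    rw [h3, smul_eq_mul, smul_eq_mul] at h
    rw [div_le_iff₀ (by positivity)]
    refine h.trans (le_of_eq ?_)
    field_simp
  have hle : ∀ x : N, ℓ₀ x ≤ S x := by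
    refine fun x => hSle _ _ fun c hc => ?_
    rw [le_div_iff₀ hc]
    have := hN (c • (x : E)) (N.smul_mem c x.2)
    rw [map_smul, smul_eq_mul, mul_comm] at this
    exact this
  obtain ⟨ℓ, h1, h2⟩ := exists_extension_of_le_sublinear ⟨N, ℓ₀.domRestrict N⟩ S hhom' hadd hle
  refine ⟨ℓ, fun x hx => h1 ⟨x, hx⟩, fun x => (h2 x).trans ?_⟩
  simpa using hS x 1 one_pos

section Density

variable {Ω : Type*} [MeasurableSpace Ω] {ν : Measure Ω} [IsFiniteMeasure ν]

lemma sum_additive {m : Set Ω → ℝ} (hadd : ∀ A B, MeasurableSet A → MeasurableSet B → Disjoint A B →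
      m (A ∪ B) = m A + m B) {f : ℕ → Set Ω} (hf : ∀ i, MeasurableSet (f i))
    (hd : Pairwise (Function.onFun Disjoint f)) (F : Finset ℕ) :
    m (⋃ i ∈ F, f i) = ∑ i ∈ F, m (f i) := by
  induction F using Finset.induction_on with
  | empty =>
    have := hadd ∅ ∅ MeasurableSet.empty MeasurableSet.empty (by simp)
    simp at this ⊢
    exact this
  | insert a F ha ih =>
    rw [Finset.set_biUnion_insert, hadd _ _ (hf a) (F.measurableSet_biUnion fun i _ => hf i),
      Finset.sum_insert ha, ih]
    refine Set.disjoint_iUnion₂_right.2 fun i hi => hd ?_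
    rintro rfl
    exact ha hi

/-- The Radon–Nikodym theorem for finitely additive functions that are absolutely continuous
in the `ε`-`δ` sense. -/
theorem exists_density {m : Set Ω → ℝ} (hadd : ∀ A B, MeasurableSet A → MeasurableSet B →
      Disjoint A B → m (A ∪ B) = m A + m B)
    (hsmall : ∀ ε > 0, ∃ δ > 0, ∀ A, MeasurableSet A → ν.real A < δ → |m A| ≤ ε) :
    ∃ h : Ω → ℝ, Measurable h ∧ Integrable h ν ∧ ∀ A, MeasurableSet A → m A = ∫ s in A, h s ∂ν := by
  classical
  have hm0 : m ∅ = 0 := by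
    have := hadd ∅ ∅ MeasurableSet.empty MeasurableSet.empty (by simp)
    simpa using this
  let M : SignedMeasure Ω :=
    -- A vector measure has to vanish on nonmeasurable sets.
    { measureOf' := fun A => if MeasurableSet A then m A else 0
      empty' := by simp [hm0]
      not_measurable' := fun A hA => by simp [hA]
      m_iUnion' := by
        intro f hf hd
        have hU : MeasurableSet (⋃ i, f i) := MeasurableSet.iUnion hf
        simp only [hf, hU, if_true]
        have hν := VectorMeasure.m_iUnion ν.toSignedMeasure hf hd
        simp only [Measure.toSignedMeasure_apply_measurable (hf _),
          Measure.toSignedMeasure_apply_measurable hU] at hν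
        rw [HasSum, Metric.tendsto_nhds] at hν ⊢
        intro ε hε
        -- Countable additivity: the part of the union left out by a large finite set of indices has
        -- small `ν`-measure.
        obtain ⟨δ, hδ, hδm⟩ := hsmall (ε / 2) (half_pos hε)
        filter_upwards [hν δ hδ] with F hF
        have hFm : MeasurableSet (⋃ i ∈ F, f i) := F.measurableSet_biUnion fun i _ => hf i
        have hsub : (⋃ i ∈ F, f i) ⊆ ⋃ i, f i := Set.iUnion₂_subset_iUnion _ _
        have h1 : ν.real (⋃ i ∈ F, f i) = ∑ i ∈ F, ν.real (f i) :=
          sum_additive (m := ν.real) (fun A B _ hB h => measureReal_union h hB) hf hd F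
        rw [← h1, Real.dist_eq, abs_sub_comm] at hF
        rw [← sum_additive hadd hf hd F, Real.dist_eq, abs_sub_comm]
        have h2 : m (⋃ i, f i) = m (⋃ i ∈ F, f i) + m ((⋃ i, f i) \ ⋃ i ∈ F, f i) := by
          rw [← hadd _ _ hFm (hU.diff hFm) Set.disjoint_sdiff_right, Set.union_sdiff_cancel hsub]
        rw [h2, add_sub_cancel_left]
        refine (hδm _ (hU.diff hFm) ?_).trans_lt (half_lt_self hε)
        rw [measureReal_sdiff hsub hFm]
        exact (le_abs_self _).trans_lt hF }
  have hM : ∀ A, MeasurableSet A → M A = m A := fun A hA => if_pos hA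
  have hac : M.AbsolutelyContinuous ν.toENNRealVectorMeasure := by
    refine VectorMeasure.AbsolutelyContinuous.mk fun A hA h0 => ?_
    rw [Measure.toENNRealVectorMeasure_apply_measurable hA] at h0
    rw [hM A hA]
    refine abs_eq_zero.1 (le_antisymm (le_of_forall_pos_le_add fun ε hε => ?_) (abs_nonneg _))
    obtain ⟨δ, hδ, hδm⟩ := hsmall ε hε
    rw [zero_add]
    exact hδm A hA (by simpa [measureReal_def, h0] using hδ)
  refine ⟨M.rnDeriv ν, SignedMeasure.measurable_rnDeriv _ _, SignedMeasure.integrable_rnDeriv _ _,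
    fun A hA => ?_⟩
  rw [← withDensityᵥ_apply (SignedMeasure.integrable_rnDeriv _ _) hA,
    SignedMeasure.withDensityᵥ_rnDeriv_eq M ν hac, hM A hA]

end Density

end

/-! ### Linear functionals on bounded measurable functions -/

section


variable {n : ℕ} {Ω : Type*} [MeasurableSpace Ω]

/-- The bounded measurable functions with values in `ℂⁿ`. -/
def boundedMeasurable (Ω : Type*) [MeasurableSpace Ω] (n : ℕ) : Submodule ℝ (Ω → Cn n) where
  carrier := {x | Measurable x ∧ ∃ R, ∀ s, ‖x s‖ ≤ R}
  add_mem' := by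
    rintro x y ⟨hx, R, hR⟩ ⟨hy, R', hR'⟩
    exact ⟨hx.add hy, R + R', fun s => norm_add_le_of_le (hR s) (hR' s)⟩
  zero_mem' := ⟨measurable_zero, 0, fun s => by simp⟩
  smul_mem' := by
    rintro c x ⟨hx, R, hR⟩
    refine ⟨hx.const_smul c, |c| * R, fun s => ?_⟩
    rw [Pi.smul_apply, norm_smul, Real.norm_eq_abs]
    exact mul_le_mul_of_nonneg_left (hR s) (abs_nonneg c)

/-- The constant `ζ` on the set `A`, as a linear function of `ζ`. -/
noncomputable def indicatorMap {A : Set Ω} (hA : MeasurableSet A) :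
    Cn n →ₗ[ℝ] boundedMeasurable Ω n where
  toFun ζ := ⟨A.indicator fun _ => ζ, measurable_const.indicator hA, ‖ζ‖,
    fun s => norm_indicator_le_norm_self (fun _ => ζ) s⟩
  map_add' ζ ξ := Subtype.ext (Set.indicator_add A (fun _ => ζ) fun _ => ξ)
  map_smul' c ζ := Subtype.ext (Set.indicator_const_smul A c fun _ => ζ)

lemma indicatorMap_union {A B : Set Ω} (hA : MeasurableSet A) (hB : MeasurableSet B)
    (hAB : Disjoint A B) (ζ : Cn n) :
    indicatorMap (hA.union hB) ζ = indicatorMap hA ζ + indicatorMap hB ζ :=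
  Subtype.ext (Set.indicator_union_of_disjoint hAB fun _ => ζ)

lemma integrable_re_dot' {ν : Measure Ω} {b : Ω → Cn n} (hb : Integrable b ν)
    {x : Ω → Cn n} (hx : Measurable x) {R : ℝ} (hR : ∀ s, ‖x s‖ ≤ R) :
    Integrable (fun s => (dot (x s) (b s)).re) ν := by
  have hc : Continuous fun x : Cn n × Cn n => (dot x.1 x.2).re :=
    Complex.continuous_re.comp continuous_dot
  have hm : AEStronglyMeasurable (fun s => (dot (x s) (b s)).re) ν :=
    (hc.measurable.comp_aemeasurable
      (hx.aemeasurable.prodMk hb.1.aemeasurable)).aestronglyMeasurable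
  have hle : ∀ s, ‖(dot (x s) (b s)).re‖ ≤ R * ‖b s‖ := fun s => by
    rw [Real.norm_eq_abs]
    exact (abs_re_dot_le _ _).trans (mul_le_mul_of_nonneg_right (hR s) (norm_nonneg _))
  exact Integrable.mono' (hb.norm.const_mul R) hm (Eventually.of_forall hle)

lemma integrable_re_dot {ν : Measure Ω} {b : Ω → Cn n} (hb : Integrable b ν)
    {x : Ω → Cn n} (hx : x ∈ boundedMeasurable Ω n) :
    Integrable (fun s => (dot (x s) (b s)).re) ν :=
  integrable_re_dot' hb hx.1 hx.2.choose_spec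

lemma exists_simpleFunc_near {x : Ω → Cn n} (hx : x ∈ boundedMeasurable Ω n) {ε : ℝ} (hε : 0 < ε) :
    ∃ y : SimpleFunc Ω (Cn n), ∀ s, ‖x s - y s‖ ≤ ε := by
  obtain ⟨hxm, R, hR⟩ := hx
  set e := TopologicalSpace.denseSeq (Cn n)
  obtain ⟨F, hF⟩ := (isCompact_closedBall (0 : Cn n) R).elim_finite_subcover
    (fun k => Metric.ball (e k) ε) (fun k => Metric.isOpen_ball) fun z _ => by
      obtain ⟨k, hk⟩ := exists_denseSeq_mem (Metric.isOpen_ball (x := z) (ε := ε))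
        ⟨z, Metric.mem_ball_self hε⟩
      exact Set.mem_iUnion.2 ⟨k, Metric.mem_ball_comm.1 hk⟩
  refine ⟨(SimpleFunc.nearestPt e (F.sup id)).comp x hxm, fun s => ?_⟩
  obtain ⟨k, hk, hks⟩ := Set.mem_iUnion₂.1 (hF (mem_closedBall_zero_iff.2 (hR s)))
  have h1 := SimpleFunc.edist_nearestPt_le e (x s) (Finset.le_sup (f := id) hk)
  rw [edist_dist, edist_dist, ENNReal.ofReal_le_ofReal_iff dist_nonneg] at h1
  rw [← dist_eq_norm, dist_comm]
  refine h1.trans ?_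
  rw [dist_comm]
  exact (Metric.mem_ball.1 hks).le

/-- A countably additive linear functional on bounded measurable functions is given by an
integrable function. -/
theorem exists_integrable_eq_integral {ν : Measure Ω} [IsFiniteMeasure ν]
    (ℓ : boundedMeasurable Ω n →ₗ[ℝ] ℝ) {C : ℝ}
    (hC : ∀ (x : boundedMeasurable Ω n) (r : ℝ), 0 < r → (∀ s, ‖x.1 s‖ ≤ r) → |ℓ x| ≤ r * C)
    (hsmall : ∀ ζ : Cn n, ∀ ε > 0, ∃ δ > 0, ∀ (A : Set Ω) (hA : MeasurableSet A),
      ν.real A < δ → |ℓ (indicatorMap hA ζ)| ≤ ε) :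
    ∃ b : Ω → Cn n, Measurable b ∧ Integrable b ν ∧
      ∀ x : boundedMeasurable Ω n, ℓ x = ∫ s, (dot (x.1 s) (b s)).re ∂ν := by
  classical
  have hdens : ∀ ζ : Cn n, ∃ h : Ω → ℝ, Measurable h ∧ Integrable h ν ∧
      ∀ (A : Set Ω) (hA : MeasurableSet A), ℓ (indicatorMap hA ζ) = ∫ s in A, h s ∂ν := by
    intro ζ
    obtain ⟨h, h1, h2, h3⟩ := exists_density (ν := ν)
      (m := fun A => if hA : MeasurableSet A then ℓ (indicatorMap hA ζ) else 0)
      (fun A B hA hB hAB => by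
        simp only [hA, hB, hA.union hB, dif_pos, indicatorMap_union hA hB hAB, map_add])
      (fun ε hε => by
        obtain ⟨δ, hδ, h⟩ := hsmall ζ ε hε
        refine ⟨δ, hδ, fun A hA hAδ => ?_⟩
        simp only [hA, dif_pos]
        exact h A hA hAδ)
    refine ⟨h, h1, h2, fun A hA => ?_⟩
    rw [← h3 A hA, dif_pos hA]
  choose h hm hi hA using hdens
  -- The minus sign compensates `Re(ζ b) = Re ζ Re b - Im ζ Im b` for the bilinear product.
  set b : Ω → Cn n := fun s => ∑ j, (h (EuclideanSpace.single j 1) s • EuclideanSpace.single j (1 : ℂ)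
    - h (EuclideanSpace.single j Complex.I) s • EuclideanSpace.single j Complex.I)
  have hbm : Measurable b := Finset.measurable_sum _ fun j _ =>
    ((hm _).smul_const _).sub ((hm _).smul_const _)
  have hbi : Integrable b ν := integrable_finsetSum _ fun j _ =>
    ((hi _).smul_const _).sub ((hi _).smul_const _)
  have hbdot : ∀ ζ s, (dot ζ (b s)).re = ∑ j, ((ζ j).re * h (EuclideanSpace.single j 1) s +
      (ζ j).im * h (EuclideanSpace.single j Complex.I) s) := by
    intro ζ s
    have h1 : ∀ i, b s i = (h (EuclideanSpace.single i 1) s : ℂ) -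
        h (EuclideanSpace.single i Complex.I) s * Complex.I := by
      intro i
      simp only [b, WithLp.ofLp_sum, Finset.sum_apply, PiLp.sub_apply, PiLp.smul_apply,
        PiLp.single_apply, Complex.real_smul]
      rw [Finset.sum_eq_single i (fun j _ hj => by simp [hj.symm]) (by simp)]
      simp
    simp only [dot, Complex.re_sum, h1]
    refine Finset.sum_congr rfl fun j _ => ?_
    simp
  have hind : ∀ (A : Set Ω) (hA : MeasurableSet A) (ζ : Cn n),
      ℓ (indicatorMap hA ζ) = ∫ s in A, (dot ζ (b s)).re ∂ν := by
    intro A hAm ζ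
    conv_lhs => rw [eq_sum_single ζ]
    simp only [map_sum, map_add, map_smul, smul_eq_mul, hA, hbdot]
    have hi' : ∀ j, Integrable (fun s => (ζ j).re * h (EuclideanSpace.single j 1) s +
        (ζ j).im * h (EuclideanSpace.single j Complex.I) s) (ν.restrict A) := fun j =>
      (((hi _).const_mul _).add ((hi _).const_mul _)).restrict
    rw [integral_finsetSum _ fun j _ => hi' j]
    refine Finset.sum_congr rfl fun j _ => ?_
    rw [integral_add ((hi _).const_mul _).restrict ((hi _).const_mul _).restrict,
      integral_const_mul, integral_const_mul]
  have hsimple : ∀ (y : SimpleFunc Ω (Cn n)) (hy : (y : Ω → Cn n) ∈ boundedMeasurable Ω n),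
      ℓ ⟨y, hy⟩ = ∫ s, (dot (y s) (b s)).re ∂ν := by
    intro y
    induction y using SimpleFunc.induction with
    | @const ζ A hAm =>
      intro hy
      have h1 : (⟨_, hy⟩ : boundedMeasurable Ω n) = indicatorMap hAm ζ := by
        refine Subtype.ext (funext fun s => ?_)
        by_cases hs : s ∈ A <;> simp [indicatorMap, hs]
      rw [h1, hind, ← integral_indicator hAm]
      refine integral_congr_ae (Eventually.of_forall fun s => ?_)
      by_cases hs : s ∈ A <;> simp [hs]
    | @add y z hd hy hz =>
      intro hyz
      have hmem : ∀ y : SimpleFunc Ω (Cn n), (y : Ω → Cn n) ∈ boundedMeasurable Ω n := fun y =>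
        ⟨y.measurable, y.exists_forall_norm_le⟩
      have h1 : (⟨_, hyz⟩ : boundedMeasurable Ω n) = ⟨y, hmem y⟩ + ⟨z, hmem z⟩ :=
        Subtype.ext (SimpleFunc.coe_add y z)
      rw [h1, map_add, hy, hz, ← integral_add (integrable_re_dot hbi (hmem y))
        (integrable_re_dot hbi (hmem z))]
      refine integral_congr_ae (Eventually.of_forall fun s => ?_)
      simp [add_dot]
  refine ⟨b, hbm, hbi, fun x => ?_⟩
  rw [← sub_eq_zero]
  refine abs_eq_zero.1 (le_antisymm ?_ (abs_nonneg _))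
  -- Both functionals are continuous for the uniform norm, in which simple functions are dense.
  have hbound : ∀ ε > 0, |ℓ x - ∫ s, (dot (x.1 s) (b s)).re ∂ν| ≤ ε * (C + ∫ s, ‖b s‖ ∂ν) := by
    intro ε hε
    obtain ⟨y, hy⟩ := exists_simpleFunc_near x.2 hε
    have hymem : (y : Ω → Cn n) ∈ boundedMeasurable Ω n := ⟨y.measurable, y.exists_forall_norm_le⟩
    have h1 := hC (x - ⟨y, hymem⟩) ε hε fun s => by
      simpa only [Submodule.coe_sub, Pi.sub_apply] using hy s
    have h2 : |∫ s, (dot (x.1 s) (b s)).re ∂ν - ∫ s, (dot (y s) (b s)).re ∂ν|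
        ≤ ε * ∫ s, ‖b s‖ ∂ν := by
      rw [← integral_sub (integrable_re_dot hbi x.2) (integrable_re_dot hbi hymem),
        ← integral_const_mul, ← Real.norm_eq_abs]
      refine norm_integral_le_of_norm_le (hbi.norm.const_mul ε) (Eventually.of_forall fun s => ?_)
      rw [← Complex.sub_re, ← sub_dot, Real.norm_eq_abs]
      exact (abs_re_dot_le _ _).trans (mul_le_mul_of_nonneg_right (hy s) (norm_nonneg _))
    rw [map_sub, hsimple y hymem] at h1
    rw [abs_le] at h1 h2 ⊢
    constructor <;> linarith
  have hlim : Tendsto (fun ε : ℝ => ε * (C + ∫ s, ‖b s‖ ∂ν)) (𝓝[>] 0)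
      (𝓝 (0 * (C + ∫ s, ‖b s‖ ∂ν))) :=
    ((continuous_mul_const (C + ∫ s, ‖b s‖ ∂ν)).tendsto 0).mono_left nhdsWithin_le_nhds
  rw [zero_mul] at hlim
  exact ge_of_tendsto hlim (eventually_nhdsWithin_of_forall fun ε hε => hbound ε hε)

end

/-! ### Duality for convex integral functionals -/

section


variable {n : ℕ} {Ω : Type*} [MeasurableSpace Ω] {ν : Measure Ω} [IsProbabilityMeasure ν]
  {φ : Ω → Cn n → EReal} {ρ B : ℝ} {K : ℝ → ℝ}

lemma integrable_conj (hφ : Measurable fun x : Ω × Cn n => φ x.1 x.2) (hρ : 0 < ρ)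
    (ht : ∀ s, IsTame ρ B K (φ s)) {x : Ω → Cn n} (hx : x ∈ boundedMeasurable Ω n) :
    Integrable (fun s => conj (φ s) (x s)) ν := by
  obtain ⟨hxm, R, hR⟩ := hx
  refine Integrable.of_bound
    ((measurable_conj hφ).comp (measurable_id.prodMk hxm)).aestronglyMeasurable (max B (K R))
    (Eventually.of_forall fun s => ?_)
  rw [Real.norm_eq_abs, abs_le]
  have h1 := (ht s).neg_le_conj hρ (x s)
  have h2 := (ht s).conj_le_of_norm_le hρ (hR s)
  exact ⟨by linarith [le_max_left B (K R)], h2.trans (le_max_right _ _)⟩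

/-- The hypothesis says precisely that the functional on `N` is dominated by the convex function `x
↦ ∫ φ*(x) + T`. -/
lemma exists_dominated_extension (hφ : Measurable fun x : Ω × Cn n => φ x.1 x.2) (hρ : 0 < ρ)
    (ht : ∀ s, IsTame ρ B K (φ s)) (N : Submodule ℝ (boundedMeasurable Ω n)) (w₀ : Cn n) {T : ℝ}
    (hT : ∀ x ∈ N, ∫ s, (dot (x.1 s) w₀).re ∂ν - ∫ s, conj (φ s) (x.1 s) ∂ν ≤ T) :
    ∃ ℓ : boundedMeasurable Ω n →ₗ[ℝ] ℝ, (∀ x ∈ N, ℓ x = ∫ s, (dot (x.1 s) w₀).re ∂ν) ∧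
      ∀ x, ℓ x ≤ ∫ s, conj (φ s) (x.1 s) ∂ν + T := by
  have hint : ∀ x : boundedMeasurable Ω n, Integrable (fun s => (dot (x.1 s) w₀).re) ν := fun x =>
    integrable_re_dot (integrable_const w₀) x.2
  let ℓ₀ : boundedMeasurable Ω n →ₗ[ℝ] ℝ :=
    { toFun := fun x => ∫ s, (dot (x.1 s) w₀).re ∂ν
      map_add' := fun x y => by
        rw [← integral_add (hint x) (hint y)]
        refine integral_congr_ae (Eventually.of_forall fun s => ?_)
        simp [add_dot]
      map_smul' := fun c x => by
        rw [RingHom.id_apply, smul_eq_mul, ← integral_const_mul]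
        refine integral_congr_ae (Eventually.of_forall fun s => ?_)
        simp [real_smul_dot] }
  have hJ : ConvexOn ℝ Set.univ fun x : boundedMeasurable Ω n =>
      ∫ s, conj (φ s) (x.1 s) ∂ν + T := by
    refine ⟨convex_univ, fun x _ y _ a b ha hb hab => ?_⟩
    have h1 : ∫ s, conj (φ s) ((a • x + b • y).1 s) ∂ν ≤
        ∫ s, (a * conj (φ s) (x.1 s) + b * conj (φ s) (y.1 s)) ∂ν :=
      integral_mono (integrable_conj hφ hρ ht (a • x + b • y).2)
        (((integrable_conj hφ hρ ht x.2).const_mul a).add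
          ((integrable_conj hφ hρ ht y.2).const_mul b))
        fun s => ((ht s).convexOn_conj hρ).2 (Set.mem_univ (x.1 s)) (Set.mem_univ (y.1 s)) ha hb hab
    rw [integral_add ((integrable_conj hφ hρ ht x.2).const_mul a)
      ((integrable_conj hφ hρ ht y.2).const_mul b), integral_const_mul, integral_const_mul] at h1
    simp only [smul_eq_mul]
    have h2 : a * T + b * T = T := by rw [← add_mul, hab, one_mul]
    linarith
  exact exists_extension_of_le_convex hJ N ℓ₀ fun x hx => by
    have := hT x hx
    change ∫ s, (dot (x.1 s) w₀).re ∂ν ≤ _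
    linarith

/-- Testing the majorant with large multiples of an indicator shows that `ℓ` is absolutely
continuous: this uses that `φ*` is bounded on every ball uniformly in `s`, which is the superlinear
growth of `φ`. -/
lemma exists_representation (hφ : Measurable fun x : Ω × Cn n => φ x.1 x.2) (hρ : 0 < ρ)
    (ht : ∀ s, IsTame ρ B K (φ s)) {T : ℝ} (ℓ : boundedMeasurable Ω n →ₗ[ℝ] ℝ)
    (hℓ : ∀ x, ℓ x ≤ ∫ s, conj (φ s) (x.1 s) ∂ν + T) :
    ∃ b : Ω → Cn n, Measurable b ∧ Integrable b ν ∧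
      ∀ x : boundedMeasurable Ω n, ℓ x = ∫ s, (dot (x.1 s) (b s)).re ∂ν := by
  have hbound : ∀ (x : boundedMeasurable Ω n) (r : ℝ), 0 < r → (∀ s, ‖x.1 s‖ ≤ r) →
      ℓ x ≤ r * (K 1 + T) := by
    intro x r hr hx
    have h1 := hℓ (r⁻¹ • x)
    have h2 : ∫ s, conj (φ s) ((r⁻¹ • x).1 s) ∂ν ≤ ∫ _, K 1 ∂ν := by
      refine integral_mono (integrable_conj hφ hρ ht (r⁻¹ • x).2) (integrable_const _) fun s => ?_
      refine (ht s).conj_le_of_norm_le hρ ?_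
      change ‖r⁻¹ • x.1 s‖ ≤ 1
      rw [norm_smul, Real.norm_of_nonneg (inv_nonneg.2 hr.le), inv_mul_le_iff₀ hr, mul_one]
      exact hx s
    rw [integral_const, probReal_univ, one_smul] at h2
    rw [map_smul, smul_eq_mul] at h1
    have h3 := mul_le_mul_of_nonneg_left (h1.trans (add_le_add_left h2 T)) hr.le
    rwa [mul_inv_cancel_left₀ hr.ne'] at h3
  have hneg : ∀ (x : boundedMeasurable Ω n), ℓ (-x) = -ℓ x := fun x => map_neg ℓ x
  refine exists_integrable_eq_integral ℓ (C := K 1 + T) (fun x r hr hx => ?_) fun ζ ε hε => ?_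
  · rw [abs_le']
    refine ⟨hbound x r hr hx, ?_⟩
    rw [← hneg]
    refine hbound (-x) r hr fun s => ?_
    change ‖-x.1 s‖ ≤ r
    rw [norm_neg]
    exact hx s
  · have hT0 : 0 ≤ |K 0| + |T| := by positivity
    -- After division by `c` the terms that do not shrink with `A` contribute at most `ε`; the
    -- measure bound `1 / (D + 1)` keeps the remaining term below 1.
    set c := (|K 0| + |T| + 1) / ε
    have hc : 0 < c := by positivity
    set D := |K (c * ‖ζ‖)|
    have hD : 0 ≤ D := abs_nonneg _
    refine ⟨1 / (D + 1), by positivity, fun A hA hAδ => ?_⟩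
    have hone : ∀ ξ : Cn n, ‖ξ‖ = ‖ζ‖ → ℓ (indicatorMap hA ξ) ≤ ε := by
      intro ξ hξ
      have h1 := hℓ (indicatorMap hA (c • ξ))
      have h2 : ∀ s, conj (φ s) ((indicatorMap hA (c • ξ)).1 s)
          ≤ A.indicator (fun _ => D) s + |K 0| := by
        intro s
        by_cases hs : s ∈ A
        · have : (indicatorMap hA (c • ξ)).1 s = c • ξ :=
            Set.indicator_of_mem hs fun _ => c • ξ
          rw [this, Set.indicator_of_mem hs]
          have h3 := (ht s).conj_le_of_norm_le hρ (ζ := c • ξ) (R := c * ‖ζ‖) (by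
            rw [norm_smul, Real.norm_of_nonneg hc.le, hξ])
          linarith [le_abs_self (K (c * ‖ζ‖)), abs_nonneg (K 0)]
        · have : (indicatorMap hA (c • ξ)).1 s = 0 :=
            Set.indicator_of_notMem hs fun _ => c • ξ
          rw [this, Set.indicator_of_notMem hs, zero_add]
          exact ((ht s).conj_le_of_norm_le hρ (by simp)).trans (le_abs_self _)
      have hi : Integrable (A.indicator fun _ : Ω => D) ν := (integrable_const D).indicator hA
      have h3 := integral_mono (integrable_conj hφ hρ ht (indicatorMap hA (c • ξ)).2)
        (hi.add (integrable_const |K 0|)) h2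
      have h4 : ∫ s, (A.indicator (fun _ : Ω => D) s + |K 0|) ∂ν = ν.real A * D + |K 0| := by
        rw [integral_add hi (integrable_const _), integral_indicator hA, setIntegral_const,
          integral_const, probReal_univ, one_smul, smul_eq_mul]
      have h5 := h3.trans_eq h4
      have h8 : ℓ (indicatorMap hA (c • ξ)) = c * ℓ (indicatorMap hA ξ) := by
        rw [map_smul, map_smul, smul_eq_mul]
      rw [h8] at h1
      have h6 : ν.real A * D ≤ 1 := by
        rw [lt_div_iff₀ (by positivity)] at hAδ
        nlinarith [measureReal_nonneg (μ := ν) (s := A)]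
      have h7 : c * ℓ (indicatorMap hA ξ) ≤ |K 0| + |T| + 1 := by linarith [le_abs_self T]
      rw [← le_div_iff₀' hc] at h7
      refine h7.trans (le_of_eq ?_)
      simp only [c]
      field_simp
    rw [abs_le']
    refine ⟨hone ζ rfl, ?_⟩
    rw [← hneg, ← map_neg]
    exact hone (-ζ) (norm_neg ζ)

/-- Simple functions that approximately maximize `Re (ζ · b) - φ*(ζ)`. -/
noncomputable def selection (φ : Ω → Cn n → EReal) (b : Ω → Cn n) : ℕ → Ω → Cn n
  | 0, _ => 0
  | m + 1, s =>
    if (dot (selection φ b m s) (b s)).re - conj (φ s) (selection φ b m s) <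
        (dot (TopologicalSpace.denseSeq (Cn n) m) (b s)).re -
          conj (φ s) (TopologicalSpace.denseSeq (Cn n) m)
      then TopologicalSpace.denseSeq (Cn n) m else selection φ b m s

omit [MeasurableSpace Ω] in
lemma selection_value_mono (φ : Ω → Cn n → EReal) (b : Ω → Cn n) (s : Ω) :
    Monotone fun m => (dot (selection φ b m s) (b s)).re - conj (φ s) (selection φ b m s) := by
  refine monotone_nat_of_le_succ fun m => ?_
  conv_rhs => rw [selection]
  split_ifs with h
  · exact h.le
  · exact le_rfl

omit [MeasurableSpace Ω] in
lemma le_selection_value (φ : Ω → Cn n → EReal) (b : Ω → Cn n) (s : Ω) (m : ℕ) :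
    (dot (TopologicalSpace.denseSeq (Cn n) m) (b s)).re -
        conj (φ s) (TopologicalSpace.denseSeq (Cn n) m) ≤
      (dot (selection φ b (m + 1) s) (b s)).re - conj (φ s) (selection φ b (m + 1) s) := by
  rw [selection]
  split_ifs with h
  · exact le_rfl
  · exact not_lt.1 h

lemma measurable_value (hφ : Measurable fun x : Ω × Cn n => φ x.1 x.2) {b x : Ω → Cn n}
    (hb : Measurable b) (hx : Measurable x) :
    Measurable fun s => (dot (x s) (b s)).re - conj (φ s) (x s) := by
  have hdot : Measurable fun x : Cn n × Cn n => (dot x.1 x.2).re :=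
    (Complex.continuous_re.comp continuous_dot).measurable
  have h1 : Measurable fun s => (x s, b s) := hx.prodMk hb
  have h2 : Measurable fun s => (s, x s) := measurable_id.prodMk hx
  have h3 := hdot.comp h1
  have h4 := (measurable_conj hφ).comp h2
  simp only [Function.comp_def] at h3 h4
  exact h3.sub h4

lemma selection_mem (hφ : Measurable fun x : Ω × Cn n => φ x.1 x.2) {b : Ω → Cn n}
    (hb : Measurable b) (m : ℕ) : selection φ b m ∈ boundedMeasurable Ω n := by
  induction m with
  | zero => exact ⟨measurable_const, 0, fun s => by simp [selection]⟩
  | succ m ih =>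
    obtain ⟨h1, R, hR⟩ := ih
    refine ⟨Measurable.ite (measurableSet_lt (measurable_value hφ hb h1)
      (measurable_value hφ hb measurable_const))
      measurable_const h1, max R ‖TopologicalSpace.denseSeq (Cn n) m‖, fun s => ?_⟩
    rw [selection]
    split_ifs
    · exact le_max_right _ _
    · exact (hR s).trans (le_max_left _ _)

/-- The values of `Re(x·b) - φ*(x)` at the greedy selections increase, by Fenchel–Moreau, to `φ(s,
b(s))`. Each selection is bounded and measurable, so its integral is at most `T`, and monotone
convergence concludes. -/
lemma exists_integral_le (hφ : Measurable fun x : Ω × Cn n => φ x.1 x.2) (hρ : 0 < ρ)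
    (ht : ∀ s, IsTame ρ B K (φ s)) {b : Ω → Cn n} (hb : Measurable b) (hbi : Integrable b ν) {T : ℝ}
    (hT : ∀ x ∈ boundedMeasurable Ω n,
      ∫ s, (dot (x s) (b s)).re ∂ν ≤ ∫ s, conj (φ s) (x s) ∂ν + T) :
    ∃ k : Ω → ℝ, Integrable k ν ∧ (∀ᵐ s ∂ν, φ s (b s) = k s) ∧ ∫ s, k s ∂ν ≤ T := by
  set F : ℕ → Ω → ℝ := fun m s =>
    (dot (selection φ b m s) (b s)).re - conj (φ s) (selection φ b m s)
  have hFi : ∀ m, Integrable (F m) ν := fun m =>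
    (integrable_re_dot hbi (selection_mem hφ hb m)).sub
      (integrable_conj hφ hρ ht (selection_mem hφ hb m))
  have hFT : ∀ m, ∫ s, F m s ∂ν ≤ T := by
    intro m
    rw [integral_sub (integrable_re_dot hbi (selection_mem hφ hb m))
      (integrable_conj hφ hρ ht (selection_mem hφ hb m))]
    linarith [hT _ (selection_mem hφ hb m)]
  have hF0 : ∀ m s, 0 ≤ F m s + K 0 := by
    intro m s
    have h1 : F 0 s ≤ F m s := selection_value_mono φ b s (Nat.zero_le m)
    have h2 : F 0 s = -conj (φ s) 0 := by simp [F, selection]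
    have h3 := (ht s).conj_le_of_norm_le hρ (ζ := 0) (R := 0) (by simp)
    linarith
  have hFK : ∀ m, Integrable (fun s => F m s + K 0) ν := fun m => (hFi m).add (integrable_const _)
  have hFKint : ∀ m, ∫ s, (F m s + K 0) ∂ν ≤ T + K 0 := by
    intro m
    rw [integral_add (hFi m) (integrable_const _), integral_const, probReal_univ, one_smul]
    linarith [hFT m]
  have hTK : 0 ≤ T + K 0 := (integral_nonneg (hF0 0)).trans (hFKint 0)
  -- Since `selection` starts at 0, all values are at least `-φ*(0) ≥ -K 0`; the shift makes them
  -- nonnegative.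
  set U : Ω → ℝ≥0∞ := fun s => ⨆ m, ENNReal.ofReal (F m s + K 0)
  have hUm : AEMeasurable U ν := AEMeasurable.iSup fun m => (hFK m).aemeasurable.ennreal_ofReal
  have hU : ∫⁻ s, U s ∂ν ≤ ENNReal.ofReal (T + K 0) := by
    rw [lintegral_iSup' (fun m => (hFK m).aemeasurable.ennreal_ofReal)
      (Eventually.of_forall fun s m m' h => ENNReal.ofReal_le_ofReal
        (add_le_add_left (selection_value_mono φ b s h) _))]
    refine iSup_le fun m => ?_
    rw [← ofReal_integral_eq_lintegral_ofReal (hFK m) (Eventually.of_forall (hF0 m))]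
    exact ENNReal.ofReal_le_ofReal (hFKint m)
  have hUfin : ∫⁻ s, U s ∂ν ≠ ∞ := ne_top_of_le_ne_top ENNReal.ofReal_ne_top hU
  have hUi : Integrable (fun s => (U s).toReal) ν := integrable_toReal_of_lintegral_ne_top hUm hUfin
  refine ⟨fun s => (U s).toReal - K 0, hUi.sub (integrable_const _), ?_, ?_⟩
  · filter_upwards [ae_lt_top' hUm hUfin] with s hs
    have hFU : ∀ m, F m s + K 0 ≤ (U s).toReal := fun m =>
      (ENNReal.ofReal_le_iff_le_toReal hs.ne).1
        (le_iSup (fun m => ENNReal.ofReal (F m s + K 0)) m)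
    have hle : φ s (b s) ≤ (((U s).toReal - K 0 : ℝ) : EReal) := by
      by_contra hcon
      obtain ⟨k, hk⟩ := (ht s).exists_lt_sub_conj hρ (not_le.1 hcon)
      have h1 : _ ≤ F (k + 1) s := le_selection_value φ b s k
      linarith [hFU (k + 1)]
    refine le_antisymm hle ?_
    obtain ⟨c, hc⟩ : ∃ c : ℝ, φ s (b s) = c := ⟨_, (EReal.coe_toReal
      (hle.trans_lt (EReal.coe_lt_top _)).ne ((ht s).convex.1 _)).symm⟩
    have hFc : ∀ m, F m s ≤ c := by
      intro m
      have := (ht s).young hρ (selection φ b m s) (b s)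
      rwa [hc, EReal.coe_le_coe_iff] at this
    rw [hc, EReal.coe_le_coe_iff, sub_le_iff_le_add]
    have hc0 : 0 ≤ c + K 0 := (hF0 0 s).trans (add_le_add_left (hFc 0) _)
    exact ENNReal.toReal_le_of_le_ofReal hc0
      (iSup_le fun m => ENNReal.ofReal_le_ofReal (add_le_add_left (hFc m) _))
  · rw [integral_sub hUi (integrable_const _), integral_const, probReal_univ, one_smul,
      integral_toReal hUm (ae_lt_top' hUm hUfin)]
    linarith [ENNReal.toReal_le_of_le_ofReal hTK hU]

/-- Duality for integral functionals: a bound for the affine functions given by the elements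
of `N` is attained by a selection with the prescribed moments. -/
theorem exists_minimizer (hφ : Measurable fun x : Ω × Cn n => φ x.1 x.2) (hρ : 0 < ρ)
    (ht : ∀ s, IsTame ρ B K (φ s)) (N : Submodule ℝ (boundedMeasurable Ω n)) (w₀ : Cn n) {T : ℝ}
    (hT : ∀ x ∈ N, ∫ s, (dot (x.1 s) w₀).re ∂ν - ∫ s, conj (φ s) (x.1 s) ∂ν ≤ T) :
    ∃ b : Ω → Cn n, Measurable b ∧ Integrable b ν ∧
      (∀ x ∈ N, ∫ s, (dot (x.1 s) (b s)).re ∂ν = ∫ s, (dot (x.1 s) w₀).re ∂ν) ∧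
      ∃ k : Ω → ℝ, Integrable k ν ∧ (∀ᵐ s ∂ν, φ s (b s) = k s) ∧ ∫ s, k s ∂ν ≤ T := by
  obtain ⟨ℓ, hℓN, hℓ⟩ := exists_dominated_extension hφ hρ ht N w₀ hT
  obtain ⟨b, hb, hbi, hbℓ⟩ := exists_representation hφ hρ ht ℓ hℓ
  refine ⟨b, hb, hbi, fun x hx => by rw [← hbℓ, hℓN x hx],
    exists_integral_le hφ hρ ht hb hbi fun x hx => ?_⟩
  rw [← hbℓ ⟨x, hx⟩]
  exact hℓ ⟨x, hx⟩

end

section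


variable {n : ℕ}

/-! ### Boundary values of affine functions -/

lemma tendsto_re_dot {ι : Type*} {l : Filter ι} {f g : ι → Cn n} {a b : Cn n}
    (hf : Tendsto f l (𝓝 a)) (hg : Tendsto g l (𝓝 b)) :
    Tendsto (fun i => (dot (f i) (g i)).re) l (𝓝 (dot a b).re) := by
  have hc : Continuous fun x : Cn n × Cn n => (dot x.1 x.2).re :=
    Complex.continuous_re.comp continuous_dot
  have h1 := (hc.tendsto (a, b)).comp (hf.prodMk_nhds hg)
  simpa only [Function.comp_def] using h1

lemma tendsto_affineFn {q : ℝ≥0∞} (hq : 1 ≤ q) {f₀ : Circle → ℂ} (hf₀ : MemLp f₀ 1 arc)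
    {f : ℂ → Cn n} {b : Circle → Cn n} (hf : IsHardy q f b) :
    ∀ᵐ s : Circle ∂arc, ∀ z : Cn n,
      Tendsto (fun x : ℝ × Cn n => (affineFn f₀ f ((x.1 : ℂ) * (s : ℂ), x.2) : EReal))
        (𝓝[Set.Ioo 0 1] (1 : ℝ) ×ˢ 𝓝 z) (𝓝 (((dot (b s) z).re - (f₀ s).re : ℝ) : EReal)) := by
  have hi : Integrable (fun s => (f₀ s).re) arc := (hf₀.integrable le_rfl).re
  filter_upwards [hf.ae_tendsto hq, ae_tendsto_poisson hi] with s h1 h2 z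
  have h3 : Tendsto (fun x : ℝ × Cn n => f ((x.1 : ℂ) * (s : ℂ)))
      (𝓝[Set.Ioo 0 1] (1 : ℝ) ×ˢ 𝓝 z) (𝓝 (b s)) := h1.comp tendsto_fst
  have h4 : Tendsto (fun x : ℝ × Cn n => poisson (fun s => (f₀ s).re) ((x.1 : ℂ) * (s : ℂ)))
      (𝓝[Set.Ioo 0 1] (1 : ℝ) ×ˢ 𝓝 z) (𝓝 (f₀ s).re) := h2.comp tendsto_fst
  have h5 := (tendsto_re_dot h3 tendsto_snd).sub h4
  exact (continuous_coe_real_ereal.tendsto _).comp h5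

instance : (𝓝[Set.Ioo 0 1] (1 : ℝ)).NeBot := right_nhdsWithin_Ioo_neBot zero_lt_one

/-- By Fatou's theorem the limsup is a limit, so the boundary inequality is a pointwise one between
the boundary values. -/
lemma boundaryLE_affineFn_iff {q : ℝ≥0∞} (hq : 1 ≤ q) {φ : Circle → Cn n → EReal}
    {f₀ : Circle → ℂ} (hf₀ : MemLp f₀ 1 arc) {f : ℂ → Cn n} {b : Circle → Cn n}
    (hf : IsHardy q f b) : BoundaryLE (affineFn f₀ f) φ ↔
      ∀ᵐ s ∂arc, ∀ z, (((dot (b s) z).re - (f₀ s).re : ℝ) : EReal) ≤ φ s z := by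
  have h := tendsto_affineFn hq hf₀ hf
  constructor <;> intro h1
  · filter_upwards [h, h1] with s h2 h3 z
    rw [← (h2 z).limsup_eq]
    exact h3 z
  · filter_upwards [h, h1] with s h2 h3 z
    rw [(h2 z).limsup_eq]
    exact h3 z

/-! ### Holomorphic extension -/

lemma eq_zero_of_re_dot {y : Cn n} (h : ∀ ζ, (dot ζ y).re = 0) : y = 0 := by
  ext j
  have h1 : ∀ c : ℂ, dot (EuclideanSpace.single j c) y = c * y j := by
    intro c
    rw [dot, Finset.sum_eq_single j (fun i _ hi => by simp [hi]) (by simp)]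
    simp
  apply Complex.ext
  · simpa [h1] using h (EuclideanSpace.single j 1)
  · simpa [h1] using h (EuclideanSpace.single j Complex.I)

/-- The real linear functional `y ↦ Re (ζ · y)`. -/
noncomputable def reDot (ζ : Cn n) : Cn n →L[ℝ] ℝ :=
  LinearMap.toContinuousLinearMap
    { toFun := fun y => (dot ζ y).re
      map_add' := fun y z => by rw [dot_add, Complex.add_re]
      map_smul' := fun c y => by
        rw [dot_real_smul, Complex.re_ofReal_mul, RingHom.id_apply, smul_eq_mul] }

lemma reDot_apply (ζ y : Cn n) : reDot ζ y = (dot ζ y).re := rfl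

lemma differentiableOn_cauchy {E : Type*} [NormedAddCommGroup E] [NormedSpace ℂ E]
    [CompleteSpace E] {β : Circle → E} (hβ : Integrable β arc) :
    DifferentiableOn ℂ (fun t => ∫ s : Circle, ((s : ℂ) / (s - t)) • β s ∂arc) disc := by
  have h1 := (hasFPowerSeriesOn_cauchy_integral (R := 1) (circleIntegrable_of_arc hβ)
    one_pos).differentiableOn
  have h2 : Metric.eball (0 : ℂ) ((1 : NNReal) : ℝ≥0∞) = disc := by
    rw [Metric.eball_coe]; rfl
  rw [h2] at h1
  refine h1.congr fun t ht => ?_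
  have hc : Continuous fun s : Circle => (s : ℂ) / (s - t) :=
    continuous_subtype_val.div (continuous_subtype_val.sub continuous_const)
      fun s => coe_sub_ne_zero ht s
  have hm : AEStronglyMeasurable (fun s : Circle => ((s : ℂ) / (s - t)) • β s) arc :=
    hc.aestronglyMeasurable.smul hβ.1
  rw [integral_arc hm, circleIntegral, ← intervalIntegral.integral_smul,
    ← intervalIntegral.integral_smul]
  refine intervalIntegral.integral_congr fun θ _ => ?_
  simp only [deriv_circleMap, NNReal.coe_one, circleMap_zero_one]
  have h3 : (Circle.exp θ : ℂ) - t ≠ 0 := coe_sub_ne_zero ht _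
  have hpi : (Real.pi : ℂ) ≠ 0 := by exact_mod_cast Real.pi_ne_zero
  rw [toCircle_coe, ← Complex.coe_smul, smul_smul, smul_smul, smul_smul]
  congr 1
  push_cast
  field_simp [Complex.I_ne_zero]

lemma norm_sub_sq_mul (t : ℂ) (s : Circle) :
    ((‖(s : ℂ) - t‖ ^ 2 : ℝ) : ℂ) * s = (s - t) * (1 - starRingEnd ℂ t * s) := by
  have h1 : starRingEnd ℂ (s : ℂ) * s = 1 := by
    rw [Complex.conj_mul', Circle.norm_coe]; simp
  have h2 := Complex.conj_mul' ((s : ℂ) - t)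
  rw [map_sub] at h2
  push_cast
  rw [← h2]
  linear_combination ((s : ℂ) - t) * h1

lemma one_sub_conj_mul_ne_zero {t : ℂ} (ht : t ∈ disc) {z : ℂ} (hz : ‖z‖ ≤ 1) :
    1 - starRingEnd ℂ t * z ≠ 0 := by
  intro h
  have h1 : starRingEnd ℂ t * z = 1 := (sub_eq_zero.1 h).symm
  have h2 : ‖t‖ * ‖z‖ = 1 := by
    rw [← RCLike.norm_conj t, ← norm_mul, h1, norm_one]
  have := mem_disc.1 ht
  nlinarith [norm_nonneg t]

/-- The polynomial factor turns harmonic measure at `t` into a multiple of `s dσ(s)`, so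
orthogonality with respect to harmonic measure can be tested against arc length. -/
lemma kernel_mul {t : ℂ} (ht : t ∈ disc) (s : Circle) :
    (1 - starRingEnd ℂ t * s) * (s - t) * kernel t s = (1 - ‖t‖ ^ 2 : ℝ) * s := by
  have h1 : ((‖(s : ℂ) - t‖ ^ 2 : ℝ) : ℂ) ≠ 0 := by
    exact_mod_cast pow_ne_zero 2 (norm_ne_zero_iff.2 (coe_sub_ne_zero ht s))
  rw [kernel_eq, Complex.ofReal_div, mul_div_assoc', div_eq_iff h1, mul_assoc _ (s : ℂ),
    mul_comm (s : ℂ), norm_sub_sq_mul]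
  ring

/-- The Poisson kernel is the Cauchy kernel plus `s` times a function of `s` in the disc algebra;
the second summand carries the dependence on the conjugate of `t`. -/
lemma kernel_eq_add {t : ℂ} (ht : t ∈ disc) (s : Circle) : (kernel t s : ℂ) =
    (s : ℂ) / (s - t) + (s : ℂ) * (starRingEnd ℂ t / (1 - starRingEnd ℂ t * s)) := by
  have h1 := one_sub_conj_mul_ne_zero ht (Circle.norm_coe s).le
  have h2 := coe_sub_ne_zero ht s
  have h3 := kernel_mul ht s
  have h4 : ((1 - ‖t‖ ^ 2 : ℝ) : ℂ) = 1 - starRingEnd ℂ t * t := by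
    rw [Complex.conj_mul']; push_cast; ring
  rw [h4] at h3
  have h5 : (kernel t s : ℂ) =
      ((1 - starRingEnd ℂ t * t) * s) / ((1 - starRingEnd ℂ t * s) * (s - t)) := by
    rw [eq_div_iff (mul_ne_zero h1 h2)]
    linear_combination h3
  rw [h5]
  field_simp
  ring

end

/-! ### The disc algebra and `hullCheck ≤ hullTilde` -/

section


variable {n : ℕ}

lemma DiffContOnCl.continuous_circle {E : Type*} [NormedAddCommGroup E] [NormedSpace ℂ E]
    {G : ℂ → E} (hG : DiffContOnCl ℂ G disc) : Continuous fun s : Circle => G s := by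
  have h1 : ContinuousOn G (Metric.closedBall 0 1) := by
    have := hG.2
    rwa [disc, closure_ball _ one_ne_zero] at this
  exact h1.comp_continuous (by fun_prop) fun s => by simpa using (Circle.norm_coe s).le

lemma exists_norm_le_of_continuous {E : Type*} [NormedAddCommGroup E] {g : Circle → E}
    (hg : Continuous g) : ∃ R, ∀ s, ‖g s‖ ≤ R := by
  obtain ⟨R, hR⟩ := (isCompact_range hg).isBounded.exists_norm_le
  exact ⟨R, fun s => hR _ ⟨s, rfl⟩⟩

lemma DiffContOnCl.mem_boundedMeasurable {G : ℂ → Cn n} (hG : DiffContOnCl ℂ G disc) :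
    (fun s : Circle => G s) ∈ boundedMeasurable Circle n :=
  ⟨(DiffContOnCl.continuous_circle hG).measurable,
    exists_norm_le_of_continuous (DiffContOnCl.continuous_circle hG)⟩

lemma DiffContOnCl.isHardy {G : ℂ → Cn n} (hG : DiffContOnCl ℂ G disc) (q : ℝ≥0∞) :
    IsHardy q G fun s : Circle => G s := by
  obtain ⟨R, hR⟩ := exists_norm_le_of_continuous (DiffContOnCl.continuous_circle hG)
  exact ⟨hG.1, MemLp.of_bound (DiffContOnCl.continuous_circle hG).aestronglyMeasurable R
    (Eventually.of_forall hR), fun t ht => (poisson_of_diffContOnCl hG ht).symm⟩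

/-- The boundary values of functions in the disc algebra. -/
def discAlgebra (n : ℕ) : Submodule ℝ (boundedMeasurable Circle n) where
  carrier := {x | ∃ G : ℂ → Cn n, DiffContOnCl ℂ G disc ∧ ∀ s : Circle, x.1 s = G s}
  add_mem' := by
    rintro x y ⟨F, hF, hx⟩ ⟨G, hG, hy⟩
    exact ⟨F + G, hF.add hG, fun s => congrArg₂ (· + ·) (hx s) (hy s)⟩
  zero_mem' := ⟨fun _ => 0, diffContOnCl_const, fun s => rfl⟩
  smul_mem' := by
    rintro c x ⟨F, hF, hx⟩
    exact ⟨c • F, hF.const_smul c, fun s => congrArg (c • ·) (hx s)⟩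

/-- A function orthogonal to the disc algebra with respect to harmonic measure at `t₀` extends
holomorphically to the disc, with value zero at `t₀`. -/
lemma differentiableOn_poisson_of_orthogonal {β : Circle → Cn n} (hβ : Integrable β arc) {t₀ : ℂ}
    (ht₀ : t₀ ∈ disc)
    (h : ∀ G : ℂ → Cn n, DiffContOnCl ℂ G disc → poisson (fun s => (dot (G s) (β s)).re) t₀ = 0) :
    DifferentiableOn ℂ (poisson β) disc ∧ poisson β t₀ = 0 := by
  constructor
  -- Orthogonality kills the antiholomorphic half of the kernel, so the Poisson integral is a Cauchy
  -- integral.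
  · refine (differentiableOn_cauchy hβ).congr fun t ht => ?_
    set H : ℂ → ℂ := fun z => starRingEnd ℂ t / (1 - starRingEnd ℂ t * z)
    have hHd : DiffContOnCl ℂ H disc := by
      refine DifferentiableOn.diffContOnCl fun z hz => ?_
      rw [disc, closure_ball _ one_ne_zero, mem_closedBall_zero_iff] at hz
      have h0 := one_sub_conj_mul_ne_zero ht hz
      have h1 : DifferentiableAt ℂ (fun z => 1 - starRingEnd ℂ t * z) z := by fun_prop
      exact ((differentiableAt_const (starRingEnd ℂ t)).fun_div h1 h0).differentiableWithinAt
    have hH : Continuous fun s : Circle => (s : ℂ) * H s :=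
      continuous_subtype_val.mul (DiffContOnCl.continuous_circle hHd)
    have hC : Continuous fun s : Circle => (s : ℂ) / (s - t) :=
      continuous_subtype_val.div (continuous_subtype_val.sub continuous_const)
        fun s => coe_sub_ne_zero ht s
    have hi1 : Integrable (fun s : Circle => ((s : ℂ) / (s - t)) • β s) arc := by
      obtain ⟨R, hR⟩ := exists_norm_le_of_continuous hC
      exact hβ.bdd_smul R hC.aestronglyMeasurable (Eventually.of_forall hR)
    have hi2 : Integrable (fun s : Circle => ((s : ℂ) * H s) • β s) arc := by
      obtain ⟨R, hR⟩ := exists_norm_le_of_continuous hH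
      exact hβ.bdd_smul R hH.aestronglyMeasurable (Eventually.of_forall hR)
    have h1 : poisson β t = ∫ s : Circle, (((s : ℂ) / (s - t)) • β s + ((s : ℂ) * H s) • β s)
        ∂arc := by
      refine integral_congr_ae (Eventually.of_forall fun s => ?_)
      simp only
      rw [← add_smul, ← kernel_eq_add ht s, Complex.coe_smul]
    rw [h1, integral_add hi1 hi2, add_eq_left]
    refine eq_zero_of_re_dot fun ζ => ?_
    rw [← reDot_apply, ← (reDot ζ).integral_comp_comm hi2]
    -- The quadratic factor is the one of `kernel_mul` at `t₀`.
    have h2 := h (fun z => ((1 - starRingEnd ℂ t₀ * z) * (z - t₀) * H z) • ζ) (by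
      refine DiffContOnCl.smul_const ?_ ζ
      refine DiffContOnCl.smul (c := fun z => (1 - starRingEnd ℂ t₀ * z) * (z - t₀)) ?_ hHd
      exact Differentiable.diffContOnCl (by fun_prop))
    have h3 : (1 - ‖t₀‖ ^ 2) * ∫ s : Circle, reDot ζ (((s : ℂ) * H s) • β s) ∂arc = 0 := by
      rw [← h2, poisson, ← integral_const_mul]
      refine integral_congr_ae (Eventually.of_forall fun s => ?_)
      simp only [reDot_apply, smul_eq_mul]
      rw [← Complex.re_ofReal_mul, ← Complex.re_ofReal_mul, dot_smul, smul_dot]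
      congr 1
      linear_combination (-(H s * dot ζ (β s))) * kernel_mul ht₀ s
    rcases mul_eq_zero.1 h3 with h4 | h4
    · have := mem_disc.1 ht₀
      nlinarith [norm_nonneg t₀]
    · exact h4
  · refine eq_zero_of_re_dot fun ζ => ?_
    rw [← reDot_apply, clm_poisson (reDot ζ) hβ ht₀]
    exact h (fun _ => ζ) diffContOnCl_const

/-- Duality under harmonic measure at `t`, with the disc algebra as the space of test functions:
disc algebra functions alone already bound the infimum. The hypothesis `hLp` upgrades the integrable
minimizer to `L^p`. -/
theorem hullCheck_le_hullTilde {p : ℝ≥0∞} {φ : Circle → Cn n → EReal}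
    (hφ : Measurable fun x : Circle × Cn n => φ x.1 x.2) {ρ B : ℝ} {K : ℝ → ℝ} (hρ : 0 < ρ)
    (htame : ∀ s, IsTame ρ B K (φ s))
    (hLp : ∀ (b : Circle → Cn n) (k : Circle → ℝ), Measurable b → Integrable k arc →
      (∀ᵐ s ∂arc, φ s (b s) = k s) → MemLp b p arc) {t : ℂ} (ht : t ∈ disc) (w : Cn n) :
    hullCheck p φ t w ≤ hullTilde p φ t w := by
  by_cases htop : hullTilde p φ t w = ⊤
  · rw [htop]; exact le_top
  have hq : 1 ≤ p.conjExponent := le_self_add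
  have hconj : ∀ G : ℂ → Cn n, DiffContOnCl ℂ G disc →
      Integrable (fun s : Circle => conj (φ s) (G s)) arc := fun G hG =>
    integrable_conj hφ hρ htame (DiffContOnCl.mem_boundedMeasurable hG)
  have hmem : ∀ G : ℂ → Cn n, DiffContOnCl ℂ G disc →
      (((dot (G t) w).re - poisson (fun s : Circle => conj (φ s) (G s)) t : ℝ) : EReal) ≤
        hullTilde p φ t w := by
    intro G hG
    have hf₀ : MemLp (fun s : Circle => (conj (φ s) (G s) : ℂ)) 1 arc :=
      memLp_one_iff_integrable.2 (hconj G hG).ofReal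
    -- For a given `G`, the conjugate is the smallest `f₀` allowed; admissibility is the
    -- Fenchel–Young inequality.
    refine le_sSup ⟨fun s => (conj (φ s) (G s) : ℂ), G, fun s => G s, hf₀,
      DiffContOnCl.isHardy hG _, ?_, by simp [affineFn]⟩
    rw [boundaryLE_affineFn_iff hq hf₀ (DiffContOnCl.isHardy hG _)]
    refine Eventually.of_forall fun s z => ?_
    rw [Complex.ofReal_re]
    exact (htame s).young hρ (G s) z
  have hbot : hullTilde p φ t w ≠ ⊥ :=
    ne_bot_of_le_ne_bot (EReal.coe_ne_bot _) (hmem (fun _ => 0) diffContOnCl_const)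
  obtain ⟨T, hT⟩ : ∃ T : ℝ, hullTilde p φ t w = T := ⟨_, (EReal.coe_toReal htop hbot).symm⟩
  rw [hT] at hmem ⊢
  have := isProbabilityMeasure_harmonicMeasure ht
  obtain ⟨b, hbm, hbi, hbN, k, hk, hφk, hkT⟩ := exists_minimizer (ν := harmonicMeasure t) hφ hρ
    htame (discAlgebra n) w (T := T) (by
      rintro x ⟨G, hG, hx⟩
      simp only [hx]
      rw [integral_harmonicMeasure ht, integral_harmonicMeasure ht]
      have h1 : poisson (fun s : Circle => (dot (G s) w).re) t = (dot (G t) w).re := by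
        have h2 := clm_poisson ((reDot w)) (integrable_of_continuous
          (DiffContOnCl.continuous_circle hG)) ht
        rw [poisson_of_diffContOnCl hG ht] at h2
        simp only [reDot_apply] at h2
        have hcomm : ∀ y z : Cn n, dot y z = dot z y := fun y z =>
          Finset.sum_congr rfl fun j _ => mul_comm _ _
        simp only [hcomm _ w]
        exact h2.symm
      rw [h1]
      exact EReal.coe_le_coe_iff.1 (hmem G hG))
  rw [integrable_harmonicMeasure_iff ht] at hbi hk
  rw [integral_harmonicMeasure ht] at hkT
  have hφk' := ae_of_ae_harmonicMeasure ht hφk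
  have hbw : Integrable (fun s => b s - w) arc := hbi.sub (integrable_const w)
  -- The prescribed moments say that `b - w` is orthogonal to the disc algebra, which gives both
  -- holomorphy and the value at `t`.
  obtain ⟨hd, h0⟩ := differentiableOn_poisson_of_orthogonal hbw ht fun G hG => by
    have h1 := hbN ⟨fun s => G s, DiffContOnCl.mem_boundedMeasurable hG⟩ ⟨G, hG, fun s => rfl⟩
    rw [integral_harmonicMeasure ht, integral_harmonicMeasure ht] at h1
    have h2 := poisson_sub (integrable_re_dot hbi (DiffContOnCl.mem_boundedMeasurable hG))
      (integrable_re_dot (integrable_const w) (DiffContOnCl.mem_boundedMeasurable hG)) ht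
    rw [h1, sub_self] at h2
    rw [← h2]
    simp only [dot_sub, Complex.sub_re]
  have hsub : ∀ τ ∈ disc, poisson b τ = poisson (fun s => b s - w) τ + w := by
    intro τ hτ
    rw [poisson_sub hbi (integrable_const w) hτ, poisson_const w hτ, sub_add_cancel]
  have hb : IsHardy p (poisson b) b :=
    ⟨(hd.add_const w).congr hsub, hLp b k hbm hk hφk', fun τ _ => rfl⟩
  have hle : hullCheck p φ t w ≤ poissonExt (fun s => φ s (b s)) t :=
    sInf_le ⟨poisson b, b, hb, by rw [hsub t ht, h0, zero_add], rfl⟩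
  rw [poissonExt_eq hk hφk' ht] at hle
  exact hle.trans (EReal.coe_le_coe_iff.2 hkT)

end

/-! ### Plurisubharmonicity and upper bound of the affine functions -/

section


variable {n : ℕ}

lemma differentiableAt_dot {F G : ℂ → Cn n} {z : ℂ} (hF : DifferentiableAt ℂ F z)
    (hG : DifferentiableAt ℂ G z) : DifferentiableAt ℂ (fun z => dot (F z) (G z)) z := by
  refine DifferentiableAt.fun_sum fun j _ => ?_
  exact ((EuclideanSpace.proj j : Cn n →L[ℂ] ℂ).differentiableAt.comp z hF).fun_mul
    ((EuclideanSpace.proj j : Cn n →L[ℂ] ℂ).differentiableAt.comp z hG)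

/-- Writing the Poisson integral as the real part of a holomorphic function, the restriction to any
complex disc is harmonic and satisfies the mean value equality. -/
lemma isPSH_affineFn {f₀ : Circle → ℂ} (hf₀ : MemLp f₀ 1 arc) {f : ℂ → Cn n}
    (hf : DifferentiableOn ℂ f disc) : IsPSH (cylinder n) (affineFn f₀ f) := by
  have hi : Integrable (fun s => (f₀ s).re) arc := (hf₀.integrable le_rfl).re
  constructor
  · refine ContinuousOn.upperSemicontinuousOn fun x hx => ?_
    have hfst : Tendsto (fun x : ℂ × Cn n => x.1) (𝓝[cylinder n] x) (𝓝[disc] x.1) :=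
      tendsto_nhdsWithin_iff.2 ⟨continuous_fst.continuousWithinAt,
        eventually_nhdsWithin_of_forall fun y hy => hy.1⟩
    have h1 : Tendsto (fun y : ℂ × Cn n => f y.1) (𝓝[cylinder n] x) (𝓝 (f x.1)) :=
      Tendsto.comp (hf.continuousOn x.1 hx.1) hfst
    have h2 : Tendsto (fun y : ℂ × Cn n => poisson (fun s => (f₀ s).re) y.1) (𝓝[cylinder n] x)
        (𝓝 (poisson (fun s => (f₀ s).re) x.1)) := by
      have h0 : Tendsto (fun t => poisson (fun s => (f₀ s).re) t) (𝓝[disc] x.1)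
        (𝓝 (poisson (fun s => (f₀ s).re) x.1)) := continuousOn_poisson hi x.1 hx.1
      exact h0.comp hfst
    have h3 : Tendsto (fun y : ℂ × Cn n => y.2) (𝓝[cylinder n] x) (𝓝 x.2) :=
      continuous_snd.continuousWithinAt
    exact (tendsto_re_dot h1 h3).sub h2
  · intro a v hav
    obtain ⟨G, hG, hGP⟩ := exists_re_eq_poisson hi
    have hin : ∀ ζ : ℂ, ‖ζ‖ ≤ 1 → a.1 + ζ * v.1 ∈ disc := fun ζ hζ => (hav ζ hζ).1
    set H : ℂ → ℂ := fun ζ => dot (f (a.1 + ζ * v.1)) (a.2 + ζ • v.2) - G (a.1 + ζ * v.1)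
    have hH : DiffContOnCl ℂ H disc := by
      refine DifferentiableOn.diffContOnCl fun z hz => ?_
      rw [disc, closure_ball _ one_ne_zero, mem_closedBall_zero_iff] at hz
      have hn := isOpen_disc.mem_nhds (hin z hz)
      have hl : DifferentiableAt ℂ (fun ζ : ℂ => a.1 + ζ * v.1) z := by fun_prop
      have h1 : DifferentiableAt ℂ (fun ζ : ℂ => f (a.1 + ζ * v.1)) z :=
        DifferentiableAt.comp z (hf.differentiableAt hn) hl
      have h2 : DifferentiableAt ℂ (fun ζ : ℂ => G (a.1 + ζ * v.1)) z :=
        DifferentiableAt.comp z (hG.differentiableAt hn) hl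
      have h3 : DifferentiableAt ℂ (fun ζ : ℂ => a.2 + ζ • v.2) z := by fun_prop
      exact ((differentiableAt_dot h1 h3).fun_sub h2).differentiableWithinAt
    have heq : ∀ ζ : ℂ, ‖ζ‖ ≤ 1 → affineFn f₀ f (a + ζ • v) = (H ζ).re := by
      intro ζ hζ
      change (dot (f (a.1 + ζ * v.1)) (a.2 + ζ • v.2)).re - poisson _ (a.1 + ζ * v.1) = _
      rw [hGP _ (hin ζ hζ), ← Complex.sub_re]
    have hsph : Set.EqOn (fun ζ => (H ζ).re) (fun ζ => affineFn f₀ f (a + ζ • v))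
        (Metric.sphere 0 |1|) := fun ζ hζ => by
      rw [abs_one, mem_sphere_zero_iff_norm] at hζ
      exact (heq ζ hζ.le).symm
    obtain ⟨h1, h2⟩ := re_circleAverage hH
    refine ⟨(circleIntegrable_congr (fun ζ hζ => hsph (by simpa using hζ))).1 h1, ?_⟩
    rw [← Real.circleAverage_congr_sphere hsph, h2, ← heq 0 (by simp)]
    simp

lemma affineFn_eq_poisson {q : ℝ≥0∞} (hq : 1 ≤ q) {f₀ : Circle → ℂ} (hf₀ : MemLp f₀ 1 arc)
    {f : ℂ → Cn n} {b : Circle → Cn n} (hf : IsHardy q f b) {t : ℂ} (ht : t ∈ disc) (w : Cn n) :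
    Integrable (fun s => (dot (b s) w).re - (f₀ s).re) arc ∧
      affineFn f₀ f (t, w) = poisson (fun s => (dot (b s) w).re - (f₀ s).re) t := by
  have hi : Integrable (fun s => (f₀ s).re) arc := (hf₀.integrable le_rfl).re
  have hcomm : ∀ y z : Cn n, dot y z = dot z y := fun y z =>
    Finset.sum_congr rfl fun j _ => mul_comm _ _
  have hb : Integrable (fun s => (dot (b s) w).re) arc := by
    simp only [hcomm _ w]
    exact (reDot w).integrable_comp (hf.integrable hq)
  refine ⟨hb.sub hi, ?_⟩
  rw [poisson_sub hb hi ht, affineFn, hf.eq_poisson t ht]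
  simp only [hcomm _ w]
  congr 1
  exact clm_poisson (reDot w) (hf.integrable hq) ht

/-- For fixed `w` the function is the Poisson integral of its boundary values, and these are at most
`φ(s, w)`. -/
lemma affineFn_le_fiberSup {q : ℝ≥0∞} (hq : 1 ≤ q) {φ : Circle → Cn n → EReal}
    (hbot : ∀ s w, φ s w ≠ ⊥) {f₀ : Circle → ℂ} (hf₀ : MemLp f₀ 1 arc)
    {f : ℂ → Cn n} {b : Circle → Cn n} (hf : IsHardy q f b) (hL : BoundaryLE (affineFn f₀ f) φ)
    {t : ℂ} (ht : t ∈ disc) (w : Cn n) : (affineFn f₀ f (t, w) : EReal) ≤ fiberSup φ w := by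
  rw [boundaryLE_affineFn_iff hq hf₀ hf] at hL
  by_cases htop : fiberSup φ w = ⊤
  · rw [htop]; exact le_top
  have hle : ∀ s, φ s w ≤ fiberSup φ w := fun s => le_iSup (fun s => φ s w) s
  obtain ⟨m, hm⟩ : ∃ m : ℝ, fiberSup φ w = m :=
    ⟨_, (EReal.coe_toReal htop (ne_bot_of_le_ne_bot (hbot 1 w) (hle 1))).symm⟩
  rw [hm] at hle ⊢
  obtain ⟨hi, heq⟩ := affineFn_eq_poisson hq hf₀ hf ht w
  rw [EReal.coe_le_coe_iff, heq, ← poisson_const_real m ht]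
  refine poisson_mono hi (integrable_const m) ?_ ht
  filter_upwards [hL] with s hs
  exact EReal.coe_le_coe_iff.1 ((hs w).trans (hle s))

theorem hullTilde_le_hullHat {p : ℝ≥0∞} {φ : Circle → Cn n → EReal}
    (hbot : ∀ s w, φ s w ≠ ⊥) {t : ℂ} (w : Cn n) : hullTilde p φ t w ≤ hullHat φ t w := by
  refine sSup_le_sSup ?_
  rintro _ ⟨f₀, f, b, hf₀, hf, hL, rfl⟩
  exact ⟨affineFn f₀ f, isPSH_affineFn hf₀ hf.holo,
    fun y hy => affineFn_le_fiberSup le_self_add hbot hf₀ hf hL hy.1 y.2, hL, rfl⟩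

/-! ### Growth conditions -/

lemma exists_linear_le_rpow {c p : ℝ} (hc : 0 < c) (hp : 1 < p) (R : ℝ) :
    ∃ K : ℝ, ∀ x : ℝ, 0 ≤ x → R * x ≤ c * x ^ p + K := by
  -- Beyond `M` one has `c x^(p-1) ≥ |R|`; before it the linear term is at most `|R| M`.
  set M := (|R| / c) ^ (1 / (p - 1))
  have hM : 0 ≤ M := by positivity
  refine ⟨|R| * M, fun x hx => ?_⟩
  have hRx : R * x ≤ |R| * x := mul_le_mul_of_nonneg_right (le_abs_self R) hx
  have hxp : 0 ≤ c * x ^ p := by positivity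
  rcases le_total x M with h | h
  · have := mul_le_mul_of_nonneg_left h (abs_nonneg R)
    linarith
  · have h1 : |R| / c ≤ x ^ (p - 1) := by
      have h2 := Real.rpow_le_rpow hM h (show 0 ≤ p - 1 by linarith)
      rwa [← Real.rpow_mul (by positivity), one_div_mul_cancel (by linarith), Real.rpow_one] at h2
    rw [div_le_iff₀ hc] at h1
    have h3 : x ^ (p - 1) * x = x ^ p := by
      rcases hx.eq_or_lt with h0 | h0
      · rw [← h0, mul_zero, Real.zero_rpow (by linarith)]
      · rw [← Real.rpow_add_one h0.ne']; congr 1; ring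
    have h4 := mul_le_mul_of_nonneg_right h1 hx
    have h5 : x ^ (p - 1) * c * x = c * x ^ p := by rw [← h3]; ring
    have : 0 ≤ |R| * M := by positivity
    linarith

/-- `K` is chosen before `g`, hence uniformly in `s`. Lower semicontinuity is automatic, since a
finite convex function on `ℂⁿ` is continuous. -/
lemma isTame_of_rpow_growth {p c C A : ℝ} (hp : 1 < p) (hc : 0 < c) (hC : 0 < C) :
    ∃ K : ℝ → ℝ, ∀ g : Cn n → EReal, IsConvexFn g →
      (∀ w, ((c * ‖w‖ ^ p - A : ℝ) : EReal) ≤ g w) →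
      (∀ w, g w ≤ ((C * ‖w‖ ^ p + A : ℝ) : EReal)) → IsTame 1 (C + A) K g := by
  choose K hK using fun R => exists_linear_le_rpow hc hp R
  refine ⟨fun R => K R + A, fun g hg hlow hup => ⟨hg, ?_, fun w hw => (hup w).trans ?_,
    fun R w => le_trans ?_ (hlow w)⟩⟩
  · have hfin : ∀ w, g w < ⊤ := fun w => (hup w).trans_lt (EReal.coe_lt_top _)
    have h1 : {w | g w < ⊤} = Set.univ := Set.eq_univ_of_forall hfin
    have h2 := hg.2
    rw [h1] at h2
    have h3 : Continuous fun w => (g w).toReal := continuousOn_univ.1 (h2.continuousOn isOpen_univ)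
    have h4 : g = fun w => (((g w).toReal : ℝ) : EReal) :=
      funext fun w => (EReal.coe_toReal (hfin w).ne (hg.1 w)).symm
    rw [h4]
    exact (continuous_coe_real_ereal.comp h3).lowerSemicontinuous
  · rw [EReal.coe_le_coe_iff]
    have : ‖w‖ ^ p ≤ 1 := Real.rpow_le_one (norm_nonneg w) hw (by linarith)
    nlinarith
  · rw [EReal.coe_le_coe_iff]
    linarith [hK R ‖w‖ (norm_nonneg w)]

lemma chi_of_le {x : ℝ} (hx : x ≤ 1) : chi x = 0 := if_pos hx

lemma chi_of_lt {x : ℝ} (hx : 1 < x) : chi x = ⊤ := if_neg (not_le.2 hx)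

lemma norm_le_of_chi_growth {c A : ℝ} (hc : 0 < c) {w : Cn n} {x : EReal}
    (hlow : chi (c * ‖w‖) - (A : EReal) ≤ x) (hx : x ≠ ⊤) : ‖w‖ ≤ 1 / c := by
  by_contra hcon
  rw [not_le, div_lt_iff₀' hc] at hcon
  rw [chi_of_lt hcon, EReal.top_sub_coe, top_le_iff] at hlow
  exact hx hlow

lemma neg_le_of_chi_growth {c A : ℝ} {w : Cn n} {x : EReal}
    (hlow : chi (c * ‖w‖) - (A : EReal) ≤ x) : ((-A : ℝ) : EReal) ≤ x := by
  refine le_trans ?_ hlow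
  rcases le_or_gt (c * ‖w‖) 1 with h | h
  · rw [chi_of_le h, zero_sub, EReal.coe_neg]
  · rw [chi_of_lt h, EReal.top_sub_coe]; exact le_top

lemma le_of_chi_growth {C A : ℝ} (hC : 0 < C) {w : Cn n} {x : EReal}
    (hup : x ≤ chi (C * ‖w‖) + (A : EReal)) (hw : ‖w‖ ≤ 1 / C) : x ≤ A := by
  rwa [chi_of_le ((le_div_iff₀' hC).1 hw), zero_add] at hup

lemma isTame_of_chi_growth {c C A : ℝ} (hc : 0 < c) (hC : 0 < C) {g : Cn n → EReal}
    (hg : IsConvexFn g) (hlsc : LowerSemicontinuous g)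
    (hlow : ∀ w, chi (c * ‖w‖) - (A : EReal) ≤ g w)
    (hup : ∀ w, g w ≤ chi (C * ‖w‖) + (A : EReal)) :
    IsTame (1 / C) A (fun R => |R| / c + A) g := by
  refine ⟨hg, hlsc, fun w hw => le_of_chi_growth hC (hup w) hw, fun R w => ?_⟩
  by_cases hx : g w = ⊤
  · rw [hx]; exact le_top
  refine le_trans (EReal.coe_le_coe_iff.2 ?_) (neg_le_of_chi_growth (hlow w))
  have h1 := norm_le_of_chi_growth hc (hlow w) hx
  have h2 := mul_le_mul_of_nonneg_right (le_abs_self R) (norm_nonneg w)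
  have h3 := mul_le_mul_of_nonneg_left h1 (abs_nonneg R)
  rw [mul_one_div] at h3
  linarith

/-- The growth from above enters `hullHat ≤ hullCheck`; the growth from below provides coercivity
and places the minimizer in `L^p`. -/
theorem hulls_eq {p : ℝ≥0∞} (hp : 1 < p) {φ : Circle → Cn n → EReal}
    (hmeas : Measurable (fun x : Circle × Cn n => φ x.1 x.2)) (hconv : ∀ s, IsConvexFn (φ s))
    (hgrowth : UniformGrowth p φ) {t : ℂ} (ht : t ∈ disc) (w : Cn n) :
    hullTilde p φ t w = hullHat φ t w ∧ hullHat φ t w = hullCheck p φ t w := by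
  obtain ⟨⟨c, C, A, hc, hC, hA, hg⟩, hlsc⟩ := hgrowth
  have h1 : hullTilde p φ t w ≤ hullHat φ t w := hullTilde_le_hullHat (fun s => (hconv s).1) w
  suffices hullHat φ t w ≤ hullCheck p φ t w ∧ hullCheck p φ t w ≤ hullTilde p φ t w from
    ⟨le_antisymm h1 (this.1.trans this.2), le_antisymm this.1 (this.2.trans h1)⟩
  by_cases hp' : p = ∞
  · subst hp'
    have hlow : ∀ s w, chi (c * ‖w‖) - (A : EReal) ≤ φ s w := fun s w => ((hg s w).2 rfl).1
    have hup : ∀ s w, φ s w ≤ chi (C * ‖w‖) + (A : EReal) := fun s w => ((hg s w).2 rfl).2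
    constructor
    · refine sSup_le ?_
      rintro _ ⟨ψ, hψ, hμ, hψφ, rfl⟩
      refine le_sInf ?_
      rintro _ ⟨f, b, hf, rfl, rfl⟩
      exact psh_le_poissonExt_of_bounded_domain hmeas hconv (δ₀ := 1 / C) (A := A) (by positivity)
        (fun s w => neg_le_of_chi_growth (hlow s w))
        (fun s w hw => le_of_chi_growth hC (hup s w) hw) hψ hμ hψφ hf ht
    · refine hullCheck_le_hullTilde hmeas (ρ := 1 / C) (by positivity)
        (fun s => isTame_of_chi_growth hc hC (hconv s) (hlsc rfl s) (hlow s) (hup s))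
        (fun b k hb hk hφk => ?_) ht w
      refine MemLp.of_bound hb.aestronglyMeasurable (1 / c) ?_
      filter_upwards [hφk] with s hs
      exact norm_le_of_chi_growth hc (hlow s (b s)) (by rw [hs]; exact EReal.coe_ne_top _)
  · have hp1 : 1 < p.toReal := by
      simpa using (ENNReal.toReal_lt_toReal ENNReal.one_ne_top hp').2 hp
    have hlow : ∀ s w, ((c * ‖w‖ ^ p.toReal - A : ℝ) : EReal) ≤ φ s w := fun s w =>
      ((hg s w).1 hp').1
    have hup : ∀ s w, φ s w ≤ ((C * ‖w‖ ^ p.toReal + A : ℝ) : EReal) := fun s w =>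
      ((hg s w).1 hp').2
    constructor
    · refine sSup_le ?_
      rintro _ ⟨ψ, hψ, hμ, hψφ, rfl⟩
      refine le_sInf ?_
      rintro _ ⟨f, b, hf, rfl, rfl⟩
      refine psh_le_poissonExt_of_rpow_growth hp.le hp' hmeas hC (fun s w => le_trans
        (EReal.coe_le_coe_iff.2 ?_) (hlow s w)) hup hψ hμ hψφ hf ht
      have : 0 ≤ c * ‖w‖ ^ p.toReal := by positivity
      linarith
    · obtain ⟨K, hK⟩ := isTame_of_rpow_growth (n := n) (A := A) hp1 hc hC
      refine hullCheck_le_hullTilde hmeas one_pos (fun s => hK (φ s) (hconv s) (hlow s) (hup s))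
        (fun b k hb hk hφk => ?_) ht w
      rw [← integrable_norm_rpow_iff hb.aestronglyMeasurable (by positivity) hp']
      refine ((hk.add (integrable_const A)).div_const c).mono'
        (hb.norm.pow_const _).aestronglyMeasurable ?_
      filter_upwards [hφk] with s hs
      have h2 := hlow s (b s)
      rw [hs, EReal.coe_le_coe_iff] at h2
      rw [Real.norm_of_nonneg (by positivity), le_div_iff₀ hc]
      change _ ≤ k s + A
      linarith

end

/-! ### Regularity of the common value for finite `p` -/

section


variable {n : ℕ}

lemma poissonExt_le {h : Circle → EReal} {v : Circle → ℝ} (hv : Integrable v arc)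
    (hle : ∀ᵐ s ∂arc, h s ≤ v s) {t : ℂ} (ht : t ∈ disc) :
    poissonExt h t ≤ ((poisson v t : ℝ) : EReal) := by
  rw [← poissonExt_eq (h := fun s => (v s : EReal)) hv (Eventually.of_forall fun s => rfl) ht]
  refine EReal.sub_le_sub ?_ ?_
  · rw [EReal.coe_ennreal_le_coe_ennreal_iff]
    refine lintegral_mono_ae ?_
    filter_upwards [hle] with s hs
    gcongr
    exact EReal.toENNReal_le_toENNReal hs
  · rw [EReal.coe_ennreal_le_coe_ennreal_iff]
    refine lintegral_mono_ae ?_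
    filter_upwards [hle] with s hs
    gcongr
    exact EReal.toENNReal_le_toENNReal (EReal.neg_le_neg_iff.2 hs)

/-- `w` divides the segment from `d` to `d + δ⁻¹(w - d)`, whose far end is within distance 1 of `d`.
-/
lemma IsConvexFn.le_near {g : Cn n → EReal} (hg : IsConvexFn g) {d w : Cn n} {a M δ : ℝ}
    (hδ : δ ∈ Set.Ioc (0 : ℝ) 1) (hw : ‖w - d‖ ≤ δ) (ha : g d ≤ a)
    (hM : ∀ y, ‖y‖ ≤ ‖d‖ + 1 → g y ≤ M) : g w ≤ (((1 - δ) * a + δ * M : ℝ) : EReal) := by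
  have h1 : w = (1 - δ) • d + (1 - (1 - δ)) • (d + δ⁻¹ • (w - d)) := by
    rw [sub_sub_cancel, smul_add, smul_inv_smul₀ hδ.1.ne', ← add_assoc, ← add_smul,
      sub_add_cancel, one_smul, add_sub_cancel]
  have h2 := hg.le_combo ha (hM (d + δ⁻¹ • (w - d)) (norm_add_le_of_le le_rfl (by
    rw [norm_smul, Real.norm_of_nonneg (inv_nonneg.2 hδ.1.le), inv_mul_le_iff₀ hδ.1, mul_one]
    exact hw))) (ρ := 1 - δ) ⟨by linarith [hδ.2], by linarith [hδ.1]⟩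
  rw [← h1, sub_sub_cancel] at h2
  exact h2

lemma hullCheck_le_poisson {p : ℝ≥0∞} {φ : Circle → Cn n → EReal} {f : ℂ → Cn n}
    {b : Circle → Cn n} (hf : IsHardy p f b) {v : Circle → ℝ} (hv : Integrable v arc)
    (hle : ∀ᵐ s ∂arc, φ s (b s) ≤ v s) {t : ℂ} (ht : t ∈ disc) :
    hullCheck p φ t (f t) ≤ ((poisson v t : ℝ) : EReal) :=
  le_trans (sInf_le ⟨f, b, hf, rfl, rfl⟩) (poissonExt_le hv hle ht)

lemma isHardy_const (p : ℝ≥0∞) (c : Cn n) : IsHardy p (fun _ => c) fun _ => c :=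
  DiffContOnCl.isHardy diffContOnCl_const p

lemma IsHardy.add_const {p : ℝ≥0∞} (hp : 1 ≤ p) {f : ℂ → Cn n} {b : Circle → Cn n}
    (hf : IsHardy p f b) (c : Cn n) : IsHardy p (fun t => f t + c) fun s => b s + c := by
  refine ⟨hf.holo.add_const c, hf.memLp.add (memLp_const c), fun t ht => ?_⟩
  rw [poisson_add (hf.integrable hp) (integrable_const c) ht, poisson_const c ht,
    hf.eq_poisson t ht]

section Finite

variable {p : ℝ≥0∞} {φ : Circle → Cn n → EReal} {C A : ℝ} {u : ℂ × Cn n → ℝ}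

/-- A nearly optimal `f` at `(t, w)` is translated by the constant `ω - f(τ)` to compete at `(τ,
ω)`. Convexity bounds the cost by `(1 - δ) k + δ v`, whose Poisson integral is continuous in `τ`. -/
lemma upperSemicontinuousOn_of_eq_hullCheck (hp : 1 ≤ p) (hp' : p ≠ ∞)
    (hmeas : Measurable (fun x : Circle × Cn n => φ x.1 x.2)) (hconv : ∀ s, IsConvexFn (φ s))
    (hC : 0 ≤ C) (hlow : ∀ s w, ((-A : ℝ) : EReal) ≤ φ s w)
    (hup : ∀ s w, φ s w ≤ ((C * ‖w‖ ^ p.toReal + A : ℝ) : EReal))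
    (hu : ∀ t ∈ disc, ∀ w, (u (t, w) : EReal) = hullCheck p φ t w) :
    UpperSemicontinuousOn u (cylinder n) := by
  have hp1 : 1 ≤ p.toReal := by simpa using ENNReal.toReal_mono hp' hp
  rintro ⟨t, w⟩ ⟨ht : t ∈ disc, -⟩ c hc
  have h1 : hullCheck p φ t w < c := by rw [← hu t ht]; exact EReal.coe_lt_coe_iff.2 hc
  obtain ⟨_, ⟨f, b, hf, hfw, rfl⟩, h2⟩ := sInf_lt_iff.1 h1
  obtain ⟨k, hk, hφk⟩ := exists_integrable_of_poissonExt_ne_top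
    (aemeasurable_comp_boundary hmeas hf.memLp.1) (fun s => hlow s (b s)) ht
    (h2.trans (EReal.coe_lt_top _)).ne
  rw [poissonExt_eq hk hφk ht, EReal.coe_lt_coe_iff] at h2
  set v : Circle → ℝ := fun s => C * (‖b s‖ + 1) ^ p.toReal + A
  have hv : Integrable v arc := by
    have h3 : MemLp (fun s => ‖b s‖ + 1) p arc := hf.memLp.norm.add (memLp_const 1)
    have h4 := h3.integrable_norm_rpow (by positivity) hp'
    refine ((h4.congr (Eventually.of_forall fun s => ?_)).const_mul C).add (integrable_const A)
    simp only
    rw [Real.norm_of_nonneg (by positivity)]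
  have hdom : ∀ δ ∈ Set.Ioc (0 : ℝ) 1, ∀ τ ∈ disc, ∀ ω, ‖ω - f τ‖ ≤ δ →
      u (τ, ω) ≤ (1 - δ) * poisson k τ + δ * poisson v τ := by
    intro δ hδ τ hτ ω hω
    have hi1 := hk.const_mul (1 - δ)
    have hi2 := hv.const_mul δ
    have h3 := hullCheck_le_poisson (φ := φ) (hf.add_const hp (ω - f τ)) (hi1.add hi2) (by
      filter_upwards [hφk] with s hs
      refine (hconv s).le_near hδ (by rwa [add_sub_cancel_left]) hs.le fun y hy =>
        (hup s y).trans (EReal.coe_le_coe_iff.2 ?_)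
      simp only [v]
      gcongr) hτ
    rw [add_sub_cancel, ← hu τ hτ, EReal.coe_le_coe_iff] at h3
    refine h3.trans (le_of_eq ?_)
    have h4 := poisson_add hi1 hi2 hτ
    rw [poisson_const_mul, poisson_const_mul] at h4
    exact h4
  have hδ : ∀ᶠ δ : ℝ in 𝓝[>] 0, (1 - δ) * poisson k t + δ * poisson v t < c := by
    have h3 : Continuous fun δ : ℝ => (1 - δ) * poisson k t + δ * poisson v t := by fun_prop
    refine (h3.tendsto 0).mono_left nhdsWithin_le_nhds |>.eventually (gt_mem_nhds ?_)
    simpa using h2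
  obtain ⟨δ, hδc, hδI⟩ := (hδ.and (Ioc_mem_nhdsGT (zero_lt_one' ℝ))).exists
  have hfst : Tendsto (fun x : ℂ × Cn n => x.1) (𝓝[cylinder n] (t, w)) (𝓝 t) :=
    (continuous_fst.tendsto (t, w)).mono_left nhdsWithin_le_nhds
  have hsnd : Tendsto (fun x : ℂ × Cn n => x.2) (𝓝[cylinder n] (t, w)) (𝓝 w) :=
    (continuous_snd.tendsto (t, w)).mono_left nhdsWithin_le_nhds
  have hnd := isOpen_disc.mem_nhds ht
  have c1 : Tendsto (fun x : ℂ × Cn n => x.2 - f x.1) (𝓝[cylinder n] (t, w)) (𝓝 (w - f t)) :=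
    hsnd.sub ((hf.holo.continuousOn.continuousAt hnd).tendsto.comp hfst)
  have c2 : Tendsto (fun τ => (1 - δ) * poisson k τ + δ * poisson v τ) (𝓝 t)
      (𝓝 ((1 - δ) * poisson k t + δ * poisson v t)) :=
    (((continuousOn_poisson hk).continuousAt hnd).tendsto.const_mul _).add
      (((continuousOn_poisson hv).continuousAt hnd).tendsto.const_mul _)
  rw [hfw, sub_self] at c1
  have c3 := c1.norm
  rw [norm_zero] at c3
  filter_upwards [c3.eventually (gt_mem_nhds hδI.1), hfst.eventually (c2.eventually (gt_mem_nhds hδc)),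
    self_mem_nhdsWithin] with x hx1 hx2 hx3
  exact (hdom δ hδI x.1 hx3.1 x.2 hx1.le).trans_lt hx2

/-- The sub-mean value inequality passes to suprema; semicontinuity does not and is supplied
separately. The growth bounds make the circle integrals finite. -/
lemma isPSH_of_isLUB (husc : UpperSemicontinuousOn u (cylinder n)) {C A p : ℝ} (hp : 0 ≤ p)
    (hC : 0 ≤ C) (hlow : ∀ x ∈ cylinder n, -A ≤ u x)
    (hup : ∀ x ∈ cylinder n, u x ≤ C * ‖x.2‖ ^ p + A)
    (hsup : ∀ x ∈ cylinder n, ∀ c < u x, ∃ L : ℂ × Cn n → ℝ, IsPSH (cylinder n) L ∧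
      (∀ y ∈ cylinder n, L y ≤ u y) ∧ c < L x) : IsPSH (cylinder n) u := by
  refine ⟨husc, fun a v hav => ?_⟩
  have hin : ∀ θ : ℝ, a + circleMap 0 1 θ • v ∈ cylinder n := fun θ => hav _ (by simp)
  have hcont : Continuous fun θ : ℝ => a + circleMap 0 1 θ • v := by fun_prop
  have hci : CircleIntegrable (fun ζ : ℂ => u (a + ζ • v)) 0 1 := by
    have hus : UpperSemicontinuous fun θ : ℝ => u (a + circleMap 0 1 θ • v) := by
      intro θ c hc
      have h1 := husc _ (hin θ) c hc
      have h2 : Tendsto (fun θ : ℝ => a + circleMap 0 1 θ • v) (𝓝 θ)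
          (𝓝[cylinder n] (a + circleMap 0 1 θ • v)) :=
        tendsto_nhdsWithin_iff.2 ⟨hcont.tendsto θ, Eventually.of_forall hin⟩
      exact h2.eventually h1
    rw [CircleIntegrable, intervalIntegrable_iff_integrableOn_Ioc_of_le (by positivity)]
    refine Measure.integrableOn_of_bounded (M := C * (‖a.2‖ + ‖v.2‖) ^ p + |A|) measure_Ioc_lt_top.ne
      hus.measurable.aestronglyMeasurable (Eventually.of_forall fun θ => ?_)
    have h1 := hlow _ (hin θ)
    have h2 := hup _ (hin θ)
    have h3 : ‖(a + circleMap 0 1 θ • v).2‖ ≤ ‖a.2‖ + ‖v.2‖ := by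
      refine norm_add_le_of_le le_rfl ?_
      change ‖circleMap 0 1 θ • v.2‖ ≤ ‖v.2‖
      rw [norm_smul]; simp
    have h4 : C * ‖(a + circleMap 0 1 θ • v).2‖ ^ p ≤ C * (‖a.2‖ + ‖v.2‖) ^ p := by gcongr
    have h5 : 0 ≤ C * (‖a.2‖ + ‖v.2‖) ^ p := by positivity
    rw [Real.norm_eq_abs, abs_le]
    constructor <;> linarith [le_abs_self A, neg_abs_le A]
  refine ⟨hci, le_of_forall_lt fun c hc => ?_⟩
  obtain ⟨L, hL, hLu, hcL⟩ := hsup a (by simpa using hav 0 (by simp)) c hc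
  obtain ⟨h1, h2⟩ := hL.2 a v hav
  refine hcL.trans_le (h2.trans (Real.circleAverage_mono h1 hci fun ζ hζ => hLu _ (hav ζ ?_)))
  simpa using (mem_sphere_zero_iff_norm.1 hζ).le

/-- Constant competitors bound `u(t, w)` by the Poisson integral of `φ(·, w)`. Fatou's theorem is
invoked for countably many `w` only, to have one exceptional null set; convexity interpolates. -/
lemma boundaryLE_of_eq_hullCheck
    (hmeas : Measurable (fun x : Circle × Cn n => φ x.1 x.2)) (hconv : ∀ s, IsConvexFn (φ s))
    (hC : 0 ≤ C) (hlow : ∀ s w, ((-A : ℝ) : EReal) ≤ φ s w)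
    (hup : ∀ s w, φ s w ≤ ((C * ‖w‖ ^ p.toReal + A : ℝ) : EReal))
    (hu : ∀ t ∈ disc, ∀ w, (u (t, w) : EReal) = hullCheck p φ t w) :
    BoundaryLE u φ := by
  have hreal : ∀ s w, ((φ s w).toReal : EReal) = φ s w := fun s w =>
    EReal.coe_toReal ((hup s w).trans_lt (EReal.coe_lt_top _)).ne ((hconv s).1 w)
  set k : Cn n → Circle → ℝ := fun w s => (φ s w).toReal
  have hk : ∀ w, Integrable (k w) arc := by
    intro w
    refine Integrable.of_bound (C := C * ‖w‖ ^ p.toReal + |A|)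
      (Measurable.ereal_toReal (hmeas.comp (measurable_id.prodMk measurable_const))).aestronglyMeasurable
      (Eventually.of_forall fun s => ?_)
    have h1 := hlow s w
    have h2 := hup s w
    rw [← hreal, EReal.coe_le_coe_iff] at h1 h2
    have h3 : 0 ≤ C * ‖w‖ ^ p.toReal := by positivity
    rw [Real.norm_eq_abs, abs_le]
    constructor <;> simp only [k] <;> linarith [le_abs_self A, neg_abs_le A]
  set d := TopologicalSpace.denseSeq (Cn n)
  filter_upwards [ae_all_iff.2 fun i => ae_tendsto_poisson (hk (d i))] with s hs z
  rw [← EReal.le_of_forall_lt_iff_le]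
  intro c hc
  set M := C * (‖z‖ + 2) ^ p.toReal + A
  have hM : ∀ s' e, ‖e - z‖ ≤ 1 → ∀ y, ‖y‖ ≤ ‖e‖ + 1 → φ s' y ≤ M := by
    intro s' e he y hy
    refine (hup s' y).trans (EReal.coe_le_coe_iff.2 ?_)
    have : ‖y‖ ≤ ‖z‖ + 2 := by
      have := norm_add_le_of_le he (le_refl ‖z‖)
      rw [sub_add_cancel] at this
      linarith
    simp only [M]
    gcongr
  -- `IsConvexFn.le_near` is used twice, from `z` to the dense point and from there to the variable
  -- point, hence the nested expression.
  have hδ : ∀ᶠ δ : ℝ in 𝓝[>] 0, (1 - δ) * ((1 - δ) * k z s + δ * M) + δ * M < c := by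
    have h3 : Continuous fun δ : ℝ => (1 - δ) * ((1 - δ) * k z s + δ * M) + δ * M := by fun_prop
    refine (h3.tendsto 0).mono_left nhdsWithin_le_nhds |>.eventually (gt_mem_nhds ?_)
    rw [← hreal, EReal.coe_lt_coe_iff] at hc
    simpa using hc
  obtain ⟨δ, hδc, hδI⟩ := (hδ.and (Ioc_mem_nhdsGT (zero_lt_one' ℝ))).exists
  obtain ⟨i, hi⟩ := exists_denseSeq_mem (Metric.isOpen_ball (x := z) (ε := δ))
    ⟨z, Metric.mem_ball_self hδI.1⟩
  rw [mem_ball_iff_norm] at hi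
  have hdz : ‖d i - z‖ ≤ 1 := hi.le.trans hδI.2
  have hki : k (d i) s ≤ (1 - δ) * k z s + δ * M := by
    have := (hconv s).le_near hδI hi.le (hreal s z).ge (hM s z (by simp))
    rwa [← hreal, EReal.coe_le_coe_iff] at this
  have hlim : Tendsto (fun r : ℝ => (1 - δ) * poisson (k (d i)) ((r : ℂ) * s) + δ * M)
      (𝓝[Set.Ioo 0 1] 1) (𝓝 ((1 - δ) * k (d i) s + δ * M)) :=
    ((hs i).const_mul _).add_const _
  have hlt : (1 - δ) * k (d i) s + δ * M < c := by
    have := mul_le_mul_of_nonneg_left hki (sub_nonneg.2 hδI.2)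
    linarith
  have hw : ∀ᶠ w in 𝓝 z, ‖w - d i‖ < δ := by
    have : Continuous fun w : Cn n => ‖w - d i‖ := by fun_prop
    exact (this.tendsto z).eventually (gt_mem_nhds (by rwa [norm_sub_rev]))
  refine limsup_le_of_le (by isBoundedDefault) ?_
  filter_upwards [((hlim.eventually (gt_mem_nhds hlt)).and self_mem_nhdsWithin).prod_mk hw]
    with x hx
  obtain ⟨⟨hx1, hx2⟩, hx3⟩ := hx
  have hxd := real_mul_mem_disc ⟨hx2.1.le, hx2.2⟩ (Circle.norm_coe s).le
  have hv : Integrable (fun s' => (1 - δ) * k (d i) s' + δ * M) arc :=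
    ((hk (d i)).const_mul _).add (integrable_const _)
  have h4 := hullCheck_le_poisson (φ := φ) (isHardy_const p x.2) hv (Eventually.of_forall fun s' =>
    (hconv s').le_near hδI hx3.le (hreal s' (d i)).ge (hM s' (d i) hdz)) hxd
  rw [← hu _ hxd, EReal.coe_le_coe_iff, poisson_add ((hk (d i)).const_mul _) (integrable_const _) hxd,
    poisson_const_mul, poisson_const_real _ hxd] at h4
  exact EReal.coe_le_coe_iff.2 (h4.trans hx1.le)

end Finite

theorem exists_psh_eq_hullHat {p : ℝ≥0∞} (hp : 1 < p) (hp' : p ≠ ∞) {φ : Circle → Cn n → EReal}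
    (hmeas : Measurable (fun x : Circle × Cn n => φ x.1 x.2)) (hconv : ∀ s, IsConvexFn (φ s))
    (hgrowth : UniformGrowth p φ) :
    ∃ u : ℂ × Cn n → ℝ, (∀ t ∈ disc, ∀ w : Cn n, (u (t, w) : EReal) = hullHat φ t w) ∧
      IsPSH (cylinder n) u ∧ BoundaryLE u φ := by
  have heq := fun (t : ℂ) (ht : t ∈ disc) (w : Cn n) => hulls_eq hp hmeas hconv hgrowth ht w
  obtain ⟨⟨c, C, A, hc, hC, hA, hg⟩, -⟩ := hgrowth
  have hup : ∀ s w, φ s w ≤ ((C * ‖w‖ ^ p.toReal + A : ℝ) : EReal) := fun s w =>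
    ((hg s w).1 hp').2
  have hlow : ∀ s w, ((-A : ℝ) : EReal) ≤ φ s w := fun s w => by
    refine le_trans (EReal.coe_le_coe_iff.2 ?_) ((hg s w).1 hp').1
    have : 0 ≤ c * ‖w‖ ^ p.toReal := by positivity
    linarith
  have hle : ∀ t ∈ disc, ∀ w, hullHat φ t w ≤ ((C * ‖w‖ ^ p.toReal + A : ℝ) : EReal) := by
    intro t ht w
    rw [(heq t ht w).2, ← poisson_const_real (C * ‖w‖ ^ p.toReal + A) ht]
    exact hullCheck_le_poisson (isHardy_const p w) (integrable_const _)
      (Eventually.of_forall fun s => hup s w) ht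
  have hge : ∀ t ∈ disc, ∀ w, ((-A : ℝ) : EReal) ≤ hullHat φ t w := by
    intro t ht w
    rw [← (heq t ht w).1]
    have hf₀ : MemLp (fun _ : Circle => (A : ℂ)) 1 arc := memLp_const _
    -- The pair `f = 0`, `f₀ = A` gives the constant `-A`.
    refine le_sSup ⟨fun _ => (A : ℂ), fun _ => 0, fun _ => 0, hf₀, isHardy_const _ 0, ?_, ?_⟩
    · rw [boundaryLE_affineFn_iff (q := p.conjExponent) le_self_add hf₀ (isHardy_const _ 0)]
      exact Eventually.of_forall fun s z => by simpa using hlow s z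
    · simp [affineFn, poisson_const_real A ht]
  set u : ℂ × Cn n → ℝ := fun x => (hullHat φ x.1 x.2).toReal
  have hu : ∀ t ∈ disc, ∀ w : Cn n, (u (t, w) : EReal) = hullHat φ t w := fun t ht w =>
    EReal.coe_toReal ((hle t ht w).trans_lt (EReal.coe_lt_top _)).ne
      (ne_bot_of_le_ne_bot (EReal.coe_ne_bot _) (hge t ht w))
  have huc : ∀ t ∈ disc, ∀ w : Cn n, (u (t, w) : EReal) = hullCheck p φ t w := fun t ht w =>
    (hu t ht w).trans (heq t ht w).2
  refine ⟨u, hu, isPSH_of_isLUB (upperSemicontinuousOn_of_eq_hullCheck hp.le hp' hmeas hconv hC.le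
    hlow hup huc) (A := A) (p := p.toReal) ENNReal.toReal_nonneg hC.le ?_ ?_ ?_,
    boundaryLE_of_eq_hullCheck hmeas hconv hC.le hlow hup huc⟩
  · rintro ⟨t, w⟩ ⟨ht, -⟩
    rw [← EReal.coe_le_coe_iff, hu t ht]
    exact hge t ht w
  · rintro ⟨t, w⟩ ⟨ht, -⟩
    rw [← EReal.coe_le_coe_iff, hu t ht]
    exact hle t ht w
  · rintro ⟨t, w⟩ ⟨ht, -⟩ c hc
    rw [← EReal.coe_lt_coe_iff, hu t ht, ← (heq t ht w).1] at hc
    obtain ⟨_, ⟨f₀, f, b, hf₀, hf, hL, rfl⟩, h2⟩ := lt_sSup_iff.1 hc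
    refine ⟨affineFn f₀ f, isPSH_affineFn hf₀ hf.holo, ?_, EReal.coe_lt_coe_iff.1 h2⟩
    rintro ⟨t', w'⟩ ⟨ht', -⟩
    rw [← EReal.coe_le_coe_iff, hu t' ht', ← (heq t' ht' w').1]
    exact le_sSup ⟨f₀, f, b, hf₀, hf, hL, rfl⟩

end

end ThreeHulls

theorem mainTheorem3 (n : ℕ) (p : ℝ≥0∞) (hp : 1 < p)
    (φ : Circle → ThreeHulls.Cn n → EReal)
    (hmeas : Measurable (fun x : Circle × ThreeHulls.Cn n => φ x.1 x.2))
    (hconv : ∀ s, ThreeHulls.IsConvexFn (φ s))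
    (hgrowth : ThreeHulls.UniformGrowth p φ) :
    (∀ t ∈ ThreeHulls.disc, ∀ w : ThreeHulls.Cn n,
      ThreeHulls.hullTilde p φ t w = ThreeHulls.hullHat φ t w ∧
        ThreeHulls.hullHat φ t w = ThreeHulls.hullCheck p φ t w) ∧
    (p < ∞ → ∃ u : ℂ × ThreeHulls.Cn n → ℝ,
      (∀ t ∈ ThreeHulls.disc, ∀ w : ThreeHulls.Cn n,
        (u (t, w) : EReal) = ThreeHulls.hullHat φ t w) ∧
      ThreeHulls.IsPSH (ThreeHulls.cylinder n) u ∧ ThreeHulls.BoundaryLE u φ) := by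
  refine ⟨fun t ht w => ThreeHulls.hulls_eq hp hmeas hconv hgrowth ht w, fun hp' => ?_⟩
  exact ThreeHulls.exists_psh_eq_hullHat hp hp'.ne hmeas hconv hgrowth
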